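/- Let $W\in\mathbb C[x_1,\dots,x_n]$ be a non-degenerate quasi-homogeneous polynomial: there are rational weights $q_i\in(0,\tfrac12]$ of the variables for which $W$ is quasi-homogeneous of weight $1$, these are the only rational weights with this property, and the only critical point of $W$ is the origin. Let $G_W\le(\mathbb C^*)^n$ be the group of all $\lambda$ with $W(\lambda_1x_1,\dots,\lambda_nx_n)=W(x_1,\dots,x_n)$, let $J_W=(e^{2\pi i q_1},\dots,e^{2\pi i q_n})\in G_W$, and let $G\le G_W$ be a subgroup with $J_W\in G$ (so that $(W,G)$ is an admissible LG pair). Put $\widehat c_W=\sum_{i=1}^n(1-2q_i)$. For $\gamma=(e^{2\pi i\theta_1},\dots,e^{2\pi i\theta_n})\in G$ with $\theta_i\in[0,1)$, let $\mathrm{Fix}(\gamma)\subseteq\mathbb C^n$ be the fixed locus, $N_\gamma$ its dimension, $W_\gamma=W|_{\mathrm{Fix}(\gamma)}$, $d\mathbf x_\gamma$ the standard top form on $\mathrm{Fix}(\gamma)$, $\iota_\gamma=\sum_{i=1}^n(\theta_i-q_i)$, and $$\mathcal H_\gamma=\bigl(\mathrm{Jac}(W_\gamma)\cdot d\mathbf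 x_\gamma\bigr)^G,\qquad \mathcal H_{W,G}=\bigoplus_{\gamma\in G}\mathcal H_\gamma ,$$ where $\mathrm{Jac}$ is the Jacobian algebra and $\lambda\in G$ acts by multiplying both $x_i$ and $dx_i$ by $\lambda_i$. A homogeneous basis of $\mathcal H_{W,G}$ is a basis of elements $\phi_a=[f_a]\,d\mathbf x_{\gamma_a}\in\mathcal H_{\gamma_a}$ with $\gamma_a\in G$ and $f_a$ a polynomial on $\mathrm{Fix}(\gamma_a)$ that is quasi-homogeneous of some weight $d_a$ for the weights $q_i$. Write $$\mu_a^+=d_a+\sum_{i:\,\theta_i(\gamma_a)=0}q_i+\iota_{\gamma_a}-\frac{\widehat c_W}{2}$$ for the eigenvalue on $\phi_a$ of the Hodge grading operator $\theta$, and define $$\mathrm{Str}\bigl(\theta^2-\tfrac14\bigr)=\sum_a(-1)^{N_{\gamma_a}}\bigl(\mu_a^+-\tfrac12\bigr)\bigl(\mu_a^++\tfrac12\bigr),\qquad \chi_{W,G}=\sum_a(-1)^{N_{\gamma_a}} .$$ Then $G$ is finite, $\mathcal H_{W,G}$ has a finite homogeneous basis, and for every finite homogeneous basis the number $\chi_{W,G}$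 is the super-dimension of $\mathcal H_{W,G}$ (the dimension of the span of the sectors $\mathcal H_\gamma$ with $N_\gamma$ even minus that of the span of those with $N_\gamma$ odd), and $$\mathrm{Str}\bigl(\theta^2-\tfrac14\bigr)=\frac{\widehat c_W-3}{12}\,\chi_{W,G}.$$ -/

import Mathlib

namespace LG

open MvPolynomial

/-- The substitution `x i ↦ g i * x i` on polynomials. -/
noncomputable def scale {σ : Type*} (g : σ → ℂˣ) : MvPolynomial σ ℂ →ₐ[ℂ] MvPolynomial σ ℂ :=
  aeval fun i => C (g i : ℂ) * X i

theorem scale_one {σ : Type*} : scale (1 : σ → ℂˣ) = AlgHom.id ℂ (MvPolynomial σ ℂ) := by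
  ext i : 1
  simp [scale]

theorem scale_mul {σ : Type*} (g h : σ → ℂˣ) (p : MvPolynomial σ ℂ) :
    scale (g * h) p = scale g (scale h p) := by
  have : scale (g * h) = (scale g).comp (scale h) := by
    ext i : 1
    simp [scale, algHom_C]
    ring
  rw [this]
  rfl

theorem pderiv_scale {σ : Type*} (g : σ → ℂˣ) (i : σ) (p : MvPolynomial σ ℂ) :
    pderiv i (scale g p) = C (g i : ℂ) * scale g (pderiv i p) := by
  classical
  induction p using MvPolynomial.induction_on with
  | C a => simp [scale]
  | add p q hp hq => simp [hp, hq, mul_add]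
  | mul_X p j hp =>
    have hX : scale g (X j) = C (g j : ℂ) * X j := by simp [scale]
    rw [map_mul, Derivation.leibniz, Derivation.leibniz, hX, hp]
    by_cases hij : j = i
    · subst hij
      simp [scale]
      ring
    · simp [hX, pderiv_X_of_ne hij]
      ring

/-- The group of diagonal symmetries `G_W` of `W`: all `g` in the torus `(ℂˣ)^σ` with
`W(g₁ x₁, …, gₙ xₙ) = W(x₁, …, xₙ)`. -/
noncomputable def diagSym {σ : Type*} (W : MvPolynomial σ ℂ) : Subgroup (σ → ℂˣ) where
  carrier := {g | scale g W = W}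
  one_mem' := by simp [scale_one]
  mul_mem' := by
    intro a b ha hb
    simp only [Set.mem_ofPred_eq] at *
    rw [scale_mul, hb, ha]
  inv_mem' := by
    intro a ha
    simp only [Set.mem_ofPred_eq] at *
    conv_lhs => rw [← ha]
    rw [← scale_mul, inv_mul_cancel, scale_one]
    rfl

/-- `W` is a non-degenerate quasi-homogeneous polynomial whose variables `x i` have the
weights `q i`, normalised so that `W` has weight `1`. -/
structure IsNondegenerate {n : ℕ} (W : MvPolynomial (Fin n) ℂ) (q : Fin n → ℚ) : Prop where
  weight_pos : ∀ i, 0 < q i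
  weight_le_half : ∀ i, q i ≤ 1 / 2
  quasihomogeneous : IsWeightedHomogeneous q W 1
  weights_unique : ∀ q' : Fin n → ℚ, IsWeightedHomogeneous q' W 1 → q' = q
  critical_only_origin : ∀ x : Fin n → ℂ, (∀ i, eval x (pderiv i W) = 0) → x = 0

/-- The element `(exp (2πi q₁), …, exp (2πi qₙ))` of the torus. -/
noncomputable def expWeights {σ : Type*} (q : σ → ℚ) : σ → ℂˣ :=
  fun i => Units.mk0 (Complex.exp (2 * Real.pi * Complex.I * (q i : ℂ))) (Complex.exp_ne_zero _)

theorem expWeights_mem {σ : Type*} {W : MvPolynomial σ ℂ} {q : σ → ℚ}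
    (h : IsWeightedHomogeneous q W 1) : expWeights q ∈ diagSym W := by
  change scale (expWeights q) W = W
  conv_rhs => rw [W.as_sum]
  conv_lhs => rw [W.as_sum]
  rw [map_sum]
  refine Finset.sum_congr rfl fun m hm => ?_
  have hw : Finsupp.weight q m = 1 := h (mem_support_iff.mp hm)
  have key : (m.prod fun i k => ((expWeights q i : ℂˣ) : ℂ) ^ k) = 1 := by
    have h1 : ∀ i, ((expWeights q i : ℂˣ) : ℂ) =
        Complex.exp (2 * Real.pi * Complex.I * (q i : ℂ)) := fun i => rfl
    simp only [h1, Finsupp.prod, ← Complex.exp_nat_mul]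
    rw [← Complex.exp_sum]
    have : ∑ i ∈ m.support, (m i : ℂ) * (2 * Real.pi * Complex.I * (q i : ℂ)) =
        2 * Real.pi * Complex.I * ((Finsupp.weight q m : ℚ) : ℂ) := by
      rw [Finsupp.weight_apply, Finsupp.sum]
      push_cast
      rw [Finset.mul_sum]
      refine Finset.sum_congr rfl fun i _ => ?_
      simp
      ring
    rw [this, hw]
    simp [Complex.exp_two_pi_mul_I]
  rw [scale, aeval_monomial]
  simp only [mul_pow]
  rw [Finsupp.prod_mul]
  have hC : (m.prod fun i k => (C ((expWeights q i : ℂˣ) : ℂ) : MvPolynomial σ ℂ) ^ k) = 1 := by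
    have := congrArg (C : ℂ →+* MvPolynomial σ ℂ) key
    simpa [Finsupp.prod] using this
  rw [hC, one_mul, algebraMap_eq, ← monomial_eq]

/-- The exponential grading element `J_W` as an element of `G_W`. -/
noncomputable def expGrading {n : ℕ} {W : MvPolynomial (Fin n) ℂ} {q : Fin n → ℚ}
    (hW : IsNondegenerate W q) : diagSym W :=
  ⟨expWeights q, expWeights_mem hW.quasihomogeneous⟩

/-- The subgroup `G ≤ G_W` is admissible if it contains `J_W`. -/
def IsAdmissible {n : ℕ} {W : MvPolynomial (Fin n) ℂ} {q : Fin n → ℚ}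
    (hW : IsNondegenerate W q) (G : Subgroup (diagSym W)) : Prop :=
  expGrading hW ∈ G

/-- The ideal generated by all partial derivatives of `W`. -/
noncomputable def jacobianIdeal {σ : Type*} (W : MvPolynomial σ ℂ) :
    Ideal (MvPolynomial σ ℂ) :=
  Ideal.span (Set.range fun i => pderiv i W)

/-- The Jacobian algebra `Jac(W)`. -/
abbrev Jac {σ : Type*} (W : MvPolynomial σ ℂ) : Type _ :=
  MvPolynomial σ ℂ ⧸ jacobianIdeal W

theorem jacobianIdeal_le_comap {σ : Type*} {W : MvPolynomial σ ℂ} (g : diagSym W) :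
    jacobianIdeal W ≤ (jacobianIdeal W).comap (scale (g : σ → ℂˣ)) := by
  rw [jacobianIdeal, Ideal.span_le]
  rintro _ ⟨i, rfl⟩
  have hg : scale (g : σ → ℂˣ) W = W := g.2
  have h := pderiv_scale (g : σ → ℂˣ) i W
  rw [hg] at h
  have h2 : scale (g : σ → ℂˣ) (pderiv i W) =
      C (((g : σ → ℂˣ) i : ℂ)⁻¹) * pderiv i W := by
    conv_rhs => rw [h, ← mul_assoc, ← C_mul, inv_mul_cancel₀ (Units.ne_zero _), C_1, one_mul]
  change scale (g : σ → ℂˣ) (pderiv i W) ∈ Ideal.span _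
  rw [h2]
  exact Ideal.mul_mem_left _ _ (Ideal.subset_span ⟨i, rfl⟩)

/-- The action of `g ∈ G_W` on `Jac(W) · dx`, an element `[f] dx` being recorded by its
coefficient `[f]`. As `g` multiplies both `x i` and `dx i` by `g i`, it sends `[f] dx` to
`(∏ i, g i) [f(g x)] dx`. -/
noncomputable def formAct {σ : Type*} [Fintype σ] {W : MvPolynomial σ ℂ} (g : diagSym W) :
    Jac W →ₗ[ℂ] Jac W :=
  (∏ i, ((g : σ → ℂˣ) i : ℂ)) •
    (Ideal.quotientMapₐ (jacobianIdeal W) (scale (g : σ → ℂˣ))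
      (jacobianIdeal_le_comap g)).toLinearMap

/-- The coordinates fixed by `γ`. The fixed locus `Fix(γ)` is the coordinate subspace of `ℂⁿ`
with these coordinates. -/
abbrev FixIdx {n : ℕ} (γ : Fin n → ℂˣ) : Type := {i : Fin n // γ i = 1}

noncomputable instance {n : ℕ} (γ : Fin n → ℂˣ) : Fintype (FixIdx γ) := Fintype.ofFinite _

/-- `N_γ`, the dimension of `Fix(γ)`. -/
noncomputable def fixDim {n : ℕ} (γ : Fin n → ℂˣ) : ℕ := Fintype.card (FixIdx γ)

open scoped Classical in
/-- Restriction of polynomial functions from `ℂⁿ` to `Fix(γ)`: coordinates not fixed by `γ`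
are set to `0`. -/
noncomputable def restrictFix {n : ℕ} (γ : Fin n → ℂˣ) :
    MvPolynomial (Fin n) ℂ →ₐ[ℂ] MvPolynomial (FixIdx γ) ℂ :=
  aeval fun i => if h : γ i = 1 then X ⟨i, h⟩ else 0

theorem scale_restrictFix {n : ℕ} (γ g : Fin n → ℂˣ) (p : MvPolynomial (Fin n) ℂ) :
    scale (fun i : FixIdx γ => g i) (restrictFix γ p) = restrictFix γ (scale g p) := by
  have : (scale (fun i : FixIdx γ => g i)).comp (restrictFix γ) =
      (restrictFix γ).comp (scale g) := by
    ext i : 1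
    by_cases h : γ i = 1
    · simp [scale, restrictFix, h, algHom_C]
    · simp [scale, restrictFix, h]
  exact DFunLike.congr_fun this p

/-- A diagonal symmetry of `W` restricts to one of `W_γ = W|_{Fix(γ)}`. -/
noncomputable def restrictSym {n : ℕ} {W : MvPolynomial (Fin n) ℂ} (γ : Fin n → ℂˣ)
    (g : diagSym W) : diagSym (restrictFix γ W) :=
  ⟨fun i => (g : Fin n → ℂˣ) i, by
    have hg : scale (g : Fin n → ℂˣ) W = W := g.2
    change scale _ (restrictFix γ W) = restrictFix γ W
    rw [scale_restrictFix, hg]⟩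

/-- The sector `H_γ = (Jac(W_γ) · dx_γ)^G`. -/
noncomputable def sector {n : ℕ} {W : MvPolynomial (Fin n) ℂ} (G : Subgroup (diagSym W))
    (γ : G) : Submodule ℂ (Jac (restrictFix (γ : Fin n → ℂˣ) W)) where
  carrier := {a | ∀ g ∈ G, formAct (restrictSym (γ : Fin n → ℂˣ) g) a = a}
  zero_mem' := by
    intro g _
    exact map_zero _
  add_mem' := by
    intro a b ha hb g hg
    rw [map_add, ha g hg, hb g hg]
  smul_mem' := by
    intro c a ha g hg
    rw [map_smul, ha g hg]

/-- The state space `H_{W,G} = ⨁_{γ ∈ G} H_γ`. -/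
abbrev StateSpace {n : ℕ} {W : MvPolynomial (Fin n) ℂ} (G : Subgroup (diagSym W)) : Type :=
  DirectSum G fun γ => sector G γ

open scoped Classical in
/-- The inclusion `α ↦ α|γ⟩` of the sector `H_γ` into the state space. -/
noncomputable def ket {n : ℕ} {W : MvPolynomial (Fin n) ℂ} (G : Subgroup (diagSym W)) (γ : G) :
    sector G γ →ₗ[ℂ] StateSpace G :=
  DirectSum.lof ℂ G (fun γ => sector G γ) γ

/-- The part of the state space spanned by the sectors with `N_γ ≡ e` modulo `2`. -/
noncomputable def parityPart {n : ℕ} {W : MvPolynomial (Fin n) ℂ} (G : Subgroup (diagSym W))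
    (e : ZMod 2) : Submodule ℂ (StateSpace G) :=
  ⨆ (γ : G) (_ : (fixDim (γ : Fin n → ℂˣ) : ZMod 2) = e), LinearMap.range (ket G γ)

/-- The super-dimension of the state space. -/
noncomputable def superDim {n : ℕ} {W : MvPolynomial (Fin n) ℂ} (G : Subgroup (diagSym W)) : ℤ :=
  (Module.finrank ℂ (parityPart G 0) : ℤ) - (Module.finrank ℂ (parityPart G 1) : ℤ)

/-- The central charge `ĉ_W = ∑ᵢ (1 - 2 qᵢ)`. -/
def centralCharge {n : ℕ} (q : Fin n → ℚ) : ℚ := ∑ i, (1 - 2 * q i)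

/-- The exponent `θ ∈ [0, 1)` with `exp(2πi θ) = z`, for `z` on the unit circle. -/
noncomputable def phase (z : ℂˣ) : ℝ := Int.fract (Complex.arg (z : ℂ) / (2 * Real.pi))

theorem phase_mem (z : ℂˣ) : phase z ∈ Set.Ico (0 : ℝ) 1 :=
  ⟨Int.fract_nonneg _, Int.fract_lt_one _⟩

theorem exp_phase (z : ℂˣ) (hz : ‖(z : ℂ)‖ = 1) :
    Complex.exp (2 * Real.pi * Complex.I * (phase z : ℂ)) = z := by
  have h1 : (2 * Real.pi * Complex.I * (phase z : ℂ) : ℂ) =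
      Complex.arg (z : ℂ) * Complex.I -
        (⌊Complex.arg (z : ℂ) / (2 * Real.pi)⌋ : ℤ) * (2 * Real.pi * Complex.I) := by
    have hpi : (Real.pi : ℂ) ≠ 0 := by exact_mod_cast Real.pi_ne_zero
    rw [phase, Int.fract]
    push_cast
    field_simp
  rw [h1, Complex.exp_sub, Complex.exp_int_mul_two_pi_mul_I, div_one]
  have := Complex.norm_mul_exp_arg_mul_I (z : ℂ)
  rwa [hz, Complex.ofReal_one, one_mul] at this

/-- The degree shift number `ι_γ = ∑ᵢ (θᵢ - qᵢ)`. -/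
noncomputable def degreeShift {n : ℕ} (q : Fin n → ℚ) (γ : Fin n → ℂˣ) : ℝ :=
  ∑ i, (phase (γ i) - (q i : ℝ))

/-- A homogeneous basis `φ_a = [f_a] dx_{γ_a} |γ_a⟩` of the state space: a basis each of whose
members lies in one sector `γ_a` and is represented there by a polynomial `f_a` on `Fix(γ_a)`
that is quasi-homogeneous of some weight `d_a` (for instance a monomial). -/
structure HomogeneousBasis {n : ℕ} {W : MvPolynomial (Fin n) ℂ} (q : Fin n → ℚ)
    (G : Subgroup (diagSym W)) (ι : Type*) where
  basis : Module.Basis ι ℂ (StateSpace G)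
  γ : ι → G
  f : ∀ a, MvPolynomial (FixIdx (γ a : Fin n → ℂˣ)) ℂ
  d : ι → ℚ
  homogeneous : ∀ a, IsWeightedHomogeneous
    (fun i : FixIdx (γ a : Fin n → ℂˣ) => q i) (f a) (d a)
  invariant : ∀ a, Ideal.Quotient.mk (jacobianIdeal (restrictFix (γ a : Fin n → ℂˣ) W)) (f a) ∈
    sector G (γ a)
  basis_eq : ∀ a, basis a = ket G (γ a) ⟨_, invariant a⟩

namespace HomogeneousBasis

/-- The weight `wt(f_a dx_γ)`, where `dx i` has weight `q i`; for a monomial `f_a = x^m` it is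
the sum of `(mᵢ + 1) qᵢ` over the fixed coordinates. -/
noncomputable def wt {n : ℕ} {W : MvPolynomial (Fin n) ℂ} {q : Fin n → ℚ}
    {G : Subgroup (diagSym W)} {ι : Type*} (φ : HomogeneousBasis q G ι) (a : ι) : ℚ :=
  φ.d a + ∑ i : FixIdx (φ.γ a : Fin n → ℂˣ), q i

/-- The Hodge grading `μ_a⁺ = wt(α) + ι_γ - ĉ_W / 2`, the eigenvalue of `θ` on `φ_a`. -/
noncomputable def muPlus {n : ℕ} {W : MvPolynomial (Fin n) ℂ} {q : Fin n → ℚ}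
    {G : Subgroup (diagSym W)} {ι : Type*} (φ : HomogeneousBasis q G ι) (a : ι) : ℝ :=
  (φ.wt a : ℝ) + degreeShift q (φ.γ a : Fin n → ℂˣ) - (centralCharge q : ℝ) / 2

/-- The parity sign `(-1)^{N_γ}` of `φ_a`. -/
noncomputable def sign {n : ℕ} {W : MvPolynomial (Fin n) ℂ} {q : Fin n → ℚ}
    {G : Subgroup (diagSym W)} {ι : Type*} (φ : HomogeneousBasis q G ι) (a : ι) : ℤ :=
  (-1) ^ fixDim (φ.γ a : Fin n → ℂˣ)

/-- The Euler characteristic `χ_{W,G}`, the sum of the parity signs. -/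
noncomputable def eulerChar {n : ℕ} {W : MvPolynomial (Fin n) ℂ} {q : Fin n → ℚ}
    {G : Subgroup (diagSym W)} {ι : Type*} [Fintype ι] (φ : HomogeneousBasis q G ι) : ℤ :=
  ∑ a, φ.sign a

/-- The supertrace `Str(θ² - 1/4)`. -/
noncomputable def supertrace {n : ℕ} {W : MvPolynomial (Fin n) ℂ} {q : Fin n → ℚ}
    {G : Subgroup (diagSym W)} {ι : Type*} [Fintype ι] (φ : HomogeneousBasis q G ι) : ℝ :=
  ∑ a, (φ.sign a : ℝ) * ((φ.muPlus a - 1 / 2) * (φ.muPlus a + 1 / 2))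

end HomogeneousBasis

end LG

/-! Consider the exponential series `∑ a, (-1)^N_a exp (μ_a s)` of a homogeneous basis. Its
coefficients at `s ^ 0` and `s ^ 2` are `χ` and half of the supertrace of `θ²`, so the claim amounts
to `Str θ² = ĉ / 12 * χ`.

The partial derivatives of `W_γ` vanish together only at the origin. They are therefore a
homogeneous system of parameters of a polynomial ring, hence a regular sequence, and the Hilbert
series of `Jac (W_γ)`, graded by weight and by character of `G`, is an explicit product
(`MvPolynomial.prod_mul_finsum_hilb`). Evaluating the characters at `g`, averaging over `g` against
the character of the top form to extract the invariants, and shifting by the degree shift gives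
(`card_mul_sum_sign_mul_expSeries`): `|G|` times the series is the sum over all pairs `γ, g` in `G`
of `∏ i, F_i`. With `w = g i`, the factor is `F_i = (exp (s/2) - w exp ((q i - 1/2) s)) / (1 - w exp
(q i s))` if `γ i = 1`, and `F_i = exp ((θ i - 1/2) s)` otherwise.

Write `log F_i = log a + A s + B s² / 2 + ⋯`. Here `a` is `1 - 1 / q i` if `γ i = g i = 1` and `1`
otherwise; `A` is a sawtooth value of `γ i` or a cotangent value of `g i` (`firstJet`), and `B` is
`1 - 2 q i` times `secondJet`. The `s ^ 2` coefficient of the product is `∏ a * ((∑ A)² + ∑ B) / 2`.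
As `ĉ = ∑ (1 - 2 q i)`, it remains to see that `∏ a * ((∑ A)² + ∑ (1 - 2 q i) (secondJet - 1/12))`
sums to zero over all pairs (`sum_prod_mul_jets`).

Expanding `∏ a` over sets of coordinates reduces this to sums without the product over `K × K`,
where `K ≤ G` is the subgroup on which the chosen coordinates are trivial. For each such `K` the
terms vanish separately. The products `A_i A_j` cancel by the reciprocity between Dedekind sums and
cotangent sums, a form of Parseval's identity for the finite Fourier transform
(`card_mul_sum_sawtooth_add_sum_cotTerm`). The terms in `secondJet` cancel by its diagonal case,
where the sum of squared sawtooth values is elementary.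

Finiteness of `G` comes from the uniqueness of the weights: the exponents of `W` span `ℚ^n`, so some
power of each coordinate is an invariant Laurent monomial. -/

/-! ### Systems of parameters and regular sequences in Noetherian local rings. -/

open RingTheory.Sequence IsLocalRing in
/-- In a Noetherian local ring, avoiding finitely many minimal primes produces a common last
parameter. -/
theorem IsLocalRing.exists_notMem_minimalPrimes {R : Type*} [CommRing R] [IsLocalRing R]
    [IsNoetherianRing R] (I J : Ideal R) (hI : maximalIdeal R ∉ I.minimalPrimes)
    (hJ : maximalIdeal R ∉ J.minimalPrimes) :
    ∃ y ∈ maximalIdeal R, ∀ P, P ∈ I.minimalPrimes ∨ P ∈ J.minimalPrimes → y ∉ P := by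
  classical
  have fin : (I.minimalPrimes ∪ J.minimalPrimes).Finite :=
    I.finite_minimalPrimes_of_isNoetherianRing.union J.finite_minimalPrimes_of_isNoetherianRing
  have hprime : ∀ P ∈ fin.toFinset, P.IsPrime := by
    intro P hP
    rw [Set.Finite.mem_toFinset] at hP
    rcases hP with h | h <;> exact h.1.1
  by_contra! hcon
  have hsub : ((maximalIdeal R : Ideal R) : Set R) ⊆ ⋃ P ∈ (↑fin.toFinset : Set (Ideal R)),
      (P : Set R) := by
    intro y hy
    obtain ⟨P, hP, hyP⟩ := hcon y hy
    simp only [Set.mem_iUnion]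
    exact ⟨P, by simpa using hP, hyP⟩
  obtain ⟨P, hP, hle⟩ := (Ideal.subset_union_prime (f := fun P : Ideal R => P) ⊥ ⊥
    (fun P hP _ _ => hprime P hP)).mp hsub
  have hPm : P = maximalIdeal R :=
    le_antisymm (IsLocalRing.le_maximalIdeal (hprime P hP).ne_top) hle
  rw [Set.Finite.mem_toFinset, hPm] at hP
  exact hP.elim hI hJ

open RingTheory.Sequence IsLocalRing in
-- A regular sequence in the maximal ideal forces the dimension to be at least its length, while
-- Krull's height theorem bounds the height of a prime minimal over `fs` by `fs.length`.
theorem IsLocalRing.maximalIdeal_notMem_minimalPrimes_ofList {R : Type*} [CommRing R]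
    [IsLocalRing R] [IsNoetherianRing R] {xs fs : List R} (hreg : IsWeaklyRegular R xs)
    (hxs : ∀ x ∈ xs, x ∈ maximalIdeal R) (hlen : fs.length < xs.length) :
    maximalIdeal R ∉ (Ideal.ofList fs).minimalPrimes := by
  classical
  intro hmem
  have h1 : (maximalIdeal R).height ≤ fs.length := by
    have hfin : {x | x ∈ fs}.Finite := fs.finite_toSet
    refine (Ideal.height_le_card_of_mem_minimalPrimes_span hfin hmem).trans ?_
    have : {x | x ∈ fs} = (fs.toFinset : Set R) := by ext; simp
    rw [this, Set.ncard_coe_finset]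
    exact_mod_cast fs.toFinset_card_le
  have hreg' : IsRegular R xs :=
    (IsLocalRing.isRegular_iff_isWeaklyRegular_of_subset_maximalIdeal hxs).mpr hreg
  have h2 := ringKrullDim_add_length_eq_ringKrullDim_of_isRegular xs hreg'
  have hne : Ideal.ofList xs ≠ ⊤ := by
    intro h
    have : Ideal.ofList xs ≤ maximalIdeal R := Ideal.span_le.mpr hxs
    exact (maximalIdeal.isMaximal R).ne_top (top_le_iff.mp (h ▸ this))
  have : Nontrivial (R ⧸ Ideal.ofList xs) := Ideal.Quotient.nontrivial_iff.mpr hne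
  have h3 : 0 ≤ ringKrullDim (R ⧸ Ideal.ofList xs) := ringKrullDim_nonneg_of_nontrivial
  rw [← IsLocalRing.maximalIdeal_height_eq_ringKrullDim (R := R)] at h2
  have h4 : ((xs.length : ℕ∞) : WithBot ℕ∞) ≤ ((maximalIdeal R).height : WithBot ℕ∞) := by
    rw [← h2]
    calc ((xs.length : ℕ∞) : WithBot ℕ∞) = 0 + (xs.length : WithBot ℕ∞) := by simp
      _ ≤ _ := by gcongr
  have h5 : (xs.length : ℕ∞) ≤ fs.length := (WithBot.coe_le_coe.mp h4).trans h1
  have : xs.length ≤ fs.length := by exact_mod_cast h5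
  omega

open RingTheory.Sequence IsLocalRing in
-- Exchange of the last parameter. As the maximal ideal is minimal over `fs` and `b`, any smaller
-- prime containing `fs` is minimal over `fs`, and such primes avoid `y`.
theorem Ideal.maximalIdeal_le_radical_of_notMem_minimalPrimes {R : Type*} [CommRing R]
    [IsLocalRing R] [IsNoetherianRing R] {fs : List R} {b y : R}
    (hb : maximalIdeal R ≤ (Ideal.ofList (fs ++ [b])).radical)
    (hbm : ∀ f ∈ fs ++ [b], f ∈ maximalIdeal R)
    (hy : ∀ P ∈ (Ideal.ofList fs).minimalPrimes, y ∉ P) :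
    maximalIdeal R ≤ (Ideal.ofList (fs ++ [y])).radical := by
  rw [Ideal.radical_eq_sInf]
  refine le_sInf ?_
  rintro Q ⟨hQ, hQp⟩
  by_contra hne
  have hQlt : Q < maximalIdeal R := by
    refine lt_of_le_of_ne (IsLocalRing.le_maximalIdeal hQp.ne_top) ?_
    rintro rfl
    exact hne le_rfl
  have hset : ∀ c : R, Ideal.ofList (fs ++ [c]) = Ideal.span (insert c {x | x ∈ fs}) := by
    intro c
    rw [Ideal.ofList]
    congr 1
    ext x
    simp [or_comm]
  have hmin : maximalIdeal R ∈ (Ideal.span (insert b {x | x ∈ fs})).minimalPrimes := by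
    rw [← hset]
    refine ⟨⟨(maximalIdeal.isMaximal R).isPrime, Ideal.span_le.mpr hbm⟩, ?_⟩
    rintro P ⟨hP, hPle⟩ _
    exact hb.trans (hP.radical_le_iff.mpr hPle)
  have ht : {x | x ∈ fs} ⊆ (Q : Set R) := fun x hx =>
    hQ (Ideal.subset_span (by simp_all))
  have := Ideal.mem_minimalPrimes_span_of_mem_minimalPrimes_span_insert hQlt b {x | x ∈ fs} hmin
    {x | x ∈ fs} ht (fun x hx => Ideal.le_radical (Ideal.subset_span (Set.mem_insert_of_mem _ hx)))
  exact hy Q this (hQ (Ideal.subset_span (by simp)))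

open RingTheory.Sequence IsLocalRing in
-- Modulo `fs`, a power of `a` is a multiple of `y`, so whatever `y` kills is killed by a power of
-- the regular element `a`.
theorem RingTheory.Sequence.IsWeaklyRegular.append_singleton_of_pow_mem {R : Type*} [CommRing R]
    {fs : List R} {a y : R} (h : IsWeaklyRegular R (fs ++ [a])) {k : ℕ}
    (hk : a ^ k ∈ Ideal.ofList (fs ++ [y])) : IsWeaklyRegular R (fs ++ [y]) := by
  rw [isWeaklyRegular_append_iff, isWeaklyRegular_singleton_iff] at h ⊢
  refine ⟨h.1, ?_⟩
  have ha := h.2.pow k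
  rw [Ideal.ofList_append, Ideal.ofList_singleton, Submodule.mem_sup] at hk
  obtain ⟨u, hu, v, hv, huv⟩ := hk
  obtain ⟨z, rfl⟩ := Ideal.mem_span_singleton'.mp hv
  rw [isSMulRegular_iff_right_eq_zero_of_smul] at ha ⊢
  intro m hm
  refine ha m ?_
  rw [← huv, add_smul, mul_smul, hm, smul_zero, add_zero]
  obtain ⟨m, rfl⟩ := Submodule.Quotient.mk_surjective _ m
  rw [← Submodule.Quotient.mk_smul, Submodule.Quotient.mk_eq_zero]
  exact Submodule.smul_mem_smul hu trivial

open RingTheory.Sequence IsLocalRing in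
theorem RingTheory.Sequence.isWeaklyRegular_cons_iff_quotient_span {R : Type*} [CommRing R]
    (y : R) (fs : List R) :
    IsWeaklyRegular R (y :: fs) ↔ IsSMulRegular R y ∧
      IsWeaklyRegular (R ⧸ Ideal.span {y}) (fs.map (Ideal.Quotient.mk (Ideal.span {y}))) := by
  rw [isWeaklyRegular_cons_iff]
  refine and_congr_right fun _ => ?_
  have e : QuotSMulTop y R ≃ₗ[R] (R ⧸ Ideal.span {y}) :=
    Submodule.quotEquivOfEq _ _ (by
      rw [← Submodule.ideal_span_singleton_smul]; simp)
  rw [e.isWeaklyRegular_congr]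
  exact (isWeaklyRegular_map_algebraMap_iff (R := R) (S := R ⧸ Ideal.span {y})
    (M := R ⧸ Ideal.span {y}) fs).symm

open RingTheory.Sequence IsLocalRing in
/-- If the maximal ideal of a Noetherian local ring is, up to radical, generated by a regular
sequence, then every system of parameters of the same length is a regular sequence. -/
theorem IsLocalRing.isWeaklyRegular_of_maximalIdeal_le_radical {R : Type*} [CommRing R]
    [IsLocalRing R] [IsNoetherianRing R] {xs fs : List R} (hreg : IsWeaklyRegular R xs)
    (hxs : ∀ x ∈ xs, x ∈ maximalIdeal R) (hx : maximalIdeal R ≤ (Ideal.ofList xs).radical)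
    (hfs : ∀ f ∈ fs, f ∈ maximalIdeal R) (hf : maximalIdeal R ≤ (Ideal.ofList fs).radical)
    (hlen : xs.length = fs.length) : IsWeaklyRegular R fs := by
  obtain ⟨N, hN⟩ : ∃ N, N = xs.length := ⟨_, rfl⟩
  induction N generalizing R with
  | zero =>
    have : fs = [] := List.length_eq_zero_iff.mp (by omega)
    subst this
    exact IsWeaklyRegular.nil R R
  | succ N ih =>
    obtain rfl | ⟨xs, a, rfl⟩ := List.eq_nil_or_concat' xs
    · simp at hN
    obtain rfl | ⟨fs, b, rfl⟩ := List.eq_nil_or_concat' fs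
    · simp at hlen
    simp only [List.length_append, List.length_singleton, add_left_inj] at hN hlen
    -- Both sequences are given the same last element `y`. It is then moved to the front and divided
    -- out, so that the induction hypothesis applies to the quotient; at the end `y` is exchanged
    -- back for `b`.
    obtain ⟨y, hym, hy⟩ := IsLocalRing.exists_notMem_minimalPrimes (Ideal.ofList xs)
      (Ideal.ofList fs)
      (IsLocalRing.maximalIdeal_notMem_minimalPrimes_ofList hreg hxs (by simp))
      (IsLocalRing.maximalIdeal_notMem_minimalPrimes_ofList hreg hxs (by simp; omega))
    have hxy := Ideal.maximalIdeal_le_radical_of_notMem_minimalPrimes hx hxs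
      (fun P hP => hy P (Or.inl hP))
    have hfy := Ideal.maximalIdeal_le_radical_of_notMem_minimalPrimes hf hfs
      (fun P hP => hy P (Or.inr hP))
    obtain ⟨k, hk⟩ := hxy (hxs a (by simp))
    have hreg1 := hreg.append_singleton_of_pow_mem hk
    have hxs' : ∀ x ∈ xs ++ [y], x ∈ maximalIdeal R := by
      intro x hx
      rcases List.mem_append.mp hx with h | h
      · exact hxs x (by simp [h])
      · simp_all
    have hreg2 : IsWeaklyRegular R (y :: xs) :=
      isWeaklyRegular_of_perm_of_subset_maximalIdeal hreg1 (List.perm_append_singleton y xs) hxs'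
    rw [isWeaklyRegular_cons_iff_quotient_span] at hreg2
    have hyne : Ideal.span {y} ≠ ⊤ := by
      rw [Ne, Ideal.span_singleton_eq_top]
      exact hym
    have : Nontrivial (R ⧸ Ideal.span {y}) := Ideal.Quotient.nontrivial_iff.mpr hyne
    let π := Ideal.Quotient.mk (Ideal.span {y})
    have hπ : Function.Surjective π := Ideal.Quotient.mk_surjective
    have : IsLocalRing (R ⧸ Ideal.span {y}) := IsLocalRing.of_surjective' π hπ
    have hloc : IsLocalHom π := IsLocalHom.of_surjective π hπ
    have hmem : ∀ l : List R, (∀ x ∈ l, x ∈ maximalIdeal R) →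
        ∀ x ∈ l.map π, x ∈ maximalIdeal (R ⧸ Ideal.span {y}) := by
      intro l hl x hx
      obtain ⟨z, hz, rfl⟩ := List.mem_map.mp hx
      exact map_nonunit π z (hl z hz)
    have hrad : ∀ l : List R, maximalIdeal R ≤ (Ideal.ofList (l ++ [y])).radical →
        maximalIdeal (R ⧸ Ideal.span {y}) ≤ (Ideal.ofList (l.map π)).radical := by
      intro l hl z hz
      obtain ⟨z, rfl⟩ := hπ z
      have hz' : z ∈ maximalIdeal R := by
        rw [mem_maximalIdeal, mem_nonunits_iff] at hz ⊢
        exact fun hu => hz (hu.map π)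
      obtain ⟨k, hk⟩ := hl hz'
      refine ⟨k, ?_⟩
      have := Ideal.mem_map_of_mem π hk
      rw [Ideal.map_ofList, List.map_append, Ideal.ofList_append, List.map_singleton,
        Ideal.ofList_singleton, show π y = 0 from
          Ideal.Quotient.eq_zero_iff_mem.mpr (Ideal.mem_span_singleton_self y)] at this
      simpa using this
    have key := ih hreg2.2 (hmem xs fun x h => hxs x (by simp [h])) (hrad xs hxy)
      (hmem fs fun x h => hfs x (by simp [h])) (hrad fs hfy) (by simpa using hlen) (by simpa using hN)
    have hreg3 : IsWeaklyRegular R (y :: fs) :=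
      (isWeaklyRegular_cons_iff_quotient_span y fs).mpr ⟨hreg2.1, key⟩
    have hfs' : ∀ x ∈ y :: fs, x ∈ maximalIdeal R := by
      intro x hx
      rcases List.mem_cons.mp hx with h | h
      · exact h ▸ hym
      · exact hfs x (by simp [h])
    have hreg4 : IsWeaklyRegular R (fs ++ [y]) :=
      isWeaklyRegular_of_perm_of_subset_maximalIdeal hreg3 (List.perm_append_singleton y fs).symm
        hfs'
    obtain ⟨k, hk⟩ := hf hym
    exact hreg4.append_singleton_of_pow_mem hk

/-! ### Hilbert functions for a grading by an abelian group with finite fibres. -/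

namespace MvPolynomial

section Graded

variable {σ k Γ : Type*} [Field k] [AddCommGroup Γ]

attribute [local instance] MvPolynomial.weightedGradedAlgebra

theorem weightedHomogeneousComponent_add_mul_left {w : σ → Γ} {δ γ : Γ} {f p : MvPolynomial σ k}
    (hf : IsWeightedHomogeneous w f δ) :
    weightedHomogeneousComponent w (δ + γ) (f * p) = f * weightedHomogeneousComponent w γ p := by
  classical
  have := DirectSum.coe_decompose_mul_add_of_left_mem (weightedHomogeneousSubmodule k w)
    (i := δ) (j := γ) (a := f) (b := p) hf
  rw [← weightedDecomposition.decompose'_apply, ← weightedDecomposition.decompose'_apply]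
  exact this

/-- An ideal stable under taking weighted homogeneous components. -/
def IsHomogeneousIdeal (w : σ → Γ) (I : Ideal (MvPolynomial σ k)) : Prop :=
  ∀ p ∈ I, ∀ γ, weightedHomogeneousComponent w γ p ∈ I

theorem isHomogeneousIdeal_span {w : σ → Γ} {s : Set (MvPolynomial σ k)}
    (hs : ∀ f ∈ s, ∃ δ, IsWeightedHomogeneous w f δ) : IsHomogeneousIdeal w (Ideal.span s) := by
  classical
  have : (Ideal.span s).IsHomogeneous (weightedHomogeneousSubmodule k w) :=
    Ideal.homogeneous_span _ _ fun f hf => hs f hf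
  intro p hp γ
  exact weightedHomogeneousComponent_mem_of_mem k w this hp γ

/-- The part of weight `γ` of an ideal. -/
noncomputable def idealPart (w : σ → Γ) (I : Ideal (MvPolynomial σ k)) (γ : Γ) :
    Submodule k (MvPolynomial σ k) :=
  weightedHomogeneousSubmodule k w γ ⊓ I.restrictScalars k

theorem mem_idealPart {w : σ → Γ} {I : Ideal (MvPolynomial σ k)} {γ : Γ} {p : MvPolynomial σ k} :
    p ∈ idealPart w I γ ↔ IsWeightedHomogeneous w p γ ∧ p ∈ I := Iff.rfl

/-- The Hilbert function of the quotient by an ideal. -/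
noncomputable def hilb (w : σ → Γ) (I : Ideal (MvPolynomial σ k)) (γ : Γ) : ℤ :=
  Module.finrank k (weightedHomogeneousSubmodule k w γ) - Module.finrank k (idealPart w I γ)

theorem finiteDimensional_weightedHomogeneousSubmodule {w : σ → Γ}
    (hw : ∀ γ, {m : σ →₀ ℕ | Finsupp.weight w m = γ}.Finite) (γ : Γ) :
    FiniteDimensional k (weightedHomogeneousSubmodule k w γ) := by
  rw [weightedHomogeneousSubmodule_eq_finsupp_supported]
  have := (hw γ).to_subtype
  exact Module.Finite.of_basis (basisRestrictSupport k {d | Finsupp.weight w d = γ})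

/-- Multiplication by `f` gives the exact sequence of the quotients by `I`, `I` and `I + (f)`,
expressed here by the dimension formula for a sum and an intersection in one degree. Only
homogeneous elements are tested for regularity. -/
theorem hilb_sup_span_singleton {w : σ → Γ}
    (hw : ∀ γ, {m : σ →₀ ℕ | Finsupp.weight w m = γ}.Finite) {I : Ideal (MvPolynomial σ k)}
    (hI : IsHomogeneousIdeal w I) {f : MvPolynomial σ k} {δ : Γ} (hf : IsWeightedHomogeneous w f δ)
    (hf0 : f ≠ 0) (hreg : ∀ γ h, IsWeightedHomogeneous w h γ → f * h ∈ I → h ∈ I) (γ : Γ) :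
    hilb w (I ⊔ Ideal.span {f}) γ = hilb w I γ - hilb w I (γ - δ) := by
  have hfin := finiteDimensional_weightedHomogeneousSubmodule (k := k) hw
  have hfinI : ∀ J : Ideal (MvPolynomial σ k), ∀ γ, FiniteDimensional k (idealPart w J γ) :=
    fun J γ => Submodule.finiteDimensional_of_le (inf_le_left (b := J.restrictScalars k))
  let μ : MvPolynomial σ k →ₗ[k] MvPolynomial σ k := LinearMap.mulLeft k f
  have hμ : Function.Injective μ := mul_right_injective₀ hf0
  have hsup : idealPart w (I ⊔ Ideal.span {f}) γ =
      idealPart w I γ ⊔ (weightedHomogeneousSubmodule k w (γ - δ)).map μ := by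
    apply le_antisymm
    · rintro p ⟨hp, hpI⟩
      obtain ⟨u, hu, v, hv, rfl⟩ := Submodule.mem_sup.mp (show p ∈ I ⊔ Ideal.span {f} from hpI)
      obtain ⟨v, rfl⟩ := Ideal.mem_span_singleton.mp hv
      refine Submodule.mem_sup.mpr ⟨weightedHomogeneousComponent w γ u,
        ⟨weightedHomogeneousComponent_mem w u γ, hI u hu γ⟩, _,
        ⟨weightedHomogeneousComponent w (γ - δ) v,
          weightedHomogeneousComponent_mem w v (γ - δ), rfl⟩, ?_⟩
      change _ + f * _ = _
      rw [← weightedHomogeneousComponent_add_mul_left hf, add_sub_cancel, ← map_add]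
      exact weightedHomogeneousComponent_eq_self hp
    · refine sup_le (fun p hp => ⟨hp.1, Ideal.mem_sup_left hp.2⟩) ?_
      rintro _ ⟨v, hv, rfl⟩
      refine ⟨?_, Ideal.mem_sup_right (Ideal.mem_span_singleton.mpr ⟨v, rfl⟩)⟩
      have := IsWeightedHomogeneous.mul hf hv
      rwa [add_sub_cancel] at this
  have hinf : idealPart w I γ ⊓ (weightedHomogeneousSubmodule k w (γ - δ)).map μ =
      (idealPart w I (γ - δ)).map μ := by
    apply le_antisymm
    · rintro _ ⟨hp, v, hv, rfl⟩
      exact ⟨v, ⟨hv, hreg _ v hv hp.2⟩, rfl⟩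
    · rintro _ ⟨v, hv, rfl⟩
      refine ⟨⟨?_, I.mul_mem_left f hv.2⟩, v, hv.1, rfl⟩
      have := IsWeightedHomogeneous.mul hf hv.1
      rwa [add_sub_cancel] at this
  have h1 := Submodule.finrank_sup_add_finrank_inf_eq (idealPart w I γ)
    ((weightedHomogeneousSubmodule k w (γ - δ)).map μ)
  have hmap : ∀ V : Submodule k (MvPolynomial σ k),
      Module.finrank k (V.map μ) = Module.finrank k V := fun V =>
    (Submodule.equivMapOfInjective μ hμ V).finrank_eq.symm
  rw [← hsup, hinf, hmap, hmap] at h1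
  simp only [hilb]
  omega

/-- The multiples of a nonzero exponent of weight zero would all lie in the fibre over zero. -/
theorem coeff_zero_eq_of_finite_weight {w : σ → Γ}
    (hw : ∀ γ, {m : σ →₀ ℕ | Finsupp.weight w m = γ}.Finite) {m : σ →₀ ℕ}
    (hm : Finsupp.weight w m = 0) : m = 0 := by
  by_contra hne
  refine Set.infinite_of_injective_forall_mem (f := fun j : ℕ => j • m) ?_ ?_ (hw 0)
  · intro a b hab
    obtain ⟨i, hi⟩ := Finsupp.ne_iff.mp hne
    have := DFunLike.congr_fun hab i
    simpa [show m i ≠ 0 from hi] using this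
  · intro j
    simp [hm]

theorem weightedHomogeneousComponent_zero_of_finite {w : σ → Γ}
    (hw : ∀ γ, {m : σ →₀ ℕ | Finsupp.weight w m = γ}.Finite) (p : MvPolynomial σ k) :
    weightedHomogeneousComponent w 0 p = C (coeff 0 p) := by
  classical
  ext m
  rw [coeff_weightedHomogeneousComponent, coeff_C]
  by_cases hm : m = 0
  · simp [hm]
  · rw [if_neg (fun h => hm (coeff_zero_eq_of_finite_weight hw h)), if_neg (Ne.symm hm)]

/-- The degree zero part of `s` is a nonzero constant, so a component of `h * s` is a nonzero
multiple of `h`. This removes denominators after localising at the origin. -/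
theorem mem_of_mul_mem_of_coeff_zero_ne_zero {w : σ → Γ}
    (hw : ∀ γ, {m : σ →₀ ℕ | Finsupp.weight w m = γ}.Finite) {I : Ideal (MvPolynomial σ k)}
    (hI : IsHomogeneousIdeal w I) {h s : MvPolynomial σ k} {γ : Γ}
    (hh : IsWeightedHomogeneous w h γ) (hs : coeff 0 s ≠ 0) (hmem : h * s ∈ I) : h ∈ I := by
  have := hI _ hmem (γ + 0)
  rw [weightedHomogeneousComponent_add_mul_left hh,
    weightedHomogeneousComponent_zero_of_finite hw] at this
  have h2 := I.mul_mem_right (C (coeff 0 s)⁻¹) this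
  rwa [mul_assoc, ← C_mul, mul_inv_cancel₀ hs, C_1, mul_one] at h2

end Graded

/-! ### Hilbert series of graded complete intersections. -/

section Koszul

variable {σ k Γ : Type*} [Field k] [AddCommGroup Γ]

open RingTheory.Sequence

theorem isWeaklyRegular_map_X (l : List σ) (hl : l.Nodup) :
    IsWeaklyRegular (MvPolynomial σ k) (l.map (X : σ → MvPolynomial σ k)) := by
  induction l using List.reverseRecOn with
  | nil => exact IsWeaklyRegular.nil _ _
  | append_singleton l i ih =>
    rw [List.map_append, List.map_singleton, isWeaklyRegular_append_iff,
      isWeaklyRegular_singleton_iff]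
    refine ⟨ih (List.nodup_append.mp hl).1, ?_⟩
    have hil : i ∉ l := fun h => (List.nodup_append.mp hl).2.2 i h i (by simp) rfl
    have hspan : Ideal.ofList (l.map X : List (MvPolynomial σ k)) =
        Ideal.span (X '' {j | j ∈ l}) := by
      rw [Ideal.ofList]
      congr 1
      ext
      simp
    rw [isSMulRegular_iff_right_eq_zero_of_smul]
    intro p hp
    obtain ⟨p, rfl⟩ := Submodule.Quotient.mk_surjective _ p
    rw [← Submodule.Quotient.mk_smul, Submodule.Quotient.mk_eq_zero] at hp
    rw [Submodule.Quotient.mk_eq_zero]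
    simp only [smul_eq_mul, Ideal.mul_top, hspan, mem_ideal_span_X_image] at hp ⊢
    intro m hm
    obtain ⟨j, hj, hjm⟩ := hp (Finsupp.single i 1 + m) (by
      rw [mem_support_iff, coeff_X_mul]
      exact mem_support_iff.mp hm)
    refine ⟨j, hj, ?_⟩
    have hij : i ≠ j := fun h => hil (h ▸ hj)
    simpa [Finsupp.single_apply, hij] using hjm

/-- The ideal of the origin. -/
noncomputable def originIdeal (σ k : Type*) [Field k] : Ideal (MvPolynomial σ k) :=
  RingHom.ker (constantCoeff : MvPolynomial σ k →+* k)

instance : (originIdeal σ k).IsMaximal :=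
  RingHom.ker_isMaximal_of_surjective _ fun a => ⟨C a, constantCoeff_C σ a⟩

theorem mem_originIdeal {p : MvPolynomial σ k} : p ∈ originIdeal σ k ↔ coeff 0 p = 0 := Iff.rfl

theorem originIdeal_eq_span : originIdeal σ k = Ideal.span (Set.range X) := by
  ext p
  rw [← Set.image_univ, mem_ideal_span_X_image, mem_originIdeal]
  constructor
  · intro h m hm
    by_contra! hcon
    have : m = 0 := by
      ext i
      exact hcon i trivial
    subst this
    exact mem_support_iff.mp hm h
  · intro h
    by_contra hne
    obtain ⟨i, -, hi⟩ := h 0 (mem_support_iff.mpr hne)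
    exact hi rfl

/-- The variables are a regular sequence generating the maximal ideal of the local ring at the
origin, and `f` is a system of parameters of the same length. -/
theorem isWeaklyRegular_localization [Fintype σ] {f : σ → MvPolynomial σ k}
    (hf : ∀ i, f i ∈ originIdeal σ k)
    (hrad : ∀ i, (X i : MvPolynomial σ k) ∈ (Ideal.span (Set.range f)).radical) :
    IsWeaklyRegular (Localization.AtPrime (originIdeal σ k))
      (((Finset.univ.toList.map f)).map
        (algebraMap _ (Localization.AtPrime (originIdeal σ k)))) := by
  set L := Localization.AtPrime (originIdeal σ k)
  have hmax : IsLocalRing.maximalIdeal L = (originIdeal σ k).map (algebraMap _ L) :=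
    (Localization.AtPrime.map_eq_maximalIdeal (I := originIdeal σ k)).symm
  have hmem : ∀ g : σ → MvPolynomial σ k, (∀ i, g i ∈ originIdeal σ k) →
      ∀ x ∈ (Finset.univ.toList.map g).map (algebraMap _ L), x ∈ IsLocalRing.maximalIdeal L := by
    intro g hg x hx
    simp only [List.map_map, List.mem_map, Finset.mem_toList, Finset.mem_univ, true_and] at hx
    obtain ⟨i, rfl⟩ := hx
    rw [hmax]
    exact Ideal.mem_map_of_mem _ (hg i)
  have hlist : ∀ g : σ → MvPolynomial σ k, Ideal.ofList ((Finset.univ.toList.map g).map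
      (algebraMap _ L)) = (Ideal.span (Set.range g)).map (algebraMap _ L) := by
    intro g
    rw [← Ideal.map_ofList, Ideal.ofList]
    congr 3
    ext
    simp
  have hr : ∀ g : σ → MvPolynomial σ k,
      (∀ i, (X i : MvPolynomial σ k) ∈ (Ideal.span (Set.range g)).radical) →
      IsLocalRing.maximalIdeal L ≤ (Ideal.ofList ((Finset.univ.toList.map g).map
        (algebraMap _ L))).radical := by
    intro g hg
    rw [hmax, hlist]
    refine (Ideal.map_mono (?_ : originIdeal σ k ≤ (Ideal.span (Set.range g)).radical)).trans
      (Ideal.map_radical_le _)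
    rw [originIdeal_eq_span, Ideal.span_le]
    rintro _ ⟨i, rfl⟩
    exact hg i
  refine IsLocalRing.isWeaklyRegular_of_maximalIdeal_le_radical
    (xs := (Finset.univ.toList.map X).map (algebraMap _ L))
    ((isWeaklyRegular_map_X _ (Finset.nodup_toList _)).of_isLocalization L
      (originIdeal σ k).primeCompl)
    (hmem X ?_) (hr X ?_) (hmem f hf) (hr f hrad) (by simp)
  · intro i
    rw [originIdeal_eq_span]
    exact Ideal.subset_span ⟨i, rfl⟩
  · intro i
    exact Ideal.le_radical (Ideal.subset_span ⟨i, rfl⟩)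

/-- The difference operator with step `δ`. -/
def backwardDiff (h : Γ → ℤ) (δ : Γ) : Γ → ℤ := fun γ => h γ - h (γ - δ)

theorem foldl_backwardDiff (h : Γ → ℤ) (δ : Γ) (l : List Γ) :
    l.foldl backwardDiff (backwardDiff h δ) = backwardDiff (l.foldl backwardDiff h) δ := by
  induction l generalizing h with
  | nil => rfl
  | cons ε l ih =>
    rw [List.foldl_cons, List.foldl_cons, ← ih]
    congr 1
    ext γ
    simp only [backwardDiff]
    rw [sub_right_comm γ δ ε]
    ring

theorem foldl_backwardDiff_comm (h : Γ → ℤ) (l l' : List Γ) :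
    l.foldl backwardDiff (l'.foldl backwardDiff h) =
      l'.foldl backwardDiff (l.foldl backwardDiff h) := by
  induction l generalizing h with
  | nil => rfl
  | cons ε l ih => rw [List.foldl_cons, List.foldl_cons, ← ih, foldl_backwardDiff _ _ l']

theorem finite_support_backwardDiff {h : Γ → ℤ} (hh : h.support.Finite) (δ : Γ) :
    (backwardDiff h δ).support.Finite := by
  have h2 : (fun γ => h (γ - δ)).support.Finite :=
    hh.preimage (f := fun γ => γ - δ) (sub_left_injective.injOn)
  exact (hh.union h2).subset (Function.support_sub _ _)

theorem finsum_backwardDiff {A : Type*} [CommRing A] (c : Multiplicative Γ →* A) {h : Γ → ℤ}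
    (hh : h.support.Finite) (δ : Γ) :
    ∑ᶠ γ, (backwardDiff h δ γ : A) * c (.ofAdd γ) =
      (1 - c (.ofAdd δ)) * ∑ᶠ γ, (h γ : A) * c (.ofAdd γ) := by
  have hs : (fun γ => (h γ : A) * c (.ofAdd γ)).support.Finite :=
    hh.subset fun γ hγ h0 => hγ (by simp [h0])
  have h1 : ∑ᶠ γ, (h (γ - δ) : A) * c (.ofAdd γ) =
      c (.ofAdd δ) * ∑ᶠ γ, (h γ : A) * c (.ofAdd γ) := by
    rw [mul_finsum' _ _ hs, ← finsum_comp_equiv (Equiv.subRight δ)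
      (f := fun γ => _ * ((h γ : A) * c (.ofAdd γ)))]
    refine finsum_congr fun γ => ?_
    simp only [Equiv.subRight_apply]
    rw [mul_left_comm, ← map_mul, ← ofAdd_add, add_sub_cancel]
  have hs' : (fun γ => (h (γ - δ) : A) * c (.ofAdd γ)).support.Finite :=
    (hh.preimage (f := fun γ => γ - δ) (sub_left_injective.injOn)).subset
      fun γ hγ h0 => hγ (by simp [h0])
  rw [sub_mul, one_mul, ← h1, ← finsum_sub_distrib hs hs']
  refine finsum_congr fun γ => ?_
  simp only [backwardDiff]
  push_cast
  ring

theorem finsum_foldl_backwardDiff {A : Type*} [CommRing A] (c : Multiplicative Γ →* A)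
    {h : Γ → ℤ} (hh : h.support.Finite) (l : List Γ) :
    ∑ᶠ γ, (l.foldl backwardDiff h γ : A) * c (.ofAdd γ) =
      (l.map fun δ => 1 - c (.ofAdd δ)).prod * ∑ᶠ γ, (h γ : A) * c (.ofAdd γ) := by
  induction l generalizing h with
  | nil => simp
  | cons ε l ih =>
    rw [List.foldl_cons, ih (finite_support_backwardDiff hh ε), finsum_backwardDiff c hh,
      List.map_cons, List.prod_cons]
    ring

/-- Each member of a regular sequence applies one difference operator. Regularity is assumed only in
the local ring at the origin; for homogeneous elements it descends to the polynomial ring. -/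
theorem hilb_ofList {w : σ → Γ} (hw : ∀ γ, {m : σ →₀ ℕ | Finsupp.weight w m = γ}.Finite)
    {f : σ → MvPolynomial σ k} {δ : σ → Γ} (hf : ∀ i, IsWeightedHomogeneous w (f i) (δ i))
    (hf0 : ∀ i, f i ∈ originIdeal σ k) (l : List σ)
    (hreg : IsWeaklyRegular (Localization.AtPrime (originIdeal σ k))
      ((l.map f).map (algebraMap _ (Localization.AtPrime (originIdeal σ k))))) :
    hilb w (Ideal.ofList (l.map f)) =
      (l.map δ).foldl backwardDiff (hilb w (⊥ : Ideal (MvPolynomial σ k))) := by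
  induction l using List.reverseRecOn with
  | nil => simp
  | append_singleton l i ih =>
    rw [List.map_append, List.map_append, isWeaklyRegular_append_iff] at hreg
    rw [List.map_append, List.map_append, Ideal.ofList_append, List.foldl_append, ← ih hreg.1]
    simp only [List.map_singleton, Ideal.ofList_singleton, List.foldl_cons, List.foldl_nil]
    have hreg2 := hreg.2
    simp only [List.map_singleton] at hreg2
    rw [isWeaklyRegular_singleton_iff, isSMulRegular_iff_right_eq_zero_of_smul] at hreg2
    have hle : Ideal.ofList (l.map f) ≤ originIdeal σ k := by
      rw [Ideal.ofList, Ideal.span_le]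
      intro x hx
      obtain ⟨j, -, rfl⟩ := List.mem_map.mp hx
      exact hf0 j
    have hI : IsHomogeneousIdeal w (Ideal.ofList (l.map f)) := by
      refine isHomogeneousIdeal_span fun x hx => ?_
      obtain ⟨j, -, rfl⟩ := List.mem_map.mp hx
      exact ⟨δ j, hf j⟩
    have key : ∀ γ h, IsWeightedHomogeneous w h γ → f i * h ∈ Ideal.ofList (l.map f) →
        h ∈ Ideal.ofList (l.map f) := by
      intro γ h hh hmem
      have h1 := hreg2 (Submodule.Quotient.mk
        (algebraMap (MvPolynomial σ k) (Localization.AtPrime (originIdeal σ k)) h)) (by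
        rw [← Submodule.Quotient.mk_smul, Submodule.Quotient.mk_eq_zero]
        simp only [smul_eq_mul, Ideal.mul_top]
        rw [← map_mul, ← Ideal.map_ofList]
        exact Ideal.mem_map_of_mem _ hmem)
      rw [Submodule.Quotient.mk_eq_zero] at h1
      simp only [smul_eq_mul, Ideal.mul_top] at h1
      rw [← Ideal.map_ofList,
        IsLocalization.mem_map_algebraMap_iff (originIdeal σ k).primeCompl] at h1
      obtain ⟨⟨⟨u, hu⟩, ⟨s, hs⟩⟩, hus⟩ := h1
      simp only [← map_mul] at hus
      have hinj := IsLocalization.injective (Localization.AtPrime (originIdeal σ k))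
        (originIdeal σ k).primeCompl_le_nonZeroDivisors
      have hus := hinj hus
      exact mem_of_mul_mem_of_coeff_zero_ne_zero hw hI hh hs (hus ▸ hu)
    -- If `f i` were zero, its regularity would put `1` into the ideal of the preceding elements,
    -- which lies in the ideal of the origin.
    have hne : f i ≠ 0 := by
      intro h0
      have := hle (key 0 1 (isWeightedHomogeneous_one k w) (by simp [h0]))
      rw [mem_originIdeal] at this
      simp at this
    ext γ
    exact hilb_sup_span_singleton hw hI (hf i) hne key γ

theorem hilb_originIdeal {w : σ → Γ}
    (hw : ∀ γ, {m : σ →₀ ℕ | Finsupp.weight w m = γ}.Finite) [DecidableEq Γ] (γ : Γ) :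
    hilb w (originIdeal σ k) γ = if γ = 0 then 1 else 0 := by
  rw [hilb]
  split_ifs with h
  · subst h
    have h1 : idealPart w (originIdeal σ k) 0 = ⊥ := by
      rw [eq_bot_iff]
      rintro p ⟨hp, hp0⟩
      have := weightedHomogeneousComponent_zero_of_finite hw p
      rw [weightedHomogeneousComponent_eq_self hp, show coeff 0 p = 0 from hp0, C_0] at this
      exact this
    have h2 : weightedHomogeneousSubmodule k w 0 = Submodule.span k {1} := by
      apply le_antisymm
      · intro p hp
        have := weightedHomogeneousComponent_zero_of_finite hw p
        rw [weightedHomogeneousComponent_eq_self hp] at this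
        exact Submodule.mem_span_singleton.mpr ⟨coeff 0 p, by
          rw [smul_eq_C_mul, mul_one, ← this]⟩
      · rw [Submodule.span_le, Set.singleton_subset_iff]
        exact isWeightedHomogeneous_one k w
    rw [h1, h2, finrank_span_singleton one_ne_zero, finrank_bot]
    rfl
  · have : idealPart w (originIdeal σ k) γ = weightedHomogeneousSubmodule k w γ := by
      refine le_antisymm inf_le_left fun p hp => ⟨hp, ?_⟩
      by_contra hne
      exact h (by simpa using (hp hne).symm)
    rw [this, sub_self]

/-- A monomial with an exponent at least `e i` lies in `I`, so only the degrees of finitely many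
monomials can contribute. -/
theorem finite_support_hilb [Finite σ] {w : σ → Γ} {I : Ideal (MvPolynomial σ k)}
    (hrad : ∀ i, (X i : MvPolynomial σ k) ∈ I.radical) : (hilb w I).support.Finite := by
  choose e he using hrad
  have hfin : {m : σ →₀ ℕ | ∀ i, m i < e i}.Finite := by
    classical
    have := Fintype.ofFinite σ
    refine (Set.finite_Iic (Finsupp.equivFunOnFinite.symm e)).subset ?_
    intro m hm i
    exact (hm i).le
  refine (hfin.image (Finsupp.weight w)).subset fun γ hγ => ?_
  by_contra hcon
  apply hγ
  have : idealPart w I γ = weightedHomogeneousSubmodule k w γ := by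
    refine le_antisymm inf_le_left fun p hp => ⟨hp, ?_⟩
    rw [p.as_sum]
    refine Submodule.sum_mem _ fun m hm => ?_
    have hmγ := hp (mem_support_iff.mp hm)
    obtain ⟨i, hi⟩ : ∃ i, e i ≤ m i := by
      by_contra! hlt
      exact hcon ⟨m, hlt, hmγ⟩
    have hdvd : (X i ^ e i : MvPolynomial σ k) ∣ monomial m (coeff m p) := by
      rw [X_pow_eq_monomial]
      refine monomial_dvd_monomial.mpr ⟨Or.inr ?_, one_dvd _⟩
      exact Finsupp.single_le_iff.mpr hi
    exact I.mem_of_dvd hdvd (he i)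
  rw [hilb, this, sub_self]

/-- The characters of the quotient by a homogeneous system of parameters. -/
theorem prod_mul_finsum_hilb [Fintype σ] {w : σ → Γ}
    (hw : ∀ γ, {m : σ →₀ ℕ | Finsupp.weight w m = γ}.Finite)
    {f : σ → MvPolynomial σ k} {δ : σ → Γ} (hf : ∀ i, IsWeightedHomogeneous w (f i) (δ i))
    (hf0 : ∀ i, f i ∈ originIdeal σ k)
    (hrad : ∀ i, (X i : MvPolynomial σ k) ∈ (Ideal.span (Set.range f)).radical)
    {A : Type*} [CommRing A] (c : Multiplicative Γ →* A) :
    (∏ i, (1 - c (.ofAdd (w i)))) *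
        ∑ᶠ γ, (hilb w (Ideal.span (Set.range f)) γ : A) * c (.ofAdd γ) =
      ∏ i, (1 - c (.ofAdd (δ i))) := by
  classical
  have hlist : ∀ g : σ → MvPolynomial σ k,
      Ideal.ofList (Finset.univ.toList.map g) = Ideal.span (Set.range g) := by
    intro g
    rw [Ideal.ofList]
    congr 1
    ext
    simp
  have hX0 : ∀ i, (X i : MvPolynomial σ k) ∈ originIdeal σ k := fun i => by
    rw [originIdeal_eq_span]
    exact Ideal.subset_span ⟨i, rfl⟩
  have h1 := hilb_ofList hw hf hf0 _ (isWeaklyRegular_localization hf0 hrad)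
  have h2 := hilb_ofList (k := k) hw (fun i => isWeightedHomogeneous_X k w i) hX0 _
    (isWeaklyRegular_localization hX0 fun i => Ideal.le_radical (Ideal.subset_span ⟨i, rfl⟩))
  rw [hlist] at h1 h2
  rw [← originIdeal_eq_span] at h2
  have hprod : ∀ ε : σ → Γ, ((Finset.univ.toList.map ε).map fun δ => 1 - c (.ofAdd δ)).prod =
      ∏ i, (1 - c (.ofAdd (ε i))) := by
    intro ε
    rw [List.map_map, ← Finset.prod_map_toList]
    rfl
  have hfin0 : (hilb w (originIdeal σ k)).support.Finite :=
    finite_support_hilb fun i => Ideal.le_radical (hX0 i)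
  -- The Hilbert function of the whole polynomial ring need not have finite support, so it cannot
  -- itself be summed against `c`. Applying to it both families of difference operators, which
  -- commute, compares the two finitely supported functions, that of the quotient by `f` and that of
  -- the quotient by the origin.
  rw [← hprod, ← finsum_foldl_backwardDiff c (finite_support_hilb hrad), h1,
    foldl_backwardDiff_comm, ← h2, finsum_foldl_backwardDiff c hfin0, hprod]
  have hone : ∑ᶠ γ, (hilb w (originIdeal σ k) γ : A) * c (.ofAdd γ) = 1 := by
    rw [finsum_eq_single _ 0 (fun γ hγ => by rw [hilb_originIdeal hw, if_neg hγ]; simp),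
      hilb_originIdeal hw]
    simp
  rw [hone, mul_one]

end Koszul
end MvPolynomial

/-! ### Sawtooth and cotangent functions on the unit circle. -/

namespace LG

/-- The point `exp (2πi x)` of the unit circle. -/
noncomputable def expUnit (x : ℝ) : ℂˣ :=
  Units.mk0 (Complex.exp (2 * Real.pi * Complex.I * (x : ℂ))) (Complex.exp_ne_zero _)

theorem coe_expUnit (x : ℝ) :
    (expUnit x : ℂ) = Complex.exp (2 * Real.pi * Complex.I * (x : ℂ)) := rfl

theorem expUnit_add (x y : ℝ) : expUnit (x + y) = expUnit x * expUnit y := by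
  ext
  simp [coe_expUnit, mul_add, Complex.exp_add]

theorem expUnit_natCast (n : ℕ) : expUnit n = 1 := by
  ext
  rw [coe_expUnit, Units.val_one, Complex.exp_eq_one_iff]
  exact ⟨n, by push_cast; ring⟩

theorem expUnit_pow (x : ℝ) (n : ℕ) : expUnit x ^ n = expUnit (n * x) := by
  ext
  rw [Units.val_pow_eq_pow_val, coe_expUnit, coe_expUnit, ← Complex.exp_nat_mul]
  congr 1
  push_cast
  ring

theorem norm_expUnit (x : ℝ) : ‖(expUnit x : ℂ)‖ = 1 := by
  rw [coe_expUnit, show (2 * Real.pi * Complex.I * (x : ℂ) : ℂ) =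
    ((2 * Real.pi * x : ℝ) : ℂ) * Complex.I by push_cast; ring]
  exact Complex.norm_exp_ofReal_mul_I _

theorem expUnit_phase {z : ℂˣ} (hz : ‖(z : ℂ)‖ = 1) : expUnit (phase z) = z :=
  Units.ext (exp_phase z hz)

theorem phase_expUnit {x : ℝ} (h0 : 0 ≤ x) (h1 : x < 1) : phase (expUnit x) = x := by
  have h := exp_phase (expUnit x) (norm_expUnit x)
  rw [coe_expUnit, Complex.exp_eq_exp_iff_exists_int] at h
  obtain ⟨n, hn⟩ := h
  have hpi : (2 * Real.pi * Complex.I : ℂ) ≠ 0 := Complex.two_pi_I_ne_zero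
  have h2 : ((phase (expUnit x) : ℝ) : ℂ) = x + n := by
    apply mul_left_cancel₀ hpi
    rw [hn]
    ring
  have h3 : phase (expUnit x) = x + n := by exact_mod_cast h2
  have h4 := phase_mem (expUnit x)
  have hn0 : n = 0 := by
    have a1 : (n : ℝ) < 1 := by linarith [h4.2]
    have a2 : (-1 : ℝ) < n := by linarith [h4.1]
    have a1' : n < 1 := by exact_mod_cast a1
    have a2' : -1 < n := by exact_mod_cast a2
    omega
  rw [h3, hn0]
  simp

theorem phase_one : phase 1 = 0 := by
  have := phase_expUnit (x := 0) le_rfl one_pos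
  rwa [show expUnit 0 = 1 by simpa using expUnit_natCast 0] at this

theorem norm_eq_one_of_pow_eq_one {z : ℂˣ} {N : ℕ} (hN : N ≠ 0) (hz : z ^ N = 1) :
    ‖(z : ℂ)‖ = 1 :=
  Complex.norm_eq_one_of_pow_eq_one (by rw [← Units.val_pow_eq_pow_val, hz, Units.val_one]) hN

open Classical in
/-- The sawtooth function on the unit circle. -/
noncomputable def sawtooth (z : ℂˣ) : ℂ := if z = 1 then 0 else (phase z : ℂ) - 1 / 2

open Classical in
/-- The function `1 / (1 - z) - 1 / 2`, a multiple of the cotangent, with value `0` at `1`. -/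
noncomputable def cotTerm (z : ℂˣ) : ℂ := if z = 1 then 0 else 1 / (1 - (z : ℂ)) - 1 / 2

theorem one_sub_ne_zero {z : ℂˣ} (hz : z ≠ 1) : 1 - (z : ℂ) ≠ 0 := by
  rw [sub_ne_zero]
  exact fun h => hz (Units.ext h.symm)

theorem cotTerm_inv (z : ℂˣ) : cotTerm z⁻¹ = -cotTerm z := by
  unfold cotTerm
  by_cases hz : z = 1
  · simp [hz]
  · rw [if_neg (by simpa using hz), if_neg hz]
    have h1 := one_sub_ne_zero hz
    have h2 := one_sub_ne_zero (z := z⁻¹) (by simpa using hz)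
    have h3 : (z : ℂ) ≠ 0 := z.ne_zero
    rw [Units.val_inv_eq_inv_val] at h2 ⊢
    have h4 : (1 - (z : ℂ)⁻¹) = -(1 - z) / z := by field_simp; ring
    rw [h4]
    field_simp
    ring

theorem expUnit_div_pow (N : ℕ) (hN : N ≠ 0) (k : ℕ) : expUnit (k / N) ^ N = 1 := by
  rw [expUnit_pow, mul_div_cancel₀ _ (by exact_mod_cast hN), expUnit_natCast]

theorem expUnit_div_eq_one_iff {N : ℕ} (hN : N ≠ 0) {k : ℕ} : expUnit (k / N) = 1 ↔ N ∣ k := by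
  constructor
  · intro h
    have hlt : ((k % N : ℕ) : ℝ) / N < 1 := by
      rw [div_lt_one (by positivity)]
      exact_mod_cast Nat.mod_lt k (Nat.pos_of_ne_zero hN)
    have h1 : expUnit (k / N) = expUnit ((k % N : ℕ) / N) := by
      have : (k : ℝ) / N = (k % N : ℕ) / N + (k / N : ℕ) := by
        have hk : ((k % N + N * (k / N) : ℕ) : ℝ) = k := by rw [Nat.mod_add_div]
        rw [← hk]
        push_cast
        field_simp
      rw [this, expUnit_add, expUnit_natCast, mul_one]
    rw [h1] at h
    have h2 := phase_expUnit (x := ((k % N : ℕ) : ℝ) / N) (by positivity) hlt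
    rw [h, phase_one] at h2
    have : ((k % N : ℕ) : ℝ) = 0 := by
      rw [eq_comm, div_eq_zero_iff] at h2
      exact h2.resolve_right (by exact_mod_cast hN)
    exact Nat.dvd_of_mod_eq_zero (by exact_mod_cast this)
  · rintro ⟨m, rfl⟩
    push_cast
    rw [mul_div_cancel_left₀ _ (by exact_mod_cast hN), expUnit_natCast]

theorem sawtooth_expUnit {x : ℝ} (h0 : 0 ≤ x) (h1 : x < 1) :
    sawtooth (expUnit x) = if x = 0 then 0 else (x : ℂ) - 1 / 2 := by
  have h : expUnit x = 1 ↔ x = 0 := by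
    constructor
    · intro h
      rw [← phase_expUnit h0 h1, h, phase_one]
    · rintro rfl
      simpa using expUnit_natCast 0
  unfold sawtooth
  simp only [h, phase_expUnit h0 h1]

theorem sawtooth_expUnit_div {N k : ℕ} (hk : k < N) :
    sawtooth (expUnit (k / N)) = if k = 0 then 0 else (k : ℂ) / N - 1 / 2 := by
  have hN : (N : ℝ) ≠ 0 := by exact_mod_cast (by omega : N ≠ 0)
  rw [sawtooth_expUnit (by positivity) ((div_lt_one (by positivity)).mpr (by exact_mod_cast hk))]
  simp [hN]

theorem expUnit_neg (x : ℝ) : expUnit (-x) = (expUnit x)⁻¹ := by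
  rw [eq_inv_iff_mul_eq_one, ← expUnit_add, neg_add_cancel]
  simpa using expUnit_natCast 0

theorem sawtooth_inv {z : ℂˣ} (hz : ‖(z : ℂ)‖ = 1) : sawtooth z⁻¹ = -sawtooth z := by
  unfold sawtooth
  by_cases h1 : z = 1
  · simp [h1]
  rw [if_neg (by simpa using h1), if_neg h1]
  have h0 : phase z ≠ 0 := by
    intro h
    have := expUnit_phase hz
    rw [h, show expUnit 0 = 1 by simpa using expUnit_natCast 0] at this
    exact h1 this.symm
  have hpos : 0 < phase z := lt_of_le_of_ne (phase_mem z).1 (Ne.symm h0)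
  have h2 : z⁻¹ = expUnit (1 - phase z) := by
    rw [sub_eq_add_neg, expUnit_add, expUnit_neg, expUnit_phase hz,
      show expUnit 1 = 1 by simpa using expUnit_natCast 1, one_mul]
  rw [h2, phase_expUnit (by linarith [(phase_mem z).2]) (by linarith)]
  push_cast
  ring

theorem sum_range_mul_pow {N : ℕ} {z : ℂ} (hz : z ^ N = 1) (h1 : 1 - z ≠ 0) :
    ∑ k ∈ Finset.range N, (k : ℂ) * z ^ k = -N / (1 - z) := by
  have key : ∀ M : ℕ, (1 - z) * ∑ k ∈ Finset.range M, (k : ℂ) * z ^ k =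
      ∑ k ∈ Finset.range M, z ^ k - 1 - (M - 1) * z ^ M := by
    intro M
    induction M with
    | zero => simp
    | succ M ih =>
      rw [Finset.sum_range_succ, mul_add, ih, Finset.sum_range_succ]
      push_cast
      ring
  have hg : ∑ k ∈ Finset.range N, z ^ k = 0 := by
    have := mul_neg_geom_sum z N
    rw [hz, sub_self] at this
    exact (mul_eq_zero.mp this).resolve_left h1
  have := key N
  rw [hg, hz] at this
  field_simp
  linear_combination this

/-- The finite Fourier expansion of the cotangent. -/
theorem cotTerm_eq_sum {N : ℕ} (hN : N ≠ 0) {z : ℂˣ} (hz : z ^ N = 1) :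
    cotTerm z = -∑ k ∈ Finset.range N, sawtooth (expUnit (k / N)) * (z : ℂ) ^ k := by
  have hN' : (N : ℂ) ≠ 0 := by exact_mod_cast hN
  -- The last `1 / 2` corrects the term `k = 0`, where the sawtooth is `0` and not `-1 / 2`.
  have hsum : ∑ k ∈ Finset.range N, sawtooth (expUnit (k / N)) * (z : ℂ) ^ k =
      1 / N * ∑ k ∈ Finset.range N, (k : ℂ) * (z : ℂ) ^ k -
        1 / 2 * ∑ k ∈ Finset.range N, (z : ℂ) ^ k + 1 / 2 := by
    have : ∀ k ∈ Finset.range N, sawtooth (expUnit (k / N)) * (z : ℂ) ^ k =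
        1 / N * ((k : ℂ) * (z : ℂ) ^ k) - 1 / 2 * (z : ℂ) ^ k + if k = 0 then 1 / 2 else 0 := by
      intro k hk
      rw [sawtooth_expUnit_div (Finset.mem_range.mp hk)]
      split_ifs with h
      · simp [h]
      · ring
    rw [Finset.sum_congr rfl this, Finset.sum_add_distrib, Finset.sum_sub_distrib,
      ← Finset.mul_sum, ← Finset.mul_sum, Finset.sum_ite_eq']
    simp [Nat.pos_of_ne_zero hN]
  rw [hsum]
  unfold cotTerm
  split_ifs with h
  · subst h
    simp only [Units.val_one, one_pow, mul_one, Finset.sum_const, Finset.card_range, nsmul_eq_mul]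
    have := Finset.sum_range_id_mul_two N
    have h2 : (∑ k ∈ Finset.range N, (k : ℂ)) * 2 = N * (N - 1) := by
      have h3 : (((∑ i ∈ Finset.range N, i) * 2 : ℕ) : ℂ) = ((N * (N - 1) : ℕ) : ℂ) := by rw [this]
      rw [Nat.cast_mul, Nat.cast_mul, Nat.cast_sub (Nat.pos_of_ne_zero hN), Nat.cast_sum] at h3
      exact_mod_cast h3
    field_simp
    linear_combination h2
  · have hz' : (z : ℂ) ^ N = 1 := by rw [← Units.val_pow_eq_pow_val, hz, Units.val_one]
    have h1 := one_sub_ne_zero h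
    have hg : ∑ k ∈ Finset.range N, (z : ℂ) ^ k = 0 := by
      have := mul_neg_geom_sum (z : ℂ) N
      rw [hz', sub_self] at this
      exact (mul_eq_zero.mp this).resolve_left h1
    rw [sum_range_mul_pow hz' h1, hg]
    field_simp
    ring

/-! ### Dedekind sums, cotangent sums and distribution relations over roots of unity. -/

section RootsOfUnity

noncomputable local instance (N : ℕ) [NeZero N] : Fintype (rootsOfUnity N ℂ) := Fintype.ofFinite _

theorem sum_rootsOfUnity {N : ℕ} [NeZero N] {A : Type*} [AddCommMonoid A] (F : ℂˣ → A) :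
    ∑ ζ : rootsOfUnity N ℂ, F ζ = ∑ k ∈ Finset.range N, F (expUnit (k / N)) := by
  have hN : N ≠ 0 := NeZero.ne N
  symm
  refine Finset.sum_bij (fun k _ => ⟨expUnit (k / N), expUnit_div_pow N hN k⟩) (fun _ _ =>
    Finset.mem_univ _) ?_ ?_ (fun _ _ => rfl)
  · intro a ha b hb hab
    have h1 := congrArg (fun ζ : rootsOfUnity N ℂ => phase ζ) hab
    simp only at h1
    have hlt : ∀ c ∈ Finset.range N, (c : ℝ) / N < 1 := fun c hc =>
      (div_lt_one (by positivity)).mpr (by exact_mod_cast Finset.mem_range.mp hc)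
    rw [phase_expUnit (by positivity) (hlt a ha), phase_expUnit (by positivity) (hlt b hb),
      div_left_inj' (by exact_mod_cast hN)] at h1
    exact_mod_cast h1
  · rintro ⟨ζ, hζ⟩ -
    obtain ⟨k, hk, hk2⟩ := (Complex.isPrimitiveRoot_exp N hN).eq_pow_of_pow_eq_one
      (ξ := (ζ : ℂ)) (by rw [← Units.val_pow_eq_pow_val, (mem_rootsOfUnity N ζ).mp hζ,
        Units.val_one])
    refine ⟨k, Finset.mem_range.mpr hk, Subtype.ext (Units.ext ?_)⟩
    rw [← hk2, coe_expUnit, ← Complex.exp_nat_mul]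
    congr 1
    push_cast
    ring

theorem sum_rootsOfUnity_pow {N : ℕ} [NeZero N] (m : ℕ) :
    ∑ ζ : rootsOfUnity N ℂ, ((ζ : ℂˣ) : ℂ) ^ m = if N ∣ m then (N : ℂ) else 0 := by
  have hN : N ≠ 0 := NeZero.ne N
  rw [sum_rootsOfUnity fun ζ => (ζ : ℂ) ^ m]
  have : ∀ k : ℕ, ((expUnit (k / N) : ℂˣ) : ℂ) ^ m = ((expUnit (m / N) : ℂˣ) : ℂ) ^ k := by
    intro k
    rw [← Units.val_pow_eq_pow_val, ← Units.val_pow_eq_pow_val, expUnit_pow, expUnit_pow]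
    congr 2
    ring
  rw [Finset.sum_congr rfl fun k _ => this k]
  split_ifs with h
  · rw [(expUnit_div_eq_one_iff hN).mpr h]
    simp
  · have h1 := one_sub_ne_zero fun h2 => h ((expUnit_div_eq_one_iff hN).mp h2)
    have := mul_neg_geom_sum ((expUnit (m / N) : ℂˣ) : ℂ) N
    rw [← Units.val_pow_eq_pow_val, expUnit_div_pow N hN, Units.val_one, sub_self] at this
    exact (mul_eq_zero.mp this).resolve_left h1

/-- Fourier inversion of `cotTerm_eq_sum`: orthogonality leaves the index inverse to `m`, and the
sawtooth is odd. -/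
theorem sum_cotTerm_mul_pow {N : ℕ} [NeZero N] (m : ℕ) :
    ∑ ζ : rootsOfUnity N ℂ, cotTerm ζ * ((ζ : ℂˣ) : ℂ) ^ m = N * sawtooth (expUnit (m / N)) := by
  classical
  have hN : N ≠ 0 := NeZero.ne N
  have h1 : ∀ ζ : rootsOfUnity N ℂ, cotTerm ζ * ((ζ : ℂˣ) : ℂ) ^ m =
      -∑ k ∈ Finset.range N, sawtooth (expUnit (k / N)) * ((ζ : ℂˣ) : ℂ) ^ (k + m) := by
    intro ζ
    rw [cotTerm_eq_sum hN ζ.2, neg_mul, Finset.sum_mul]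
    congr 1
    refine Finset.sum_congr rfl fun k _ => ?_
    rw [pow_add]
    ring
  have h2 : ∀ k : ℕ, N ∣ k + m ↔ expUnit (k / N) = (expUnit (m / N))⁻¹ := by
    intro k
    rw [← expUnit_div_eq_one_iff hN, eq_inv_iff_mul_eq_one, ← expUnit_add]
    push_cast
    rw [add_div]
  rw [Finset.sum_congr rfl fun ζ _ => h1 ζ, Finset.sum_neg_distrib, Finset.sum_comm]
  simp only [← Finset.mul_sum, sum_rootsOfUnity_pow, h2]
  rw [← sum_rootsOfUnity fun ζ => sawtooth ζ * if ζ = (expUnit (m / N))⁻¹ then (N : ℂ) else 0]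
  rw [Finset.sum_eq_single (⟨(expUnit (m / N))⁻¹, by
    rw [mem_rootsOfUnity, inv_pow, expUnit_div_pow N hN, inv_one]⟩ : rootsOfUnity N ℂ)]
  · rw [if_pos rfl, sawtooth_inv (norm_expUnit _)]
    ring
  · intro ζ _ hζ
    rw [if_neg (fun h => hζ (Subtype.ext h)), mul_zero]
  · simp

/-- The reciprocity between Dedekind sums and cotangent sums for cyclic groups. -/
theorem sum_sawtooth_add_sum_cotTerm_rootsOfUnity {N : ℕ} [NeZero N] (u : ℕ) :
    N * ∑ ζ : rootsOfUnity N ℂ, sawtooth ζ * sawtooth ((ζ : ℂˣ) ^ u) +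
      ∑ ζ : rootsOfUnity N ℂ, cotTerm ζ * cotTerm ((ζ : ℂˣ) ^ u) = 0 := by
  have hN : N ≠ 0 := NeZero.ne N
  -- Only the second cotangent is expanded; the sum over `ζ` of the first against powers of `ζ` is
  -- then a Fourier coefficient, again a sawtooth value.
  have h1 : ∀ ζ : rootsOfUnity N ℂ, cotTerm ζ * cotTerm ((ζ : ℂˣ) ^ u) =
      -∑ k ∈ Finset.range N, sawtooth (expUnit (k / N)) *
        (cotTerm ζ * ((ζ : ℂˣ) : ℂ) ^ (u * k)) := by
    intro ζ
    have hζ : (ζ : ℂˣ) ^ N = 1 := ζ.2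
    rw [cotTerm_eq_sum hN (z := (ζ : ℂˣ) ^ u) (by rw [← pow_mul, mul_comm, pow_mul, hζ, one_pow]),
      mul_neg, Finset.mul_sum]
    congr 1
    refine Finset.sum_congr rfl fun k _ => ?_
    rw [Units.val_pow_eq_pow_val, ← pow_mul]
    ring
  rw [Finset.sum_congr rfl fun ζ _ => h1 ζ, Finset.sum_neg_distrib, Finset.sum_comm,
    sum_rootsOfUnity fun ζ => sawtooth ζ * sawtooth (ζ ^ u), Finset.mul_sum]
  rw [add_neg_eq_zero]
  refine Finset.sum_congr rfl fun k _ => ?_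
  rw [← Finset.mul_sum, sum_cotTerm_mul_pow, expUnit_pow]
  push_cast
  rw [mul_div_assoc]
  ring

/-- Distribution relation of the sawtooth. Up to reindexing by a root of unity, `z` is `expUnit (y /
N)` with `y` the phase of `z ^ N`, and the values `(y + k) / N - 1 / 2` add up to `y - 1 / 2`; the
case `y = 0` is corrected at `k = 0`. -/
theorem sum_sawtooth_mul_rootsOfUnity {N : ℕ} [NeZero N] {z : ℂˣ} (hz : ‖(z : ℂ)‖ = 1) :
    ∑ ζ : rootsOfUnity N ℂ, sawtooth (z * ζ) = sawtooth (z ^ N) := by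
  have hN : N ≠ 0 := NeZero.ne N
  have hN' : (N : ℝ) ≠ 0 := by exact_mod_cast hN
  set y := phase (z ^ N) with hy
  have hy0 : 0 ≤ y := (phase_mem _).1
  have hy1 : y < 1 := (phase_mem _).2
  have hzN : expUnit y = z ^ N := expUnit_phase (by
    rw [Units.val_pow_eq_pow_val, norm_pow, hz, one_pow])
  have hroot : expUnit (y / N) ^ N = z ^ N := by
    rw [expUnit_pow, mul_div_cancel₀ _ hN', hzN]
  let ζ₀ : rootsOfUnity N ℂ := ⟨(expUnit (y / N))⁻¹ * z, by
    rw [mem_rootsOfUnity, mul_pow, inv_pow, hroot, inv_mul_cancel]⟩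
  have hz0 : z = expUnit (y / N) * (ζ₀ : ℂˣ) := by simp [ζ₀]
  have h1 : ∑ ζ : rootsOfUnity N ℂ, sawtooth (z * ζ) =
      ∑ ζ : rootsOfUnity N ℂ, sawtooth (expUnit (y / N) * ζ) := by
    rw [← Equiv.sum_comp (Equiv.mulLeft ζ₀)
      fun ζ : rootsOfUnity N ℂ => sawtooth (expUnit (y / N) * ζ)]
    refine Finset.sum_congr rfl fun ζ _ => ?_
    simp only [Equiv.coe_mulLeft, Subgroup.coe_mul]
    rw [← mul_assoc, ← hz0]
  have h2 : ∀ k ∈ Finset.range N, sawtooth (expUnit (y / N) * expUnit (k / N)) =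
      (y + k) / N - 1 / 2 + if k = 0 then (if y = 0 then 1 / 2 else 0) else 0 := by
    intro k hk
    have hk' : (k : ℝ) + 1 ≤ N := by exact_mod_cast Finset.mem_range.mp hk
    have hk0 : (0 : ℝ) ≤ k := by positivity
    rw [← expUnit_add, ← add_div, sawtooth_expUnit (by positivity)
      ((div_lt_one (by positivity)).mpr (by linarith))]
    simp only [div_eq_zero_iff, add_eq_zero_iff_of_nonneg hy0 hk0,
      Nat.cast_eq_zero]
    by_cases hk : k = 0 <;> by_cases hyz : y = 0 <;> simp [hk, hyz, hN]
  rw [h1, sum_rootsOfUnity fun ζ => sawtooth (expUnit (y / N) * ζ), Finset.sum_congr rfl h2,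
    Finset.sum_add_distrib, Finset.sum_ite_eq', if_pos (Finset.mem_range.mpr
    (Nat.pos_of_ne_zero hN)), ← hzN, sawtooth_expUnit hy0 hy1, Finset.sum_sub_distrib,
    ← Finset.sum_div, Finset.sum_add_distrib]
  have hgauss : (∑ k ∈ Finset.range N, (k : ℂ)) * 2 = N * (N - 1) := by
    have h3 := congrArg (Nat.cast (R := ℂ)) (Finset.sum_range_id_mul_two N)
    rwa [Nat.cast_mul, Nat.cast_mul, Nat.cast_sub (Nat.pos_of_ne_zero hN), Nat.cast_sum,
      Nat.cast_one] at h3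
  have hNC : (N : ℂ) ≠ 0 := by exact_mod_cast hN
  simp only [Finset.sum_const, Finset.card_range, nsmul_eq_mul]
  have h4 : (∑ k ∈ Finset.range N, (k : ℂ)) = N * (N - 1) / 2 := by
    rw [← hgauss]
    ring
  rw [h4]
  split_ifs with h
  · rw [h]
    push_cast
    field_simp
    ring
  · field_simp
    ring

/-- Distribution relation of the cotangent. If `z ^ N ≠ 1`, expand `1 / (1 - z ζ)` as a geometric
sum over `1 - z ^ N`: only the term `k = 0` survives summation over `ζ`. If `z ^ N = 1`, the sum
runs over all roots of unity and is zero. -/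
theorem sum_cotTerm_mul_rootsOfUnity {N : ℕ} [NeZero N] (z : ℂˣ) :
    ∑ ζ : rootsOfUnity N ℂ, cotTerm (z * ζ) = N * cotTerm (z ^ N) := by
  have hN : N ≠ 0 := NeZero.ne N
  by_cases hz : z ^ N = 1
  · rw [hz, show cotTerm 1 = 0 by simp [cotTerm], mul_zero]
    refine (Equiv.sum_comp (Equiv.mulLeft (⟨z, hz⟩ : rootsOfUnity N ℂ))
      fun ζ : rootsOfUnity N ℂ => cotTerm ζ).trans ?_
    have := sum_cotTerm_mul_pow (N := N) 0
    simp only [pow_zero, mul_one, Nat.cast_zero, zero_div] at this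
    rw [this, show expUnit 0 = 1 by simpa using expUnit_natCast 0]
    simp [sawtooth]
  · have hzN := one_sub_ne_zero hz
    have h1 : ∀ ζ : rootsOfUnity N ℂ, cotTerm (z * ζ) =
        1 / (1 - (z : ℂ) ^ N) * ∑ k ∈ Finset.range N, (z : ℂ) ^ k * ((ζ : ℂˣ) : ℂ) ^ k - 1 / 2 := by
      intro ζ
      have hζ : (ζ : ℂˣ) ^ N = 1 := ζ.2
      have hpow : (z * ζ) ^ N = z ^ N := by rw [mul_pow, hζ, mul_one]
      have hne : z * (ζ : ℂˣ) ≠ 1 := by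
        intro h
        rw [h, one_pow] at hpow
        exact hz hpow.symm
      have h2 := one_sub_ne_zero hne
      have h3 := mul_neg_geom_sum ((z * ζ : ℂˣ) : ℂ) N
      rw [← Units.val_pow_eq_pow_val _ N, hpow] at h3
      rw [cotTerm, if_neg hne]
      congr 1
      simp only [← mul_pow]
      rw [Units.val_pow_eq_pow_val] at h3 hzN
      rw [Units.val_mul] at h2 h3 ⊢
      field_simp
      rw [h3]
    rw [Finset.sum_congr rfl fun ζ _ => h1 ζ, Finset.sum_sub_distrib, ← Finset.mul_sum,
      Finset.sum_comm]
    simp only [← Finset.mul_sum, sum_rootsOfUnity_pow]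
    rw [Finset.sum_eq_single 0]
    · have hcard : (Finset.univ : Finset (rootsOfUnity N ℂ)).card = N := by
        rw [Finset.card_univ, ← Nat.card_eq_fintype_card]
        exact Complex.card_rootsOfUnity N
      rw [Finset.sum_const, hcard, cotTerm, if_neg hz]
      simp only [pow_zero, dvd_zero, if_true, nsmul_eq_mul, Units.val_pow_eq_pow_val]
      ring
    · intro k hk hk0
      rw [if_neg (Nat.not_dvd_of_pos_of_lt (Nat.pos_of_ne_zero hk0) (Finset.mem_range.mp hk)),
        mul_zero]
    · intro h
      exact absurd (Finset.mem_range.mpr (Nat.pos_of_ne_zero hN)) h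

/-! ### Reciprocity for characters of a finite abelian group. -/

section Characters

variable {H : Type*} [CommGroup H] [Fintype H]

theorem range_eq_rootsOfUnity (ψ : H →* ℂˣ) : ψ.range = rootsOfUnity (Nat.card ψ.range) ℂ := by
  have : NeZero (Nat.card ψ.range) := ⟨Nat.card_pos.ne'⟩
  refine Subgroup.eq_of_le_of_card_ge ?_ (Complex.card_rootsOfUnity _).le
  rintro z hz
  rw [mem_rootsOfUnity]
  have := pow_card_eq_one' (x := (⟨z, hz⟩ : ψ.range))
  exact congrArg Subtype.val this

theorem sum_character {A : Type*} [CommSemiring A] (ψ : H →* ℂˣ)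
    [NeZero (Nat.card ψ.range)] (F : ℂˣ → A) :
    ∑ b, F (ψ b) = Nat.card ψ.ker * ∑ ζ : rootsOfUnity (Nat.card ψ.range) ℂ, F ζ := by
  classical
  rw [Finset.sum_comp F ψ, Finset.mul_sum]
  have himg : (Finset.univ.image ψ) =
      Finset.univ.image (fun ζ : rootsOfUnity (Nat.card ψ.range) ℂ => (ζ : ℂˣ)) := by
    ext z
    have h := SetLike.ext_iff.mp (range_eq_rootsOfUnity ψ) z
    simp only [Finset.mem_image, Finset.mem_univ, true_and, Subtype.exists, exists_prop,
      exists_eq_right]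
    rw [← h]
    rfl
  have hcard : ∀ z ∈ Finset.univ.image ψ,
      (Finset.univ.filter fun a => ψ a = z).card • F z = Nat.card ψ.ker * F z := by
    intro z hz
    rw [nsmul_eq_mul]
    congr 2
    have h1 : z ∈ Set.range ψ := by simpa using hz
    rw [MonoidHom.card_fiber_eq_of_mem_range ψ h1 (⟨1, map_one ψ⟩ : (1 : ℂˣ) ∈ Set.range ψ),
      Nat.card_eq_fintype_card, Fintype.card_subtype]
    simp only [MonoidHom.mem_ker]
  rw [Finset.sum_congr rfl hcard, himg, Finset.sum_image]
  exact fun a _ b _ h => Subtype.ext h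

theorem card_eq_card_ker_mul {H : Type*} [CommGroup H] (ψ : H →* ℂˣ) :
    Nat.card H = Nat.card ψ.ker * Nat.card ψ.range := by
  rw [← Subgroup.card_mul_index ψ.ker, Subgroup.index_ker]

theorem norm_character (ψ : H →* ℂˣ) (γ : H) : ‖(ψ γ : ℂ)‖ = 1 :=
  norm_eq_one_of_pow_eq_one (N := Nat.card H) Nat.card_pos.ne'
    (by rw [← map_pow, pow_card_eq_one', map_one])

theorem card_ker_restrict {H : Type*} [CommGroup H] (χ₁ χ₂ : H →* ℂˣ) :
    Nat.card (χ₂.comp χ₁.ker.subtype).ker = Nat.card (χ₁.ker ⊓ χ₂.ker : Subgroup H) := by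
  refine Nat.card_congr ⟨fun a => ⟨a.1.1, a.1.2, a.2⟩, fun a => ⟨⟨a.1, a.2.1⟩, a.2.2⟩,
    fun _ => rfl, fun _ => rfl⟩

/-- Translating `γ` by the kernel of `χ₁` does not change `χ₁ γ`. Averaging over this kernel spreads
the second factor over a full group of roots of unity, ready for a distribution relation. -/
theorem card_mul_sum_character_mul (χ₁ χ₂ : H →* ℂˣ)
    [NeZero (Nat.card (χ₂.comp χ₁.ker.subtype).range)] (F : ℂˣ → ℂ) :
    Nat.card χ₁.ker * ∑ γ, F (χ₁ γ) * F (χ₂ γ) =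
      Nat.card (χ₁.ker ⊓ χ₂.ker : Subgroup H) * ∑ γ, F (χ₁ γ) *
        ∑ ζ : rootsOfUnity (Nat.card (χ₂.comp χ₁.ker.subtype).range) ℂ, F (χ₂ γ * ζ) := by
  classical
  have h1 : ∀ a : χ₁.ker, ∑ γ, F (χ₁ γ) * F (χ₂ γ) =
      ∑ γ, F (χ₁ γ) * F (χ₂ γ * (χ₂.comp χ₁.ker.subtype) a) := by
    intro a
    rw [← Equiv.sum_comp (Equiv.mulRight (a : H))]
    refine Finset.sum_congr rfl fun γ _ => ?_
    have : χ₁ a = 1 := a.2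
    simp [this]
  have h2 : Nat.card χ₁.ker * ∑ γ, F (χ₁ γ) * F (χ₂ γ) =
      ∑ a : χ₁.ker, ∑ γ, F (χ₁ γ) * F (χ₂ γ * (χ₂.comp χ₁.ker.subtype) a) := by
    rw [← Finset.sum_congr rfl fun a _ => h1 a, Finset.sum_const, Finset.card_univ, nsmul_eq_mul,
      Nat.card_eq_fintype_card]
  rw [h2, Finset.sum_comm, Finset.mul_sum]
  refine Finset.sum_congr rfl fun γ _ => ?_
  rw [← Finset.mul_sum, sum_character (χ₂.comp χ₁.ker.subtype) fun z => F (χ₂ γ * z),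
    card_ker_restrict]
  ring

/-- `ψ` factors through the image of `χ`, which is cyclic, and is determined by its value on a
preimage of a generator. -/
theorem exists_pow_eq_of_ker_le (χ ψ : H →* ℂˣ) (hle : χ.ker ≤ ψ.ker) :
    ∃ u : ℕ, ∀ γ, ψ γ = χ γ ^ u := by
  set d := Nat.card χ.range with hd
  have hd0 : d ≠ 0 := Nat.card_pos.ne'
  have hprim : IsPrimitiveRoot ((expUnit (1 / d) : ℂˣ) : ℂ) d := by
    have := Complex.isPrimitiveRoot_exp d hd0
    rw [coe_expUnit]
    convert this using 2
    push_cast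
    ring
  have hprim' : IsPrimitiveRoot (expUnit (1 / d)) d := IsPrimitiveRoot.coe_units_iff.mp hprim
  obtain ⟨γ₀, hγ₀⟩ : ∃ γ₀, χ γ₀ = expUnit (1 / d) := by
    have : expUnit (1 / d) ∈ χ.range := by
      rw [range_eq_rootsOfUnity, mem_rootsOfUnity]
      exact hprim'.pow_eq_one
    exact this
  have hpow : ∀ γ, ∃ k, χ γ = χ γ₀ ^ k := by
    intro γ
    have h1 : χ γ ^ d = 1 := by
      rw [← mem_rootsOfUnity, hd, ← range_eq_rootsOfUnity]
      exact ⟨γ, rfl⟩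
    have : NeZero d := ⟨hd0⟩
    obtain ⟨k, -, hk⟩ := hprim.eq_pow_of_pow_eq_one (ξ := (χ γ : ℂ))
      (by rw [← Units.val_pow_eq_pow_val, h1, Units.val_one])
    exact ⟨k, Units.ext (by rw [hγ₀, Units.val_pow_eq_pow_val, hk])⟩
  have hψ : ∀ γ k, χ γ = χ γ₀ ^ k → ψ γ = ψ γ₀ ^ k := by
    intro γ k h
    have : γ * (γ₀ ^ k)⁻¹ ∈ ψ.ker := hle (by
      rw [MonoidHom.mem_ker, map_mul, map_inv, map_pow, h, mul_inv_cancel])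
    rw [MonoidHom.mem_ker, map_mul, map_inv, map_pow, mul_inv_eq_one] at this
    exact this
  obtain ⟨u, -, hu⟩ := hprim.eq_pow_of_pow_eq_one (ξ := (ψ γ₀ : ℂ)) (by
    have := hψ 1 d (by rw [map_one, hγ₀, hprim'.pow_eq_one])
    rw [map_one] at this
    rw [← Units.val_pow_eq_pow_val, ← this, Units.val_one])
  refine ⟨u, fun γ => ?_⟩
  obtain ⟨k, hk⟩ := hpow γ
  rw [hψ γ k hk, hk, ← pow_mul, mul_comm, pow_mul]
  congr 1
  rw [hγ₀]
  exact Units.ext (by rw [Units.val_pow_eq_pow_val, hu])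

/-- The reciprocity between Dedekind sums and cotangent sums for pairs of characters of a finite
abelian group. -/
theorem card_mul_sum_sawtooth_add_sum_cotTerm (χ₁ χ₂ : H →* ℂˣ) :
    Nat.card H * ∑ γ, sawtooth (χ₁ γ) * sawtooth (χ₂ γ) +
      Nat.card (χ₁.ker ⊓ χ₂.ker : Subgroup H) * ∑ γ, cotTerm (χ₁ γ) * cotTerm (χ₂ γ) = 0 := by
  have i1 : NeZero (Nat.card (χ₂.comp χ₁.ker.subtype).range) := ⟨Nat.card_pos.ne'⟩
  have i2 : NeZero (Nat.card χ₁.range) := ⟨Nat.card_pos.ne'⟩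
  have hs := card_mul_sum_character_mul χ₁ χ₂ sawtooth
  have hc := card_mul_sum_character_mul χ₁ χ₂ cotTerm
  have hA := card_eq_card_ker_mul (χ₂.comp χ₁.ker.subtype)
  have hH := card_eq_card_ker_mul χ₁
  rw [card_ker_restrict] at hA
  -- The distribution relations replace `χ₂` by its power `χ₂ ^ p`, where `p` is the order of the
  -- image of `ker χ₁` under `χ₂`. That power is trivial on `ker χ₁`, hence a power of `χ₁`, and
  -- both sums become sums over one cyclic group.
  obtain ⟨u, hu⟩ := exists_pow_eq_of_ker_le χ₁
    (χ₂ ^ Nat.card (χ₂.comp χ₁.ker.subtype).range) (by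
    intro a ha
    have : (χ₂.comp χ₁.ker.subtype) ⟨a, ha⟩ ∈ (χ₂.comp χ₁.ker.subtype).range := ⟨_, rfl⟩
    rw [range_eq_rootsOfUnity, mem_rootsOfUnity] at this
    exact this)
  have hu' : ∀ γ, χ₂ γ ^ Nat.card (χ₂.comp χ₁.ker.subtype).range = χ₁ γ ^ u := hu
  simp only [sum_sawtooth_mul_rootsOfUnity (norm_character χ₂ _), hu'] at hs
  simp only [sum_cotTerm_mul_rootsOfUnity, hu'] at hc
  set p := Nat.card (χ₂.comp χ₁.ker.subtype).range
  rw [sum_character χ₁ fun z => sawtooth z * sawtooth (z ^ u)] at hs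
  have hc2 : ∑ γ, cotTerm (χ₁ γ) * (p * cotTerm (χ₁ γ ^ u)) =
      p * ∑ γ, cotTerm (χ₁ γ) * cotTerm (χ₁ γ ^ u) := by
    rw [Finset.mul_sum]
    exact Finset.sum_congr rfl fun γ _ => by ring
  rw [hc2, sum_character χ₁ fun z => cotTerm z * cotTerm (z ^ u)] at hc
  have hrec := sum_sawtooth_add_sum_cotTerm_rootsOfUnity (N := Nat.card χ₁.range) u
  have hA0 : (Nat.card χ₁.ker : ℂ) ≠ 0 := by exact_mod_cast Nat.card_pos.ne'
  have hAC : (Nat.card χ₁.ker : ℂ) = Nat.card (χ₁.ker ⊓ χ₂.ker : Subgroup H) * p := by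
    exact_mod_cast hA
  have hHC : (Nat.card H : ℂ) = Nat.card χ₁.ker * Nat.card χ₁.range := by
    exact_mod_cast hH
  apply mul_left_cancel₀ hA0
  rw [mul_zero, hHC]
  linear_combination (Nat.card χ₁.ker * Nat.card χ₁.range : ℂ) * hs +
    (Nat.card (χ₁.ker ⊓ χ₂.ker : Subgroup H) : ℂ) * hc +
    (Nat.card χ₁.ker : ℂ) ^ 2 * (Nat.card (χ₁.ker ⊓ χ₂.ker : Subgroup H)) * hrec -
    (Nat.card χ₁.ker * Nat.card (χ₁.ker ⊓ χ₂.ker : Subgroup H) *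
      ∑ ζ : rootsOfUnity (Nat.card χ₁.range) ℂ, cotTerm ζ * cotTerm ((ζ : ℂˣ) ^ u)) * hAC

theorem sum_cotTerm_character (χ : H →* ℂˣ) : ∑ g, cotTerm (χ g) = 0 := by
  have h : ∑ g, cotTerm (χ g) = ∑ g, cotTerm (χ g⁻¹) :=
    (Equiv.sum_comp (Equiv.inv H) fun g => cotTerm (χ g)).symm
  simp only [map_inv, cotTerm_inv, Finset.sum_neg_distrib] at h
  linear_combination h / 2

open Classical in
/-- The first jet at `t = 1` of the logarithm of a factor of the elliptic genus. -/
noncomputable def firstJet (z w : ℂˣ) : ℂ := if z = 1 then cotTerm w else sawtooth z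

open Classical in
/-- The second jet at `t = 1` of the logarithm of a factor of the elliptic genus, divided by
`1 - 2 q`. -/
noncomputable def secondJet (z w : ℂˣ) : ℂ :=
  if z = 1 then (if w = 1 then 1 / 12 else 1 / 4 - cotTerm w ^ 2) else 0

/-- Split each factor into a sawtooth in `γ` and, on the kernel, a cotangent in `g`. The mixed terms
vanish because cotangents sum to zero, and the other two are the two sides of the reciprocity. -/
theorem sum_firstJet_mul_firstJet (χ₁ χ₂ : H →* ℂˣ) :
    ∑ γ, ∑ g, firstJet (χ₁ γ) (χ₁ g) * firstJet (χ₂ γ) (χ₂ g) = 0 := by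
  classical
  have h1 : ∀ z w : ℂˣ, firstJet z w = sawtooth z + if z = 1 then cotTerm w else 0 := by
    intro z w
    unfold firstJet
    split_ifs with h
    · simp [h, sawtooth]
    · simp
  have hker : ∀ γ : H, (if χ₁ γ = 1 ∧ χ₂ γ = 1 then (1 : ℂ) else 0) =
      if γ ∈ χ₁.ker ⊓ χ₂.ker then 1 else 0 := fun γ => by
    simp only [Subgroup.mem_inf, MonoidHom.mem_ker]
  have hcard : ∑ γ : H, (if χ₁ γ = 1 ∧ χ₂ γ = 1 then (1 : ℂ) else 0) =
      Nat.card (χ₁.ker ⊓ χ₂.ker : Subgroup H) := by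
    rw [Finset.sum_congr rfl fun γ _ => hker γ, Finset.sum_boole, Nat.card_eq_fintype_card,
      Fintype.card_subtype]
  have h2 : ∀ γ : H, ∑ g, firstJet (χ₁ γ) (χ₁ g) * firstJet (χ₂ γ) (χ₂ g) =
      Nat.card H * (sawtooth (χ₁ γ) * sawtooth (χ₂ γ)) +
        (if χ₁ γ = 1 ∧ χ₂ γ = 1 then (1 : ℂ) else 0) * ∑ g, cotTerm (χ₁ g) * cotTerm (χ₂ g) := by
    intro γ
    have e : ∀ g : H, firstJet (χ₁ γ) (χ₁ g) * firstJet (χ₂ γ) (χ₂ g) =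
        sawtooth (χ₁ γ) * sawtooth (χ₂ γ) +
        (if χ₁ γ = 1 ∧ χ₂ γ = 1 then (1 : ℂ) else 0) * (cotTerm (χ₁ g) * cotTerm (χ₂ g)) +
        (sawtooth (χ₁ γ) * (if χ₂ γ = 1 then 1 else 0)) * cotTerm (χ₂ g) +
        (sawtooth (χ₂ γ) * (if χ₁ γ = 1 then 1 else 0)) * cotTerm (χ₁ g) := by
      intro g
      rw [h1, h1]
      by_cases a : χ₁ γ = 1 <;> by_cases b : χ₂ γ = 1 <;> simp [a, b] <;> ring
    rw [Finset.sum_congr rfl fun g _ => e g, Finset.sum_add_distrib, Finset.sum_add_distrib,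
      Finset.sum_add_distrib, Finset.sum_const, ← Finset.mul_sum, ← Finset.mul_sum,
      ← Finset.mul_sum, sum_cotTerm_character, sum_cotTerm_character, Finset.card_univ,
      Nat.card_eq_fintype_card, nsmul_eq_mul]
    ring
  rw [Finset.sum_congr rfl fun γ _ => h2 γ, Finset.sum_add_distrib, ← Finset.mul_sum,
    ← Finset.sum_mul, hcard]
  exact card_mul_sum_sawtooth_add_sum_cotTerm χ₁ χ₂

theorem sum_range_cast_sq (N : ℕ) :
    ∑ k ∈ Finset.range N, (k : ℂ) ^ 2 = N * (N - 1) * (2 * N - 1) / 6 := by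
  induction N with
  | zero => simp
  | succ N ih =>
    rw [Finset.sum_range_succ, ih]
    push_cast
    ring

theorem sum_range_cast (N : ℕ) : ∑ k ∈ Finset.range N, (k : ℂ) = N * (N - 1) / 2 := by
  induction N with
  | zero => simp
  | succ N ih =>
    rw [Finset.sum_range_succ, ih]
    push_cast
    ring

theorem sum_sawtooth_sq_rootsOfUnity {N : ℕ} [NeZero N] :
    ∑ ζ : rootsOfUnity N ℂ, sawtooth ζ * sawtooth ζ = (N - 1) * (N - 2) / (12 * N) := by
  have hN : N ≠ 0 := NeZero.ne N
  have hNC : (N : ℂ) ≠ 0 := by exact_mod_cast hN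
  rw [sum_rootsOfUnity fun ζ => sawtooth ζ * sawtooth ζ]
  have h : ∀ k ∈ Finset.range N, sawtooth (expUnit (k / N)) * sawtooth (expUnit (k / N)) =
      (k : ℂ) ^ 2 / N ^ 2 - (k : ℂ) / N + 1 / 4 - if k = 0 then 1 / 4 else 0 := by
    intro k hk
    rw [sawtooth_expUnit_div (Finset.mem_range.mp hk)]
    split_ifs with h
    · simp [h]
    · ring
  rw [Finset.sum_congr rfl h, Finset.sum_sub_distrib, Finset.sum_ite_eq', if_pos
    (Finset.mem_range.mpr (Nat.pos_of_ne_zero hN)), Finset.sum_add_distrib, Finset.sum_sub_distrib,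
    ← Finset.sum_div, ← Finset.sum_div, sum_range_cast, sum_range_cast_sq, Finset.sum_const,
    Finset.card_range, nsmul_eq_mul]
  field_simp
  ring

/-- The reciprocity for `χ` paired with itself evaluates the sum of squared cotangents from the
explicit sum of squared sawtooth values. -/
theorem sum_secondJet (χ : H →* ℂˣ) :
    ∑ γ, ∑ g, (secondJet (χ γ) (χ g) - 1 / 12) = 0 := by
  classical
  have i2 : NeZero (Nat.card χ.range) := ⟨Nat.card_pos.ne'⟩
  have hd0 : (Nat.card χ.range : ℂ) ≠ 0 := by exact_mod_cast Nat.card_pos.ne'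
  have hcard : ∑ γ : H, (if χ γ = 1 then (1 : ℂ) else 0) = Nat.card χ.ker := by
    rw [Finset.sum_boole, Nat.card_eq_fintype_card, Fintype.card_subtype]
    simp only [MonoidHom.mem_ker]
  have hHC : (Nat.card H : ℂ) = Nat.card χ.ker * Nat.card χ.range := by
    exact_mod_cast card_eq_card_ker_mul χ
  have hrec := card_mul_sum_sawtooth_add_sum_cotTerm χ χ
  rw [inf_idem, sum_character χ fun z => sawtooth z * sawtooth z, sum_sawtooth_sq_rootsOfUnity]
    at hrec
  -- At `χ g = 1` the cotangent is zero by convention but the jet is `1 / 12`; the correction is `1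
  -- / 4 - 1 / 12 = 1 / 6`.
  have e : ∀ γ g : H, secondJet (χ γ) (χ g) - 1 / 12 =
      (if χ γ = 1 then (1 : ℂ) else 0) * (1 / 4 - cotTerm (χ g) * cotTerm (χ g) -
        1 / 6 * if χ g = 1 then 1 else 0) - 1 / 12 := by
    intro γ g
    unfold secondJet
    by_cases a : χ γ = 1 <;> by_cases b : χ g = 1 <;> simp [a, b, cotTerm] <;> ring
  have hcardH : (Fintype.card H : ℂ) = Nat.card H := by rw [Nat.card_eq_fintype_card]
  simp only [e, Finset.sum_sub_distrib, ← Finset.mul_sum, ← Finset.sum_mul, hcard,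
    Finset.sum_const, Finset.card_univ, nsmul_eq_mul, hcardH]
  rw [hHC] at hrec ⊢
  set K := (Nat.card χ.ker : ℂ)
  set d := (Nat.card χ.range : ℂ)
  have hrec' : K * ∑ g, cotTerm (χ g) * cotTerm (χ g) = -(K ^ 2 * (d - 1) * (d - 2) / 12) := by
    rw [eq_neg_iff_add_eq_zero, add_comm, ← hrec]
    field_simp
  linear_combination -hrec'

end Characters

end RootsOfUnity

end LG

/-! ### Vanishing of the second jet summed over pairs of symmetries. -/

namespace LG

theorem sum_subgroup_ite {H A : Type*} [Group H] [Fintype H] [AddCommMonoid A] (K : Subgroup H)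
    [DecidablePred (· ∈ K)] (F : H → A) :
    ∑ γ, (if γ ∈ K then F γ else 0) = ∑ γ : K, F γ := by
  rw [← Finset.sum_filter]
  exact (Finset.sum_subtype _ (by simp) F)

/-- The vanishing of the second jet of the sum over all pairs of commuting twists. -/
theorem sum_prod_mul_jets {H ι : Type*} [CommGroup H] [Fintype H] [Fintype ι]
    (χ : ι → H →* ℂˣ) (a b : ι → ℂ) [∀ i γ g, Decidable (χ i γ = 1 ∧ χ i g = 1)] :
    ∑ γ, ∑ g, (∏ i, if χ i γ = 1 ∧ χ i g = 1 then 1 - b i else 1) *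
      ((∑ i, firstJet (χ i γ) (χ i g)) ^ 2 +
        ∑ i, a i * (secondJet (χ i γ) (χ i g) - 1 / 12)) = 0 := by
  classical
  set φ : H → H → ℂ := fun γ g => (∑ i, firstJet (χ i γ) (χ i g)) ^ 2 +
        ∑ i, a i * (secondJet (χ i γ) (χ i g) - 1 / 12) with hφ
  -- The product over coordinates expands over subsets `I`; the term of `I` is constant on `K × K`
  -- and zero elsewhere, `K` being the common kernel of the characters in `I`.
  have hprod : ∀ γ g, (∏ i, if χ i γ = 1 ∧ χ i g = 1 then 1 - b i else 1) =
      ∑ I : Finset ι, if γ ∈ ⨅ i ∈ I, (χ i).ker then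
        (if g ∈ ⨅ i ∈ I, (χ i).ker then ∏ i ∈ I, -b i else 0) else 0 := by
    intro γ g
    have h1 : ∀ i, (if χ i γ = 1 ∧ χ i g = 1 then 1 - b i else 1) =
        1 + if χ i γ = 1 ∧ χ i g = 1 then -b i else 0 := by
      intro i
      split_ifs <;> ring
    rw [Finset.prod_congr rfl fun i _ => h1 i, Finset.prod_one_add, Finset.powerset_univ]
    refine Finset.sum_congr rfl fun I _ => ?_
    simp only [Subgroup.mem_iInf, MonoidHom.mem_ker]
    rw [← ite_and]
    split_ifs with h
    · exact Finset.prod_congr rfl fun i hi => if_pos ⟨h.1 i hi, h.2 i hi⟩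
    · rw [not_and_or] at h
      rcases h with h | h
      all_goals
        push Not at h
        obtain ⟨i, hi, hne⟩ := h
        refine Finset.prod_eq_zero hi (if_neg ?_)
        tauto
  have hK : ∀ K : Subgroup H, ∑ γ : K, ∑ g : K, φ γ g = 0 := by
    intro K
    let ψ : ι → K →* ℂˣ := fun i => (χ i).comp K.subtype
    have h1 : ∀ γ g : K, φ γ g = (∑ i, ∑ j, firstJet (ψ i γ) (ψ i g) * firstJet (ψ j γ) (ψ j g)) +
        ∑ i, a i * (secondJet (ψ i γ) (ψ i g) - 1 / 12) := by
      intro γ g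
      rw [← Finset.sum_mul_sum, ← sq]
      rfl
    simp only [h1, Finset.sum_add_distrib]
    have h2 : ∑ γ : K, ∑ g : K, ∑ i, ∑ j, firstJet (ψ i γ) (ψ i g) * firstJet (ψ j γ) (ψ j g) =
        ∑ i, ∑ j, ∑ γ : K, ∑ g : K, firstJet (ψ i γ) (ψ i g) * firstJet (ψ j γ) (ψ j g) := by
      simp only [Finset.sum_comm (s := (Finset.univ : Finset K)) (t := (Finset.univ : Finset ι))]
    have h3 : ∑ γ : K, ∑ g : K, ∑ i, a i * (secondJet (ψ i γ) (ψ i g) - 1 / 12) =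
        ∑ i, a i * ∑ γ : K, ∑ g : K, (secondJet (ψ i γ) (ψ i g) - 1 / 12) := by
      simp only [Finset.sum_comm (s := (Finset.univ : Finset K)) (t := (Finset.univ : Finset ι)),
        Finset.mul_sum]
    rw [h2, h3]
    simp only [sum_firstJet_mul_firstJet, sum_secondJet]
    simp
  have hsum : ∑ γ, ∑ g, (∏ i, if χ i γ = 1 ∧ χ i g = 1 then 1 - b i else 1) * φ γ g =
      ∑ I : Finset ι, (∏ i ∈ I, -b i) * ∑ γ : (⨅ i ∈ I, (χ i).ker : Subgroup H),
        ∑ g : (⨅ i ∈ I, (χ i).ker : Subgroup H), φ γ g := by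
    have h4 : ∀ I : Finset ι, (∏ i ∈ I, -b i) * ∑ γ : (⨅ i ∈ I, (χ i).ker : Subgroup H),
        ∑ g : (⨅ i ∈ I, (χ i).ker : Subgroup H), φ γ g =
        ∑ γ, ∑ g, (if γ ∈ ⨅ i ∈ I, (χ i).ker then
          (if g ∈ ⨅ i ∈ I, (χ i).ker then ∏ i ∈ I, -b i else 0) else 0) * φ γ g := by
      intro I
      rw [← sum_subgroup_ite _ fun γ : H => ∑ g : (⨅ i ∈ I, (χ i).ker : Subgroup H), φ γ g,
        Finset.mul_sum]
      refine Finset.sum_congr rfl fun γ _ => ?_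
      rw [← sum_subgroup_ite _ fun g : H => φ γ g]
      split_ifs with h
      · rw [Finset.mul_sum]
        refine Finset.sum_congr rfl fun g _ => ?_
        split_ifs <;> simp
      · simp
    simp only [hprod, h4, Finset.sum_mul]
    rw [Finset.sum_congr rfl fun γ _ => Finset.sum_comm]
    rw [Finset.sum_comm]
  rw [hsum]
  simp only [hK, mul_zero, Finset.sum_const_zero]

/-! ### Second order jets of the factors of the generating series. -/

section Jets

open PowerSeries

/-- The power series `exp (a s)`. -/
noncomputable def expSeries (a : ℂ) : PowerSeries ℂ := rescale a (PowerSeries.exp ℂ)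

theorem coeff_expSeries (a : ℂ) (n : ℕ) : coeff n (expSeries a) = a ^ n / n.factorial := by
  simp [expSeries, coeff_rescale, coeff_exp, div_eq_mul_inv]

theorem expSeries_add (a b : ℂ) : expSeries (a + b) = expSeries a * expSeries b :=
  (exp_mul_exp_eq_exp_add a b).symm

theorem expSeries_zero : expSeries 0 = 1 := by
  ext n
  rw [coeff_expSeries, coeff_one]
  rcases n with _ | n <;> simp

/-- `F = a (1 + A s + (A² + B) s² / 2 + ⋯)`. -/
structure HasJet (F : PowerSeries ℂ) (a A B : ℂ) : Prop where
  coeff_zero : coeff 0 F = a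
  coeff_one : coeff 1 F = a * A
  coeff_two : coeff 2 F = a * (A ^ 2 + B) / 2

theorem coeff_one_mul' (F G : PowerSeries ℂ) :
    coeff 1 (F * G) = coeff 0 F * coeff 1 G + coeff 1 F * coeff 0 G := by
  rw [coeff_mul, Finset.Nat.sum_antidiagonal_eq_sum_range_succ_mk, Finset.sum_range_succ,
    Finset.sum_range_one]

theorem coeff_two_mul' (F G : PowerSeries ℂ) :
    coeff 2 (F * G) = coeff 0 F * coeff 2 G + coeff 1 F * coeff 1 G + coeff 2 F * coeff 0 G := by
  rw [coeff_mul, Finset.Nat.sum_antidiagonal_eq_sum_range_succ_mk, Finset.sum_range_succ,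
    Finset.sum_range_succ, Finset.sum_range_one]

theorem coeff_zero_mul' (F G : PowerSeries ℂ) :
    coeff 0 (F * G) = coeff 0 F * coeff 0 G := by
  simp

theorem HasJet.one : HasJet 1 1 0 0 := by
  constructor <;> simp

/-- For nonzero `a`, the numbers `A` and `B` are the first two derivatives at zero of the logarithm
of `F`, hence additive. -/
theorem HasJet.mul {F G : PowerSeries ℂ} {a A B b A' B' : ℂ} (hF : HasJet F a A B)
    (hG : HasJet G b A' B') : HasJet (F * G) (a * b) (A + A') (B + B') := by
  constructor
  · rw [coeff_zero_mul', hF.coeff_zero, hG.coeff_zero]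
  · rw [coeff_one_mul', hF.coeff_zero, hG.coeff_zero, hF.coeff_one, hG.coeff_one]
    ring
  · rw [coeff_two_mul', hF.coeff_zero, hG.coeff_zero, hF.coeff_one, hG.coeff_one, hF.coeff_two,
      hG.coeff_two]
    ring

theorem HasJet.prod {ι : Type*} (s : Finset ι) {F : ι → PowerSeries ℂ} {a A B : ι → ℂ}
    (h : ∀ i, HasJet (F i) (a i) (A i) (B i)) :
    HasJet (∏ i ∈ s, F i) (∏ i ∈ s, a i) (∑ i ∈ s, A i) (∑ i ∈ s, B i) := by
  classical
  induction s using Finset.induction_on with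
  | empty => simpa using HasJet.one
  | insert i s hi ih =>
    rw [Finset.prod_insert hi, Finset.prod_insert hi, Finset.sum_insert hi, Finset.sum_insert hi]
    exact (h i).mul ih

theorem hasJet_expSeries (a : ℂ) : HasJet (expSeries a) 1 a 0 := by
  constructor <;> rw [coeff_expSeries] <;> simp [Nat.factorial]

theorem hasJet_of_mul_eq {F D N : PowerSeries ℂ} (h : F * D = N) (hD : coeff 0 D ≠ 0)
    {a A B : ℂ} (h0 : coeff 0 N = a * coeff 0 D)
    (h1 : coeff 1 N = a * coeff 1 D + a * A * coeff 0 D)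
    (h2 : coeff 2 N = a * coeff 2 D + a * A * coeff 1 D + a * (A ^ 2 + B) / 2 * coeff 0 D) :
    HasJet F a A B := by
  subst h
  rw [coeff_zero_mul'] at h0
  have e0 : coeff 0 F = a := mul_right_cancel₀ hD h0
  rw [coeff_one_mul', e0] at h1
  have e1 : coeff 1 F = a * A := mul_right_cancel₀ hD (by linear_combination h1)
  rw [coeff_two_mul', e0, e1] at h2
  exact ⟨e0, e1, mul_right_cancel₀ hD (by linear_combination h2)⟩

/-- The difference quotient `(exp (a s) - exp (b s)) / s`. -/
noncomputable def expDiff (a b : ℂ) : PowerSeries ℂ :=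
  mk fun n => (a ^ (n + 1) - b ^ (n + 1)) / (n + 1).factorial

theorem X_mul_expDiff (a b : ℂ) : X * expDiff a b = expSeries a - expSeries b := by
  ext n
  rcases n with _ | n
  · simp [coeff_expSeries, -coeff_zero_eq_constantCoeff]
    simp
  · rw [coeff_succ_X_mul, map_sub, coeff_expSeries, coeff_expSeries, expDiff, coeff_mk]
    ring

open Classical in
/-- The factor of the elliptic genus at a fixed coordinate. -/
theorem exists_hasJet_fixed {q : ℂ} (hq : q ≠ 0) (w : ℂˣ) : ∃ F : PowerSeries ℂ,
    F * (1 - C (w : ℂ) * expSeries q) = expSeries (1 / 2) - C (w : ℂ) * expSeries (q - 1 / 2) ∧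
      HasJet F (if w = 1 then 1 - 1 / q else 1) (firstJet 1 w) ((1 - 2 * q) * secondJet 1 w) := by
  by_cases hw : w = 1
  · subst hw
    -- At `w = 1` numerator and denominator both vanish at `s = 0`; the common factor `X` is
    -- cancelled, leaving a denominator with constant term `-q`. The resulting constant term is `(1
    -- - q) / (-q) = 1 - 1 / q`.
    have hd : coeff 0 (expDiff 0 q) = -q := by simp [expDiff]
    have hF : expDiff (1 / 2) (q - 1 / 2) * (expDiff 0 q)⁻¹ * expDiff 0 q =
        expDiff (1 / 2) (q - 1 / 2) := by
      rw [mul_assoc, PowerSeries.inv_mul_cancel _ (by simpa [expDiff] using hq), mul_one]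
    refine ⟨expDiff (1 / 2) (q - 1 / 2) * (expDiff 0 q)⁻¹, ?_, ?_⟩
    · simp only [Units.val_one, map_one, one_mul]
      rw [← X_mul_expDiff, ← expSeries_zero, ← X_mul_expDiff, mul_left_comm, hF]
    · refine hasJet_of_mul_eq hF (by rw [hd]; simpa using hq) ?_ ?_ ?_ <;>
      · simp [expDiff, firstJet, secondJet, cotTerm, Nat.factorial]
        try field_simp
        try ring
  · have hw1 := one_sub_ne_zero hw
    have hd : coeff 0 (1 - C (w : ℂ) * expSeries q) = 1 - (w : ℂ) := by
      rw [map_sub, coeff_C_mul, coeff_expSeries, coeff_one]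
      simp
    have hF : (expSeries (1 / 2) - C (w : ℂ) * expSeries (q - 1 / 2)) *
        (1 - C (w : ℂ) * expSeries q)⁻¹ * (1 - C (w : ℂ) * expSeries q) =
        expSeries (1 / 2) - C (w : ℂ) * expSeries (q - 1 / 2) := by
      rw [mul_assoc, PowerSeries.inv_mul_cancel _ (by
        rw [← coeff_zero_eq_constantCoeff_apply, hd]; exact hw1), mul_one]
    refine ⟨_, hF, ?_⟩
    refine hasJet_of_mul_eq hF (by rw [hd]; exact hw1) ?_ ?_ ?_ <;>
    · simp only [map_sub, coeff_C_mul, coeff_expSeries, coeff_one, firstJet, secondJet, cotTerm,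
        if_neg hw]
      simp [Nat.factorial]
      try field_simp
      try ring

end Jets

end LG

/-! ### Finiteness of the group of diagonal symmetries. -/

namespace LG

open MvPolynomial

section Scale

variable {σ : Type*}

theorem coeff_scale (g : σ → ℂˣ) (p : MvPolynomial σ ℂ) (m : σ →₀ ℕ) :
    coeff m (scale g p) = ((m.prod fun i k => g i ^ k : ℂˣ) : ℂ) * coeff m p := by
  classical
  induction p using MvPolynomial.induction_on' with
  | monomial u a =>
    have h : scale g (monomial u a) = monomial u (((u.prod fun i k => g i ^ k : ℂˣ) : ℂ) * a) := by
      rw [scale, aeval_monomial]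
      simp only [mul_pow]
      rw [Finsupp.prod_mul, mul_comm, algebraMap_eq, mul_assoc, mul_comm _ (C a), ← monomial_eq,
        ← C_mul_monomial]
      congr 1
      simp [Finsupp.prod, Units.coe_prod]
    rw [h, coeff_monomial, coeff_monomial]
    split_ifs with hu
    · rw [hu]
    · simp
  | add p p' hp hp' => simp [hp, hp', mul_add]

theorem prod_pow_eq_one_of_mem_diagSym {W : MvPolynomial σ ℂ} {g : σ → ℂˣ} (hg : g ∈ diagSym W)
    {m : σ →₀ ℕ} (hm : coeff m W ≠ 0) : (m.prod fun i k => g i ^ k) = 1 := by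
  have h := coeff_scale g W m
  rw [show scale g W = W from hg] at h
  ext
  rw [Units.val_one]
  exact mul_right_cancel₀ hm (by rw [one_mul]; exact h.symm)

theorem eval_scale (g : σ → ℂˣ) (p : MvPolynomial σ ℂ) (x : σ → ℂ) :
    eval x (scale g p) = eval (fun i => (g i : ℂ) * x i) p := by
  have : (aeval x).comp (scale g) = aeval (R := ℂ) fun i => (g i : ℂ) * x i := by
    ext i
    simp [scale]
  have := DFunLike.congr_fun this p
  simpa [aeval_eq_eval] using this

end Scale

section Finiteness

variable {n : ℕ} {W : MvPolynomial (Fin n) ℂ} {q : Fin n → ℚ}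

/-- The exponents of a polynomial with a unique system of weights span. -/
theorem span_exponents (hW : IsNondegenerate W q) :
    Submodule.span ℚ ((fun m : Fin n →₀ ℕ => fun i => (m i : ℚ)) '' {m | coeff m W ≠ 0}) = ⊤ := by
  classical
  by_contra hne
  obtain ⟨f, hf0, hf⟩ := Submodule.exists_le_ker_of_lt_top _ (lt_top_iff_ne_top.mpr hne)
  have hfe : ∀ v : Fin n → ℚ, f v = ∑ i, v i * f (Pi.single i 1) := by
    intro v
    conv_lhs => rw [pi_eq_sum_univ' v]
    simp only [map_sum, map_smul, smul_eq_mul]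
  -- A functional vanishing on all exponents of `W` can be added to `q` without changing the weight
  -- of `W`; uniqueness of the weights makes it zero.
  have key : (fun i => q i + f (Pi.single i 1)) = q := by
    refine hW.weights_unique _ fun m hm => ?_
    have h1 : Finsupp.weight q m = 1 := hW.quasihomogeneous hm
    have h2 : f (fun i => (m i : ℚ)) = 0 := hf (Submodule.subset_span ⟨m, hm, rfl⟩)
    rw [Finsupp.weight_apply, Finsupp.sum_fintype _ _ (by simp)] at h1 ⊢
    rw [hfe] at h2
    simp only [nsmul_eq_mul, mul_add, Finset.sum_add_distrib] at h1 h2 ⊢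
    rw [h1, h2, add_zero]
  refine hf0 (LinearMap.ext fun v => ?_)
  rw [hfe, LinearMap.zero_apply]
  refine Finset.sum_eq_zero fun i _ => ?_
  have := congrFun key i
  simp only [add_eq_left] at this
  rw [this, mul_zero]

/-- Every rational vector has an integral multiple that is an invariant exponent. -/
theorem exists_invariant_exponent (hW : IsNondegenerate W q) (v : Fin n → ℚ) :
    ∃ N : ℤ, N ≠ 0 ∧ ∃ u : Fin n → ℤ, (∀ j, (u j : ℚ) = N * v j) ∧
      ∀ g ∈ diagSym W, ∏ j, g j ^ u j = 1 := by
  have hv : v ∈ Submodule.span ℚ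
      ((fun m : Fin n →₀ ℕ => fun i => (m i : ℚ)) '' {m | coeff m W ≠ 0}) := by
    rw [span_exponents hW]; trivial
  induction hv using Submodule.span_induction with
  | mem x hx =>
    obtain ⟨m, hm, rfl⟩ := hx
    refine ⟨1, one_ne_zero, fun j => m j, by simp, fun g hg => ?_⟩
    have := prod_pow_eq_one_of_mem_diagSym hg hm
    rw [Finsupp.prod_fintype _ _ (by simp)] at this
    simpa using this
  | zero => exact ⟨1, one_ne_zero, 0, by simp, by simp⟩
  | add x y _ _ hx hy =>
    obtain ⟨N, hN, u, hu, h⟩ := hx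
    obtain ⟨N', hN', u', hu', h'⟩ := hy
    refine ⟨N * N', mul_ne_zero hN hN', fun j => N' * u j + N * u' j, fun j => ?_, fun g hg => ?_⟩
    · push_cast
      rw [hu, hu', Pi.add_apply]
      ring
    · simp only [zpow_add, Finset.prod_mul_distrib]
      simp only [mul_comm N' _, mul_comm N _, zpow_mul, Finset.prod_zpow, h g hg, h' g hg, one_zpow,
        mul_one]
  | smul a x _ hx =>
    obtain ⟨N, hN, u, hu, h⟩ := hx
    refine ⟨N * a.den, mul_ne_zero hN (by exact_mod_cast a.den_ne_zero), fun j => u j * a.num,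
      fun j => ?_, fun g hg => ?_⟩
    · push_cast
      rw [hu, Pi.smul_apply, smul_eq_mul]
      conv_rhs => rw [← Rat.num_div_den a]
      have : (a.den : ℚ) ≠ 0 := by exact_mod_cast a.den_ne_zero
      simp only [Rat.num_div_den]
      have h2 : (a.den : ℚ) * a = a.num := by rw [mul_comm]; exact Rat.mul_den_eq_num a
      rw [← h2]
      ring
    · simp only [zpow_mul, Finset.prod_zpow, h g hg, one_zpow]

/-- Applied to coordinate vectors, `exists_invariant_exponent` bounds the order of every coordinate
of a symmetry, so the group embeds in a finite product of groups of roots of unity. -/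
theorem finite_diagSym (hW : IsNondegenerate W q) : Finite (diagSym W) := by
  classical
  have h : ∀ i : Fin n, ∃ N : ℕ, N ≠ 0 ∧ ∀ g ∈ diagSym W, g i ^ N = 1 := by
    intro i
    obtain ⟨N, hN, u, hu, h⟩ := exists_invariant_exponent hW (Pi.single i 1)
    refine ⟨N.natAbs, Int.natAbs_ne_zero.mpr hN, fun g hg => ?_⟩
    have h1 := h g hg
    have hu' : ∀ j, u j = Pi.single (M := fun _ => ℤ) i N j := by
      intro j
      have := hu j
      by_cases hj : j = i
      · subst hj
        simpa using this
      · simpa [hj] using this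
    rw [Finset.prod_eq_single i (by intro j _ hj; simp [hu', hj]) (by simp), hu',
      Pi.single_eq_same] at h1
    rcases Int.natAbs_eq N with h2 | h2
    · rw [h2] at h1
      exact_mod_cast h1
    · rw [h2, zpow_neg, inv_eq_one] at h1
      exact_mod_cast h1
  choose N hN h using h
  have : ∀ i, NeZero (N i) := fun i => ⟨hN i⟩
  refine Finite.of_injective
    (fun g : diagSym W => fun i => (⟨(g : Fin n → ℂˣ) i, h i g g.2⟩ : rootsOfUnity (N i) ℂ)) ?_
  intro g g' hgg
  ext i
  have := congrFun hgg i
  exact congrArg (fun z : rootsOfUnity (N i) ℂ => ((z : ℂˣ) : ℂ)) this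

end Finiteness

/-! ### Restriction of `W` to fixed loci. -/

section Restriction

variable {n : ℕ} {W : MvPolynomial (Fin n) ℂ} {q : Fin n → ℚ}

theorem isWeightedHomogeneous_restrictFix {M : Type*} [AddCommMonoid M] {w : Fin n → M} {δ : M}
    {p : MvPolynomial (Fin n) ℂ} (hp : IsWeightedHomogeneous w p δ) (γ : Fin n → ℂˣ) :
    IsWeightedHomogeneous (fun i : FixIdx γ => w i) (restrictFix γ p) δ := by
  classical
  rw [p.as_sum, map_sum]
  refine (weightedHomogeneousSubmodule ℂ _ δ).sum_mem fun m hm => ?_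
  rw [mem_weightedHomogeneousSubmodule, restrictFix, aeval_monomial, algebraMap_eq]
  have hδ : Finsupp.weight w m = δ := hp (mem_support_iff.mp hm)
  rw [← zero_add δ]
  refine (isWeightedHomogeneous_C _ _).mul ?_
  rw [← hδ, Finsupp.weight_apply, Finsupp.sum, Finsupp.prod]
  refine IsWeightedHomogeneous.prod _ _ _ fun i _ => ?_
  refine IsWeightedHomogeneous.pow ?_ _
  split_ifs with h
  · exact isWeightedHomogeneous_X ℂ _ _
  · exact isWeightedHomogeneous_zero ℂ _ _

theorem pderiv_restrictFix (γ : Fin n → ℂˣ) (i : FixIdx γ) (p : MvPolynomial (Fin n) ℂ) :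
    pderiv i (restrictFix γ p) = restrictFix γ (pderiv (i : Fin n) p) := by
  classical
  induction p using MvPolynomial.induction_on with
  | C a => simp [restrictFix]
  | add p q hp hq => simp [hp, hq]
  | mul_X p j hp =>
    rw [map_mul, Derivation.leibniz, Derivation.leibniz, hp, map_add, smul_eq_mul, smul_eq_mul,
      smul_eq_mul, smul_eq_mul, map_mul, map_mul]
    congr 2
    by_cases hj : γ j = 1
    · have hX : restrictFix γ (X j) = X ⟨j, hj⟩ := by simp [restrictFix, hj]
      rw [hX]
      by_cases hij : j = i
      · have : (⟨j, hj⟩ : FixIdx γ) = i := Subtype.ext hij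
        rw [this, hij, pderiv_X_self, pderiv_X_self, map_one]
      · have : (⟨j, hj⟩ : FixIdx γ) ≠ i := fun h => hij (congrArg Subtype.val h)
        rw [pderiv_X_of_ne this, pderiv_X_of_ne hij, map_zero]
    · have hX : restrictFix γ (X j) = 0 := by simp [restrictFix, hj]
      have hij : j ≠ i := fun h => hj (h ▸ i.2)
      rw [hX, pderiv_X_of_ne hij, map_zero, map_zero]

open Classical in
theorem eval_restrictFix (γ : Fin n → ℂˣ) (x : FixIdx γ → ℂ) (p : MvPolynomial (Fin n) ℂ) :
    eval x (restrictFix γ p) = eval (fun i => if h : γ i = 1 then x ⟨i, h⟩ else 0) p := by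
  have : (aeval x).comp (restrictFix γ) =
      aeval (R := ℂ) fun i => if h : γ i = 1 then x ⟨i, h⟩ else 0 := by
    ext i
    by_cases h : γ i = 1 <;> simp [restrictFix, h]
  have := DFunLike.congr_fun this p
  simpa [aeval_eq_eval] using this

/-- The restriction of `W` to the fixed locus of a symmetry has no critical point besides the
origin. -/
theorem eq_zero_of_critical_restrictFix (hW : IsNondegenerate W q) {γ : Fin n → ℂˣ}
    (hγ : γ ∈ diagSym W) (x : FixIdx γ → ℂ)
    (hx : ∀ i, eval x (pderiv i (restrictFix γ W)) = 0) : x = 0 := by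
  classical
  set y : Fin n → ℂ := fun i => if h : γ i = 1 then x ⟨i, h⟩ else 0 with hy
  have hy0 : y = 0 := by
    refine hW.critical_only_origin y fun i => ?_
    by_cases hi : γ i = 1
    · have := hx ⟨i, hi⟩
      rwa [pderiv_restrictFix, eval_restrictFix] at this
    -- In a direction not fixed by `γ`, invariance of `W` at the fixed point `y` gives `∂ᵢW(y) = γᵢ
    -- ∂ᵢW(y)` with `γᵢ ≠ 1`, so the derivative vanishes there without further assumption.
    · have h1 := pderiv_scale γ i W
      rw [show scale γ W = W from hγ] at h1
      have h2 := congrArg (eval y) h1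
      rw [map_mul, eval_C, eval_scale] at h2
      have h3 : (fun i => (γ i : ℂ) * y i) = y := by
        funext j
        by_cases hj : γ j = 1 <;> simp [hy, hj]
      rw [h3] at h2
      have h4 : (1 - (γ i : ℂ)) * eval y (pderiv i W) = 0 := by
        rw [sub_mul, one_mul, ← h2, sub_self]
      exact (mul_eq_zero.mp h4).resolve_left (one_sub_ne_zero hi)
  funext i
  have := congrFun hy0 i
  simpa [hy, i.2] using this

/-- Nullstellensatz: the only zero of the Jacobian ideal is the origin. -/
theorem X_mem_radical_jacobianIdeal (hW : IsNondegenerate W q) {γ : Fin n → ℂˣ}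
    (hγ : γ ∈ diagSym W) (i : FixIdx γ) :
    X i ∈ (jacobianIdeal (restrictFix γ W)).radical := by
  rw [← vanishingIdeal_zeroLocus_eq_radical (k := ℂ) (K := ℂ), mem_vanishingIdeal_iff]
  intro x hx
  rw [mem_zeroLocus_iff] at hx
  have : x = 0 := by
    refine eq_zero_of_critical_restrictFix hW hγ x fun j => ?_
    have := hx _ (Ideal.subset_span ⟨j, rfl⟩)
    simpa [aeval_eq_eval] using this
  simp [this]

/-- The variables are nilpotent in the quotient, so it is integral and finitely generated as an
algebra. -/
theorem finite_jac (hW : IsNondegenerate W q) {γ : Fin n → ℂˣ} (hγ : γ ∈ diagSym W) :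
    Module.Finite ℂ (Jac (restrictFix γ W)) := by
  have hint : Algebra.IsIntegral ℂ (Jac (restrictFix γ W)) := by
    refine ⟨fun a => ?_⟩
    obtain ⟨p, rfl⟩ := Ideal.Quotient.mk_surjective a
    induction p using MvPolynomial.induction_on with
    | C c => exact isIntegral_algebraMap (R := ℂ) (A := Jac (restrictFix γ W)) (x := c)
    | add p q hp hq => rw [map_add]; exact hp.add hq
    | mul_X p i hp =>
      rw [map_mul]
      refine hp.mul ?_
      obtain ⟨N, hN⟩ := X_mem_radical_jacobianIdeal hW hγ i
      refine IsIntegral.of_pow (n := N + 1) (Nat.succ_pos _) ?_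
      rw [pow_succ, ← map_pow, Ideal.Quotient.eq_zero_iff_mem.mpr hN, zero_mul]
      exact isIntegral_zero
  exact Algebra.IsIntegral.finite

end Restriction

end LG

/-! ### Bases adapted to a decomposition, and the super-dimension. -/

namespace LG

open MvPolynomial

section AdaptedBasis

/-- A basis adapted to a family of subspaces separated by projections restricts to a basis of each
subspace. -/
theorem span_eq_of_adapted {R M K ι : Type*} [Semiring R] [AddCommMonoid M] [Module R M]
    (b : Module.Basis ι R M) (U : K → Submodule R M) (k : ι → K) (hb : ∀ a, b a ∈ U (k a))
    {M' : K → Type*} [∀ k, AddCommMonoid (M' k)] [∀ k, Module R (M' k)] (P : ∀ k, M →ₗ[R] M' k)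
    (hP : ∀ k k', k' ≠ k → ∀ x ∈ U k', P k x = 0) (hinj : ∀ k, Set.InjOn (P k) (U k))
    (k₀ : K) : Submodule.span R (Set.range fun a : {a // k a = k₀} => b a) = U k₀ := by
  classical
  refine le_antisymm ?_ fun x hx => ?_
  · rw [Submodule.span_le]
    rintro _ ⟨⟨a, rfl⟩, rfl⟩
    exact hb a
  · set s := (b.repr x).support
    have hsum : x = ∑ a ∈ s, b.repr x a • b a := by
      conv_lhs => rw [← b.linearCombination_repr x]
      rfl
    set y := ∑ a ∈ s with k a = k₀, b.repr x a • b a with hy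
    have hyU : y ∈ U k₀ := by
      refine Submodule.sum_mem _ fun a ha => Submodule.smul_mem _ _ ?_
      rw [← (Finset.mem_filter.mp ha).2]
      exact hb a
    have hxy : x = y + ∑ a ∈ s with ¬ k a = k₀, b.repr x a • b a := by
      rw [hy, Finset.sum_filter_add_sum_filter_not]
      exact hsum
    have h0 : P k₀ x = P k₀ y := by
      conv_lhs => rw [hxy, map_add]
      refine (congrArg (P k₀ y + ·) ?_).trans (add_zero _)
      rw [map_sum]
      refine Finset.sum_eq_zero fun a ha => ?_
      rw [map_smul, hP k₀ (k a) (Finset.mem_filter.mp ha).2 _ (hb a), smul_zero]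
    rw [hinj k₀ hx hyU h0]
    refine Submodule.sum_mem _ fun a ha => Submodule.smul_mem _ _ (Submodule.subset_span ?_)
    exact ⟨⟨a, (Finset.mem_filter.mp ha).2⟩, rfl⟩

theorem card_eq_finrank_of_adapted {R M K ι : Type*} [Field R] [AddCommMonoid M] [Module R M]
    [Fintype ι] (b : Module.Basis ι R M) (U : K → Submodule R M) (k : ι → K)
    (hb : ∀ a, b a ∈ U (k a))
    {M' : K → Type*} [∀ k, AddCommMonoid (M' k)] [∀ k, Module R (M' k)] (P : ∀ k, M →ₗ[R] M' k)
    (hP : ∀ k k', k' ≠ k → ∀ x ∈ U k', P k x = 0) (hinj : ∀ k, Set.InjOn (P k) (U k))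
    (k₀ : K) [DecidablePred fun a => k a = k₀] :
    (Finset.univ.filter fun a => k a = k₀).card = Module.finrank R (U k₀) := by
  have h := Module.finrank_eq_card_basis (Module.Basis.span
    (b.linearIndependent.comp (Subtype.val : {a // k a = k₀} → ι) Subtype.val_injective))
  rw [show Submodule.span R (Set.range (b ∘ (Subtype.val : {a // k a = k₀} → ι))) = U k₀ from
    span_eq_of_adapted b U k hb P hP hinj k₀] at h
  rw [h, Fintype.card_subtype]

end AdaptedBasis

section Parity

variable {n : ℕ} {W : MvPolynomial (Fin n) ℂ} {q : Fin n → ℚ}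

open Classical in
/-- The projection of the state space to the sectors with `N_γ ≡ e` modulo `2`. -/
noncomputable def parityProj (G : Subgroup (diagSym W)) (e : ZMod 2) :
    StateSpace G →ₗ[ℂ] StateSpace G :=
  DirectSum.toModule ℂ G _ fun γ =>
    if (fixDim (γ : Fin n → ℂˣ) : ZMod 2) = e then ket G γ else 0

open Classical in
theorem parityProj_ket (G : Subgroup (diagSym W)) (e : ZMod 2) (γ : G) (x : sector G γ) :
    parityProj G e (ket G γ x) =
      if (fixDim (γ : Fin n → ℂˣ) : ZMod 2) = e then ket G γ x else 0 := by
  rw [parityProj, ket, DirectSum.toModule_lof]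
  split_ifs <;> rfl

theorem parityProj_of_mem (G : Subgroup (diagSym W)) {e e' : ZMod 2} {x : StateSpace G}
    (hx : x ∈ parityPart G e') : parityProj G e x = if e' = e then x else 0 := by
  classical
  rw [parityPart] at hx
  have hle : (⨆ (γ : G) (_ : (fixDim (γ : Fin n → ℂˣ) : ZMod 2) = e'),
      LinearMap.range (ket G γ)) ≤
      LinearMap.eqLocus (parityProj G e) (if e' = e then LinearMap.id else 0) := by
    refine iSup₂_le fun γ hγ => ?_
    rintro _ ⟨y, rfl⟩
    rw [LinearMap.mem_eqLocus, parityProj_ket, hγ]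
    split_ifs <;> rfl
  have := hle hx
  rw [LinearMap.mem_eqLocus] at this
  rw [this]
  split_ifs <;> rfl

/-- Every member lies in one parity part, so the members of given parity are a basis of that part.
-/
theorem HomogeneousBasis.eulerChar_eq_superDim {G : Subgroup (diagSym W)} {ι : Type*} [Fintype ι]
    (φ : HomogeneousBasis q G ι) : φ.eulerChar = superDim G := by
  classical
  set k : ι → ZMod 2 := fun a => (fixDim (φ.γ a : Fin n → ℂˣ) : ZMod 2) with hk
  have hb : ∀ a, φ.basis a ∈ parityPart G (k a) := by
    intro a
    rw [φ.basis_eq]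
    exact Submodule.mem_iSup_of_mem (φ.γ a) (Submodule.mem_iSup_of_mem rfl ⟨_, rfl⟩)
  have hcard := card_eq_finrank_of_adapted (M := StateSpace G)
    (M' := fun _ => StateSpace G) φ.basis (parityPart G) k hb (parityProj G)
    (fun e e' hne x hx => by rw [parityProj_of_mem G hx, if_neg hne])
    (fun e x hx y hy h => by
      rwa [parityProj_of_mem G hx, parityProj_of_mem G hy, if_pos rfl, if_pos rfl] at h)
  rw [superDim, ← hcard, ← hcard, HomogeneousBasis.eulerChar, Finset.card_filter,
    Finset.card_filter]
  push_cast
  rw [← Finset.sum_sub_distrib]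
  refine Finset.sum_congr rfl fun a _ => ?_
  rw [HomogeneousBasis.sign]
  rcases Nat.even_or_odd (fixDim (φ.γ a : Fin n → ℂˣ)) with h | h
  · have h0 : k a = 0 := (ZMod.natCast_eq_zero_iff_even).mpr h
    rw [h.neg_one_pow, h0]
    simp
  · have h0 : k a = 1 := (ZMod.natCast_eq_one_iff_odd).mpr h
    rw [h.neg_one_pow, h0]
    simp

end Parity

/-! ### The grading by weight and character. -/

section Bigrading

variable {n : ℕ} {W : MvPolynomial (Fin n) ℂ} {q : Fin n → ℚ}

/-- The `i`-th coordinate as a character of a group of diagonal symmetries. -/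
noncomputable def coordChar (G : Subgroup (diagSym W)) (i : Fin n) : G →* ℂˣ where
  toFun γ := (γ : Fin n → ℂˣ) i
  map_one' := rfl
  map_mul' _ _ := rfl

/-- Pairs of a weight and a character of the group of symmetries. -/
noncomputable def Bidegree (G : Subgroup (diagSym W)) : Type := ℚ × Additive (G →* ℂˣ)

noncomputable instance (G : Subgroup (diagSym W)) : AddCommGroup (Bidegree G) :=
  inferInstanceAs (AddCommGroup (ℚ × Additive (G →* ℂˣ)))

/-- The bidegree with weight `r` and character `ψ`. -/
noncomputable def Bidegree.mk {G : Subgroup (diagSym W)} (r : ℚ) (ψ : G →* ℂˣ) : Bidegree G :=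
  (r, Additive.ofMul ψ)

/-- The weight of a bidegree. -/
noncomputable def Bidegree.weight {G : Subgroup (diagSym W)} : Bidegree G →+ ℚ :=
  AddMonoidHom.fst ℚ (Additive (G →* ℂˣ))

/-- The character of a bidegree. -/
noncomputable def Bidegree.char {G : Subgroup (diagSym W)} : Multiplicative (Bidegree G) →*
    (G →* ℂˣ) :=
  AddMonoidHom.toMultiplicativeLeft (AddMonoidHom.snd ℚ (Additive (G →* ℂˣ)))

theorem Bidegree.ext {G : Subgroup (diagSym W)} {ξ η : Bidegree G} (h : ξ.weight = η.weight)
    (h' : Bidegree.char (.ofAdd ξ) = Bidegree.char (.ofAdd η)) : ξ = η :=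
  Prod.ext h h'

/-- The weight of `x i` together with the character through which the symmetries act on it. -/
noncomputable def biweight (q : Fin n → ℚ) (G : Subgroup (diagSym W)) (i : Fin n) :
    Bidegree G :=
  .mk (q i) (coordChar G i)

/-- The restriction of `biweight` to the coordinates of `Fix(γ)`. -/
noncomputable def fixBiweight (q : Fin n → ℚ) (G : Subgroup (diagSym W)) (γ : Fin n → ℂˣ)
    (i : FixIdx γ) : Bidegree G :=
  biweight q G i

theorem weight_comp_eq {σ : Type*} {G : Subgroup (diagSym W)} (r : σ → ℚ) (ψ : σ → G →* ℂˣ)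
    (m : σ →₀ ℕ) : Finsupp.weight (fun i => Bidegree.mk (r i) (ψ i)) m =
      Bidegree.mk (Finsupp.weight r m) (m.prod fun i k => ψ i ^ k) := by
  rw [Finsupp.weight_apply, Finsupp.weight_apply, Finsupp.sum, Finsupp.sum, Finsupp.prod]
  refine Bidegree.ext ?_ ?_
  · rw [map_sum]
    rfl
  · rw [ofAdd_sum, map_prod]
    rfl

theorem weight_fixBiweight (q : Fin n → ℚ) (G : Subgroup (diagSym W)) (γ : Fin n → ℂˣ)
    (m : FixIdx γ →₀ ℕ) :
    Finsupp.weight (fixBiweight q G γ) m =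
      .mk (Finsupp.weight (fun i : FixIdx γ => q i) m) (m.prod fun i k => coordChar G i ^ k) :=
  weight_comp_eq _ _ m

theorem weight_biweight (q : Fin n → ℚ) (G : Subgroup (diagSym W)) (m : Fin n →₀ ℕ) :
    Finsupp.weight (biweight q G) m =
      .mk (Finsupp.weight q m) (m.prod fun i k => coordChar G i ^ k) :=
  weight_comp_eq _ _ m

theorem finite_weight_fibre {σ : Type*} [Finite σ] {q : σ → ℚ} (hq : ∀ i, 0 < q i) (r : ℚ) :
    {m : σ →₀ ℕ | Finsupp.weight q m = r}.Finite := by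
  classical
  have := Fintype.ofFinite σ
  refine Set.Finite.subset (Finset.finite_toSet (Finset.Iic
    (Finsupp.equivFunOnFinite.symm fun i => ⌊r / q i⌋₊))) fun m hm => ?_
  rw [Finset.mem_coe, Finset.mem_Iic]
  intro i
  change m i ≤ ⌊r / q i⌋₊
  have hm : Finsupp.weight q m = r := hm
  rw [Finsupp.weight_apply, Finsupp.sum_fintype _ _ (by simp)] at hm
  have h1 : m i • q i ≤ r := by
    rw [← hm]
    exact Finset.single_le_sum (f := fun i => m i • q i)
      (fun j _ => nsmul_nonneg (hq j).le _) (Finset.mem_univ i)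
  refine Nat.le_floor ?_
  rw [le_div_iff₀ (hq i)]
  simpa using h1

theorem finite_fixBiweight_fibre (hW : IsNondegenerate W q) (G : Subgroup (diagSym W))
    (γ : Fin n → ℂˣ) (ξ : Bidegree G) :
    {m : FixIdx γ →₀ ℕ | Finsupp.weight (fixBiweight q G γ) m = ξ}.Finite := by
  refine (finite_weight_fibre (q := fun i : FixIdx γ => q i)
    (fun i => hW.weight_pos i) ξ.weight).subset fun m hm => ?_
  have hm : Finsupp.weight (fixBiweight q G γ) m = ξ := hm
  rw [weight_fixBiweight] at hm
  exact congrArg Bidegree.weight hm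

theorem isWeightedHomogeneous_biweight (hW : IsNondegenerate W q) (G : Subgroup (diagSym W)) :
    IsWeightedHomogeneous (biweight q G) W (.mk 1 1) := by
  intro m hm
  rw [weight_biweight, hW.quasihomogeneous hm]
  congr 1
  ext g
  have := prod_pow_eq_one_of_mem_diagSym (g : diagSym W).2 hm
  rw [Finsupp.prod, MonoidHom.finsetProd_apply]
  exact congrArg Units.val this

theorem isWeightedHomogeneous_pderiv_restrictFix (hW : IsNondegenerate W q)
    (G : Subgroup (diagSym W)) (γ : Fin n → ℂˣ) (i : FixIdx γ) :
    IsWeightedHomogeneous (fixBiweight q G γ) (pderiv i (restrictFix γ W))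
      (.mk 1 1 - fixBiweight q G γ i) := by
  have h : IsWeightedHomogeneous (fixBiweight q G γ) (restrictFix γ W) (.mk 1 1) :=
    isWeightedHomogeneous_restrictFix (isWeightedHomogeneous_biweight hW G) γ
  exact h.pderiv (sub_add_cancel (Bidegree.mk 1 1) (fixBiweight q G γ i))

theorem pderiv_restrictFix_mem_originIdeal (hW : IsNondegenerate W q) (γ : Fin n → ℂˣ)
    (i : FixIdx γ) : pderiv i (restrictFix γ W) ∈ originIdeal (FixIdx γ) ℂ := by
  rw [mem_originIdeal]
  by_contra h
  -- A nonzero constant term would have weight `0`, but the derivative has weight `1 - q i ≥ 1 / 2`.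
  -- Only the weight is read off, so the choice `⊥` of group is immaterial.
  have h1 := isWeightedHomogeneous_pderiv_restrictFix hW ⊥ γ i h
  rw [map_zero] at h1
  have h2 : (0 : ℚ) = 1 - q i := congrArg Bidegree.weight h1
  have := hW.weight_le_half i
  linarith

theorem isHomogeneousIdeal_jacobianIdeal_weight (hW : IsNondegenerate W q) (γ : Fin n → ℂˣ) :
    IsHomogeneousIdeal (fun i : FixIdx γ => q i) (jacobianIdeal (restrictFix γ W)) := by
  refine isHomogeneousIdeal_span ?_
  rintro _ ⟨i, rfl⟩
  exact ⟨1 - q i, (isWeightedHomogeneous_restrictFix hW.quasihomogeneous γ).pderiv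
    (sub_add_cancel _ _)⟩

theorem IsWeightedHomogeneous.of_fixBiweight {G : Subgroup (diagSym W)} {γ : Fin n → ℂˣ}
    {p : MvPolynomial (FixIdx γ) ℂ} {ξ : Bidegree G}
    (hp : IsWeightedHomogeneous (fixBiweight q G γ) p ξ) :
    IsWeightedHomogeneous (fun i : FixIdx γ => q i) p ξ.weight := by
  intro m hm
  have := hp hm
  rw [weight_fixBiweight] at this
  exact congrArg Bidegree.weight this

end Bigrading

end LG

/-! ### Sectors as invariant bidegrees of Jacobian algebras, and homogeneous bases. -/

namespace LG

open MvPolynomial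

section SpanningBasis

theorem exists_basis_of_span_eq_top {K V : Type*} [Field K] [AddCommMonoid V] [Module K V]
    [Module.Finite K V] (s : Set V) (hs : Submodule.span K s = ⊤) :
    ∃ (N : ℕ) (b : Module.Basis (Fin N) K V), ∀ i, b i ∈ s := by
  let _ := Module.addCommMonoidToAddCommGroup K (M := V)
  obtain ⟨t, hts, hspan, hli⟩ := exists_linearIndependent K s
  let b : Module.Basis t K V := Module.Basis.mk hli (by
    rw [Subtype.range_coe, hspan, hs])
  have : Finite t := Module.Finite.finite_basis b
  obtain ⟨N, ⟨e⟩⟩ := Finite.exists_equiv_fin t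
  refine ⟨N, b.reindex e, fun i => ?_⟩
  rw [Module.Basis.reindex_apply, Module.Basis.mk_apply]
  exact hts (e.symm i).2

end SpanningBasis

theorem sum_coe_character {H : Type*} [CommGroup H] [Fintype H] (ψ : H →* ℂˣ) [Decidable (ψ = 1)] :
    ∑ g, (ψ g : ℂ) = if ψ = 1 then (Fintype.card H : ℂ) else 0 := by
  classical
  have h := sum_hom_units ((Units.coeHom ℂ).comp ψ)
  have hiff : (Units.coeHom ℂ).comp ψ = 1 ↔ ψ = 1 := by
    constructor
    · intro h
      ext g
      exact DFunLike.congr_fun h g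
    · rintro rfl
      ext
      simp
  simp only [hiff] at h
  refine Eq.trans ?_ (h.trans ?_)
  · rfl
  · split_ifs <;> simp

section Sector

variable {n : ℕ} {W : MvPolynomial (Fin n) ℂ} {q : Fin n → ℚ} {G : Subgroup (diagSym W)}

/-- The character through which the symmetries act on the top form of `Fix(γ)`. -/
noncomputable def volumeChar (G : Subgroup (diagSym W)) (γ : Fin n → ℂˣ) : G →* ℂˣ :=
  ∏ i : FixIdx γ, coordChar G i

theorem volumeChar_apply (γ : Fin n → ℂˣ) (g : G) :
    (volumeChar G γ g : ℂ) = ∏ i : FixIdx γ, (((g : diagSym W) : Fin n → ℂˣ) i : ℂ) := by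
  rw [volumeChar, MonoidHom.finsetProd_apply, Units.coe_prod]
  rfl

/-- The bidegree of the coefficients of invariant forms of coefficient weight `r`. -/
noncomputable def invDegree (G : Subgroup (diagSym W)) (γ : Fin n → ℂˣ) (r : ℚ) : Bidegree G :=
  .mk r (volumeChar G γ)⁻¹

theorem formAct_mk (γ : Fin n → ℂˣ) (g : G) (p : MvPolynomial (FixIdx γ) ℂ) :
    formAct (restrictSym γ (g : diagSym W)) (Ideal.Quotient.mk (jacobianIdeal (restrictFix γ W)) p) =
      Ideal.Quotient.mk _ (C (volumeChar G γ g : ℂ) *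
        scale (fun i : FixIdx γ => ((g : diagSym W) : Fin n → ℂˣ) i) p) := by
  rw [C_mul', volumeChar_apply]
  rfl

theorem formAct_mk_eq_self {γ : Fin n → ℂˣ} {r : ℚ} {p : MvPolynomial (FixIdx γ) ℂ}
    (hp : IsWeightedHomogeneous (fixBiweight q G γ) p (invDegree G γ r)) (g : G) :
    C (volumeChar G γ g : ℂ) * scale (fun i : FixIdx γ => ((g : diagSym W) : Fin n → ℂˣ) i) p
      = p := by
  ext m
  rw [coeff_C_mul, coeff_scale]
  by_cases hm : coeff m p = 0
  · simp [hm]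
  have h := hp hm
  rw [weight_fixBiweight] at h
  have h1 : (m.prod fun i k => coordChar G i ^ k) = (volumeChar G γ)⁻¹ :=
    congrArg (fun ξ => Bidegree.char (.ofAdd ξ)) h
  have h2 := DFunLike.congr_fun h1 g
  rw [Finsupp.prod, MonoidHom.finsetProd_apply] at h2
  have h3 : (m.prod fun i k => ((g : diagSym W) : Fin n → ℂˣ) i ^ k) = (volumeChar G γ g)⁻¹ := h2
  rw [h3, ← mul_assoc, ← Units.val_mul, mul_inv_cancel, Units.val_one, one_mul]

theorem mk_mem_sector {γ : G} {r : ℚ} {p : MvPolynomial (FixIdx (γ : Fin n → ℂˣ)) ℂ}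
    (hp : IsWeightedHomogeneous (fixBiweight q G γ) p (invDegree G γ r)) :
    Ideal.Quotient.mk (jacobianIdeal (restrictFix (γ : Fin n → ℂˣ) W)) p ∈ sector G γ := by
  intro g hg
  have := formAct_mk (γ : Fin n → ℂˣ) ⟨g, hg⟩ p
  rw [formAct_mk_eq_self hp] at this
  exact this

/-- The class in the sector `H_γ` of a polynomial in the bidegree of invariant forms. -/
noncomputable def sectorMap (q : Fin n → ℚ) (G : Subgroup (diagSym W)) (γ : G) (r : ℚ) :
    weightedHomogeneousSubmodule ℂ (fixBiweight q G γ) (invDegree G γ r) →ₗ[ℂ] sector G γ :=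
  LinearMap.codRestrict (sector G γ)
    ((Ideal.Quotient.mkₐ ℂ (jacobianIdeal (restrictFix (γ : Fin n → ℂˣ) W))).toLinearMap ∘ₗ
      Submodule.subtype _) fun p => mk_mem_sector p.2

theorem coe_sectorMap (γ : G) (r : ℚ)
    (p : weightedHomogeneousSubmodule ℂ (fixBiweight q G γ) (invDegree G γ r)) :
    (sectorMap q G γ r p : Jac (restrictFix (γ : Fin n → ℂˣ) W)) =
      Ideal.Quotient.mk _ (p : MvPolynomial (FixIdx (γ : Fin n → ℂˣ)) ℂ) := rfl

/-- The part of the state space coming from forms of coefficient weight `r` in the sector `γ`. -/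
noncomputable def sectorPart (q : Fin n → ℚ) (G : Subgroup (diagSym W)) (k : G × ℚ) :
    Submodule ℂ (StateSpace G) :=
  (LinearMap.range (sectorMap q G k.1 k.2)).map (ket G k.1)

theorem component_ket (γ : G) (x : sector G γ) :
    DirectSum.component ℂ G (fun γ => sector G γ) γ (ket G γ x) = x := by
  classical
  exact DirectSum.component.lof_self _ _ _

theorem component_ket_of_ne {γ γ' : G} (h : γ' ≠ γ) (x : sector G γ') :
    DirectSum.component ℂ G (fun γ => sector G γ) γ (ket G γ' x) = 0 := by
  classical
  rw [ket, DirectSum.component.of, dif_neg h]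

theorem ket_injective (γ : G) : Function.Injective (ket G γ) :=
  Function.LeftInverse.injective (component_ket γ)

/-- Rank and nullity: the kernel of the class map is the part of the Jacobian ideal in the invariant
bidegree. -/
theorem finrank_sectorPart (hW : IsNondegenerate W q) (γ : G) (r : ℚ) :
    (Module.finrank ℂ (sectorPart q G (γ, r)) : ℤ) =
      hilb (fixBiweight q G γ) (jacobianIdeal (restrictFix (γ : Fin n → ℂˣ) W))
        (invDegree G γ r) := by
  have := finiteDimensional_weightedHomogeneousSubmodule (k := ℂ)
    (finite_fixBiweight_fibre hW G γ) (invDegree G γ r)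
  have h1 : Module.finrank ℂ (sectorPart q G (γ, r)) =
      Module.finrank ℂ (LinearMap.range (sectorMap q G γ r)) :=
    (LinearEquiv.finrank_eq (Submodule.equivMapOfInjective _ (ket_injective γ) _)).symm
  have h2 := LinearMap.finrank_range_add_finrank_ker (sectorMap q G γ r)
  have h3 : (LinearMap.ker (sectorMap q G γ r)).map (Submodule.subtype _) =
      idealPart (fixBiweight q G γ) (jacobianIdeal (restrictFix (γ : Fin n → ℂˣ) W))
        (invDegree G γ r) := by
    ext p
    rw [mem_idealPart, Submodule.mem_map]
    constructor
    · rintro ⟨p, hp, rfl⟩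
      rw [LinearMap.mem_ker] at hp
      have := congrArg Subtype.val hp
      rw [coe_sectorMap] at this
      exact ⟨p.2, Ideal.Quotient.eq_zero_iff_mem.mp this⟩
    · rintro ⟨hp, hpI⟩
      refine ⟨⟨p, hp⟩, ?_, rfl⟩
      rw [LinearMap.mem_ker]
      exact Subtype.ext (Ideal.Quotient.eq_zero_iff_mem.mpr hpI)
  have h4 := Submodule.finrank_map_subtype_eq _ (LinearMap.ker (sectorMap q G γ r))
  rw [hilb, ← h3, h4, h1, ← h2]
  push_cast
  ring

/-- The projection of the Jacobian algebra to classes of weight `r`. -/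
noncomputable def weightProj (hW : IsNondegenerate W q) (γ : Fin n → ℂˣ) (r : ℚ) :
    Jac (restrictFix γ W) →ₗ[ℂ] Jac (restrictFix γ W) :=
  (Submodule.Quotient.restrictScalarsEquiv ℂ (jacobianIdeal (restrictFix γ W))).toLinearMap ∘ₗ
    Submodule.mapQ ((jacobianIdeal (restrictFix γ W)).restrictScalars ℂ)
      ((jacobianIdeal (restrictFix γ W)).restrictScalars ℂ)
      (weightedHomogeneousComponent (fun i : FixIdx γ => q i) r)
      (fun p hp => isHomogeneousIdeal_jacobianIdeal_weight hW γ p hp r) ∘ₗ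
    (Submodule.Quotient.restrictScalarsEquiv ℂ (jacobianIdeal (restrictFix γ W))).symm.toLinearMap

theorem weightProj_mk (hW : IsNondegenerate W q) (γ : Fin n → ℂˣ) (r : ℚ)
    (p : MvPolynomial (FixIdx γ) ℂ) :
    weightProj hW γ r (Ideal.Quotient.mk _ p) =
      Ideal.Quotient.mk _ (weightedHomogeneousComponent (fun i : FixIdx γ => q i) r p) := rfl

/-- The projection of the state space to the classes of coefficient weight `r` in a sector. -/
noncomputable def sectorProj (hW : IsNondegenerate W q) (G : Subgroup (diagSym W)) (k : G × ℚ) :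
    StateSpace G →ₗ[ℂ] Jac (restrictFix (k.1 : Fin n → ℂˣ) W) :=
  weightProj hW k.1 k.2 ∘ₗ (sector G k.1).subtype ∘ₗ
    DirectSum.component ℂ G (fun γ => sector G γ) k.1

theorem sectorProj_of_ne (hW : IsNondegenerate W q) {k k' : G × ℚ} (h : k' ≠ k)
    {x : StateSpace G} (hx : x ∈ sectorPart q G k') : sectorProj hW G k x = 0 := by
  classical
  obtain ⟨γ, r⟩ := k
  obtain ⟨γ', r'⟩ := k'
  obtain ⟨_, ⟨p, rfl⟩, rfl⟩ := hx
  by_cases hγ : γ' = γ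
  · subst hγ
    have hr : r ≠ r' := fun h' => h (by rw [h'])
    change weightProj hW _ r (DirectSum.component ℂ G (fun γ => sector G γ) γ' (ket G γ' _)).1 = 0
    rw [component_ket, coe_sectorMap, weightProj_mk,
      weightedHomogeneousComponent_of_mem (IsWeightedHomogeneous.of_fixBiweight p.2)]
    rw [if_neg, map_zero]
    exact fun h' => hr h'
  · change weightProj hW _ r (DirectSum.component ℂ G (fun γ => sector G γ) γ (ket G γ' _)).1 = 0
    rw [component_ket_of_ne hγ]
    exact map_zero _

theorem sectorProj_injOn (hW : IsNondegenerate W q) (k : G × ℚ) :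
    Set.InjOn (sectorProj hW G k) (sectorPart q G k) := by
  have key : ∀ p, sectorProj hW G k (ket G k.1 (sectorMap q G k.1 k.2 p)) =
      sectorMap q G k.1 k.2 p := by
    intro p
    change weightProj hW _ k.2 (DirectSum.component ℂ G (fun γ => sector G γ) k.1 (ket G k.1 _)).1
      = _
    rw [component_ket, coe_sectorMap, weightProj_mk]
    exact congrArg _ (weightedHomogeneousComponent_eq_self (IsWeightedHomogeneous.of_fixBiweight p.2))
  rintro _ ⟨_, ⟨p, rfl⟩, rfl⟩ _ ⟨_, ⟨p', rfl⟩, rfl⟩ h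
  rw [key, key] at h
  rw [Subtype.ext h]

/-- Averaging over the group of symmetries. -/
theorem coeff_sum_volumeChar_mul_scale [Fintype G] (γ : Fin n → ℂˣ)
    (p : MvPolynomial (FixIdx γ) ℂ) (m : FixIdx γ →₀ ℕ)
    [Decidable ((m.prod fun i k => coordChar G i ^ k) = (volumeChar G γ)⁻¹)] :
    coeff m (∑ g : G, C (volumeChar G γ g : ℂ) *
        scale (fun i : FixIdx γ => ((g : diagSym W) : Fin n → ℂˣ) i) p) =
      if (m.prod fun i k => coordChar G i ^ k) = (volumeChar G γ)⁻¹ then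
        (Fintype.card G : ℂ) * coeff m p else 0 := by
  classical
  have h := sum_coe_character (volumeChar G γ * m.prod fun i k => coordChar G i ^ k)
  rw [coeff_sum]
  have h1 : ∀ g : G, coeff m (C (volumeChar G γ g : ℂ) *
        scale (fun i : FixIdx γ => ((g : diagSym W) : Fin n → ℂˣ) i) p) =
      (((volumeChar G γ * m.prod fun i k => coordChar G i ^ k) g : ℂˣ) : ℂ) * coeff m p := by
    intro g
    rw [coeff_C_mul, coeff_scale, ← mul_assoc, MonoidHom.mul_apply, Units.val_mul, Finsupp.prod,
      Finsupp.prod, MonoidHom.finsetProd_apply]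
    rfl
  rw [Finset.sum_congr rfl fun g _ => h1 g, ← Finset.sum_mul, h]
  have hiff : (volumeChar G γ * m.prod fun i k => coordChar G i ^ k) = 1 ↔
      (m.prod fun i k => coordChar G i ^ k) = (volumeChar G γ)⁻¹ := by
    rw [MonoidHom.ext_iff, MonoidHom.ext_iff]
    exact forall_congr' fun g => mul_eq_one_iff_eq_inv'
  simp only [hiff]
  split_ifs <;> simp

theorem mk_sum_volumeChar_mul_scale [Fintype G] {γ : G}
    {p : MvPolynomial (FixIdx (γ : Fin n → ℂˣ)) ℂ}
    (hp : Ideal.Quotient.mk (jacobianIdeal (restrictFix (γ : Fin n → ℂˣ) W)) p ∈ sector G γ) :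
    Ideal.Quotient.mk (jacobianIdeal (restrictFix (γ : Fin n → ℂˣ) W))
      (∑ g : G, C (volumeChar G γ g : ℂ) *
        scale (fun i : FixIdx (γ : Fin n → ℂˣ) => ((g : diagSym W) : Fin n → ℂˣ) i) p) =
      (Fintype.card G : ℂ) • Ideal.Quotient.mk _ p := by
  rw [map_sum, Finset.sum_congr rfl fun g _ => (formAct_mk (γ : Fin n → ℂˣ) g p).symm,
    Finset.sum_congr rfl fun (g : G) _ => hp (g : diagSym W) g.2]
  simp [Nat.cast_smul_eq_nsmul]

/-- Only the class of `p` is invariant, not `p` itself. Averaging `p` over the group keeps the class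
and the weight and moves the representative into the bidegree of invariant forms. -/
theorem ket_mem_sectorPart [Finite G] {γ : G} {r : ℚ}
    {p : MvPolynomial (FixIdx (γ : Fin n → ℂˣ)) ℂ}
    (hr : IsWeightedHomogeneous (fun i : FixIdx (γ : Fin n → ℂˣ) => q i) p r)
    (hp : Ideal.Quotient.mk (jacobianIdeal (restrictFix (γ : Fin n → ℂˣ) W)) p ∈ sector G γ) :
    ket G γ ⟨_, hp⟩ ∈ sectorPart q G (γ, r) := by
  classical
  have := Fintype.ofFinite G
  have hcard : (Fintype.card G : ℂ) ≠ 0 := by exact_mod_cast Fintype.card_ne_zero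
  have h1 := mk_sum_volumeChar_mul_scale hp
  set P := ∑ g : G, C (volumeChar G γ g : ℂ) *
        scale (fun i : FixIdx (γ : Fin n → ℂˣ) => ((g : diagSym W) : Fin n → ℂˣ) i) p with hP
  have hPh : P ∈ weightedHomogeneousSubmodule ℂ (fixBiweight q G γ) (invDegree G γ r) := by
    intro m hm
    rw [hP, coeff_sum_volumeChar_mul_scale] at hm
    split_ifs at hm with h
    · rw [weight_fixBiweight, hr (right_ne_zero_of_mul hm), h]
      rfl
    · exact absurd rfl hm
  refine ⟨_, ⟨(Fintype.card G : ℂ)⁻¹ • ⟨P, hPh⟩, rfl⟩, ?_⟩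
  congr 1
  refine Subtype.ext ?_
  rw [map_smul, SetLike.val_smul, coe_sectorMap]
  change (Fintype.card G : ℂ)⁻¹ • Ideal.Quotient.mk _ P = _
  rw [h1, inv_smul_smul₀ hcard]

/-- Averaging a representative of an invariant class kills all monomials with the wrong character,
and each surviving monomial defines an invariant class by itself. -/
theorem span_sectorPart [Finite G] :
    Submodule.span ℂ (⋃ k : G × ℚ, (sectorPart q G k : Set (StateSpace G))) = ⊤ := by
  classical
  have := Fintype.ofFinite G
  have hcard : (Fintype.card G : ℂ) ≠ 0 := by exact_mod_cast Fintype.card_ne_zero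
  rw [eq_top_iff]
  rintro x -
  induction x using DirectSum.induction_on with
  | zero => exact Submodule.zero_mem _
  | add x y hx hy => exact Submodule.add_mem _ hx hy
  | of γ y =>
    obtain ⟨y, hy⟩ := y
    obtain ⟨p, rfl⟩ := Ideal.Quotient.mk_surjective y
    set V : Submodule ℂ (Jac (restrictFix (γ : Fin n → ℂˣ) W)) :=
      ((Submodule.span ℂ (⋃ k : G × ℚ, (sectorPart q G k : Set (StateSpace G)))).comap
        (ket G γ)).map (sector G γ).subtype with hV
    suffices h : Ideal.Quotient.mk _ p ∈ V by
      obtain ⟨z, hz, hzp⟩ := h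
      have : z = ⟨_, hy⟩ := Subtype.ext hzp
      rw [this] at hz
      exact hz
    have h1 := mk_sum_volumeChar_mul_scale hy
    have h2 : Ideal.Quotient.mk (jacobianIdeal (restrictFix (γ : Fin n → ℂˣ) W)) p =
        (Fintype.card G : ℂ)⁻¹ • Ideal.Quotient.mk _ (∑ g : G, C (volumeChar G γ g : ℂ) *
        scale (fun i : FixIdx (γ : Fin n → ℂˣ) => ((g : diagSym W) : Fin n → ℂˣ) i) p) := by
      rw [h1, inv_smul_smul₀ hcard]
    rw [h2]
    refine V.smul_mem _ ?_
    rw [as_sum (∑ g : G, C (volumeChar G γ g : ℂ) *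
        scale (fun i : FixIdx (γ : Fin n → ℂˣ) => ((g : diagSym W) : Fin n → ℂˣ) i) p), map_sum]
    refine V.sum_mem fun m hm => ?_
    rw [mem_support_iff, coeff_sum_volumeChar_mul_scale] at hm
    split_ifs at hm with h
    · have hmon : ∀ c : ℂ, IsWeightedHomogeneous (fixBiweight q G γ) (monomial m c)
          (invDegree G γ (Finsupp.weight (fun i : FixIdx (γ : Fin n → ℂˣ) => q i) m)) := by
        intro c
        refine isWeightedHomogeneous_monomial _ _ _ ?_
        rw [weight_fixBiweight, h]
        rfl
      refine ⟨sectorMap q G γ _ ⟨_, hmon _⟩, Submodule.subset_span ?_, rfl⟩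
      exact Set.mem_iUnion.mpr ⟨(γ, _), ⟨_, ⟨_, rfl⟩, rfl⟩⟩
    · exact absurd rfl hm

theorem exists_homogeneousBasis (hW : IsNondegenerate W q) (G : Subgroup (diagSym W)) :
    ∃ N : ℕ, Nonempty (HomogeneousBasis q G (Fin N)) := by
  classical
  have := finite_diagSym hW
  have hfin : ∀ γ : G, Module.Finite ℂ (sector G γ) := by
    intro γ
    have := finite_jac hW (γ : diagSym W).2
    infer_instance
  have hfinite : Module.Finite ℂ (StateSpace G) := by
    have := Fintype.ofFinite G
    exact Module.Finite.equiv
      (DirectSum.linearEquivFunOnFintype ℂ G fun γ => sector G γ).symm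
  obtain ⟨N, b, hb⟩ := exists_basis_of_span_eq_top _ (span_sectorPart (q := q) (G := G))
  simp only [Set.mem_iUnion] at hb
  choose k hk using hb
  have hk' : ∀ i, ∃ p : weightedHomogeneousSubmodule ℂ (fixBiweight q G (k i).1)
      (invDegree G (k i).1 (k i).2), ket G (k i).1 (sectorMap q G (k i).1 (k i).2 p) = b i := by
    intro i
    obtain ⟨_, ⟨p, rfl⟩, h⟩ := hk i
    exact ⟨p, h⟩
  choose p hp using hk'
  exact ⟨N, ⟨{
    basis := b
    γ := fun i => (k i).1
    f := fun i => (p i).1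
    d := fun i => (k i).2
    homogeneous := fun i => IsWeightedHomogeneous.of_fixBiweight (p i).2
    invariant := fun i => mk_mem_sector (p i).2
    basis_eq := fun i => (hp i).symm }⟩⟩

/-- The number of members of a homogeneous basis of given sector and weight is a value of the
Hilbert function of the Jacobian algebra. -/
theorem HomogeneousBasis.card_eq_hilb (hW : IsNondegenerate W q) {ι : Type*} [Fintype ι]
    (φ : HomogeneousBasis q G ι) (γ : G) (r : ℚ)
    [DecidablePred fun a => (φ.γ a, φ.d a) = (γ, r)] :
    ((Finset.univ.filter fun a => (φ.γ a, φ.d a) = (γ, r)).card : ℤ) =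
      hilb (fixBiweight q G γ) (jacobianIdeal (restrictFix (γ : Fin n → ℂˣ) W))
        (invDegree G γ r) := by
  have := finite_diagSym hW
  rw [← finrank_sectorPart hW, card_eq_finrank_of_adapted φ.basis (sectorPart q G)
    (fun a => (φ.γ a, φ.d a)) (fun a => ?_) (sectorProj hW G)
    (fun k k' h x hx => sectorProj_of_ne hW h hx) (sectorProj_injOn hW)]
  rw [φ.basis_eq]
  exact ket_mem_sectorPart (φ.homogeneous a) (φ.invariant a)

end Sector

end LG

/-! ### The generating series of the Hodge gradings as a sum over pairs of symmetries. -/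

namespace LG

section GeneratingSeries

variable {n : ℕ} {W : MvPolynomial (Fin n) ℂ} {q : Fin n → ℚ} {G : Subgroup (diagSym W)}

/-- The exponential of the weight twisted by the value of the character at `g`. -/
noncomputable def bidegreeEval (g : G) : Multiplicative (Bidegree G) →* PowerSeries ℂ where
  toFun ξ := PowerSeries.C ((Bidegree.char ξ g : ℂˣ) : ℂ) *
    expSeries ((Bidegree.weight ξ.toAdd : ℚ) : ℂ)
  map_one' := by
    rw [map_one, toAdd_one, map_zero, Rat.cast_zero, expSeries_zero, MonoidHom.one_apply,
      Units.val_one, map_one, mul_one]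
  map_mul' ξ η := by
    rw [map_mul, toAdd_mul, map_add, Rat.cast_add, expSeries_add, MonoidHom.mul_apply,
      Units.val_mul, map_mul]
    ring

theorem bidegreeEval_mk (g : G) (r : ℚ) (ψ : G →* ℂˣ) :
    bidegreeEval g (.ofAdd (Bidegree.mk r ψ)) = PowerSeries.C (ψ g : ℂ) * expSeries (r : ℂ) := rfl

/-- The Hilbert series of the Jacobian algebra of `W_γ`, twisted by `g`. -/
noncomputable def twistedHilb (q : Fin n → ℚ) (G : Subgroup (diagSym W)) (γ : Fin n → ℂˣ) (g : G) :
    PowerSeries ℂ :=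
  ∑ᶠ ξ, (MvPolynomial.hilb (fixBiweight q G γ) (jacobianIdeal (restrictFix γ W)) ξ :
    PowerSeries ℂ) * bidegreeEval g (.ofAdd ξ)

/-- `W` has weight `1` and trivial character, so its `i`-th derivative has weight `1 - q i` and the
inverse of the character of `x i`. -/
theorem prod_mul_twistedHilb (hW : IsNondegenerate W q) {γ : Fin n → ℂˣ} (hγ : γ ∈ diagSym W)
    (g : G) :
    (∏ i : FixIdx γ, (1 - PowerSeries.C (coordChar G i g : ℂ) * expSeries (q i : ℂ))) *
      twistedHilb q G γ g =
    ∏ i : FixIdx γ, (1 - PowerSeries.C ((coordChar G i g)⁻¹ : ℂˣ).1 *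
      expSeries (1 - (q i : ℂ))) := by
  have h := MvPolynomial.prod_mul_finsum_hilb (finite_fixBiweight_fibre hW G γ)
    (fun i => isWeightedHomogeneous_pderiv_restrictFix hW G γ i)
    (pderiv_restrictFix_mem_originIdeal hW γ)
    (fun i => X_mem_radical_jacobianIdeal hW hγ i) (bidegreeEval g)
  refine h.trans (Finset.prod_congr rfl fun i _ => ?_)
  congr 1
  have h1 : Bidegree.mk 1 1 - fixBiweight q G γ i =
      Bidegree.mk (1 - q i) (coordChar G i)⁻¹ := by
    refine Bidegree.ext ?_ ?_
    · rw [map_sub]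
      rfl
    · rw [ofAdd_sub, map_div]
      exact one_div (coordChar G i)
  rw [h1, bidegreeEval_mk, Rat.cast_sub, Rat.cast_one]
  rfl

/-- Orthogonality of characters keeps only the bidegrees whose character is inverse to that of the
top form. In those, the Hilbert function counts the basis members by coefficient weight. -/
theorem sum_volumeChar_mul_twistedHilb (hW : IsNondegenerate W q) [Fintype G] {ι : Type*}
    [Fintype ι] (φ : HomogeneousBasis q G ι) (γ : G) [DecidablePred fun a => φ.γ a = γ] :
    ∑ g : G, PowerSeries.C (volumeChar G γ g : ℂ) * twistedHilb q G γ g =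
      (Fintype.card G : PowerSeries ℂ) *
        ∑ a with φ.γ a = γ, expSeries (φ.d a : ℂ) := by
  classical
  set h := MvPolynomial.hilb (fixBiweight q G γ)
    (jacobianIdeal (restrictFix (γ : Fin n → ℂˣ) W)) with hh
  have hfin : h.support.Finite :=
    MvPolynomial.finite_support_hilb
      (fun i => X_mem_radical_jacobianIdeal hW (γ : diagSym W).2 i)
  have hsum : ∀ g : G, twistedHilb q G γ g =
      ∑ ξ ∈ hfin.toFinset, (h ξ : PowerSeries ℂ) * bidegreeEval g (.ofAdd ξ) := by
    intro g
    refine finsum_eq_sum_of_support_subset _ fun ξ hξ => ?_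
    rw [Set.Finite.coe_toFinset]
    intro h0
    exact hξ (by simp only [← hh, h0, Int.cast_zero, zero_mul])
  have hchar : ∀ ξ : Bidegree G, ∑ g : G, PowerSeries.C (volumeChar G γ g : ℂ) *
      bidegreeEval g (.ofAdd ξ) = if invDegree G γ ξ.weight = ξ then
        (Fintype.card G : PowerSeries ℂ) * expSeries (ξ.weight : ℂ) else 0 := by
    intro ξ
    have h1 := sum_coe_character (volumeChar G γ * Bidegree.char (.ofAdd ξ))
    have hiff : volumeChar G γ * Bidegree.char (.ofAdd ξ) = 1 ↔ invDegree G γ ξ.weight = ξ := by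
      have : volumeChar G γ * Bidegree.char (.ofAdd ξ) = 1 ↔
          (volumeChar G γ)⁻¹ = Bidegree.char (.ofAdd ξ) := by
        rw [MonoidHom.ext_iff, MonoidHom.ext_iff]
        exact forall_congr' fun g => mul_eq_one_iff_inv_eq
      rw [this]
      exact ⟨fun h => Bidegree.ext rfl h, fun h => congrArg (fun η => Bidegree.char (.ofAdd η)) h⟩
    simp only [hiff] at h1
    have h2 : ∀ g : G, PowerSeries.C (volumeChar G γ g : ℂ) * bidegreeEval g (.ofAdd ξ) =
        PowerSeries.C (((volumeChar G γ * Bidegree.char (.ofAdd ξ)) g : ℂˣ) : ℂ) *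
          expSeries (ξ.weight : ℂ) := by
      intro g
      rw [MonoidHom.mul_apply, Units.val_mul, map_mul, mul_assoc]
      rfl
    rw [Finset.sum_congr rfl fun g _ => h2 g, ← Finset.sum_mul, ← map_sum, h1]
    split_ifs <;> simp
  calc ∑ g : G, PowerSeries.C (volumeChar G γ g : ℂ) * twistedHilb q G γ g
      = ∑ ξ ∈ hfin.toFinset, (h ξ : PowerSeries ℂ) *
          ∑ g : G, PowerSeries.C (volumeChar G γ g : ℂ) * bidegreeEval g (.ofAdd ξ) := by
        simp only [hsum, Finset.mul_sum]
        rw [Finset.sum_comm]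
        refine Finset.sum_congr rfl fun ξ _ => Finset.sum_congr rfl fun g _ => ?_
        ring
    _ = (Fintype.card G : PowerSeries ℂ) * ∑ ξ ∈ hfin.toFinset with invDegree G γ ξ.weight = ξ,
          (h ξ : PowerSeries ℂ) * expSeries (ξ.weight : ℂ) := by
        rw [Finset.mul_sum, Finset.sum_filter]
        refine Finset.sum_congr rfl fun ξ _ => ?_
        rw [hchar]
        split_ifs <;> ring
    _ = _ := by
        congr 1
        have hcard : ∀ r : ℚ, h (invDegree G γ r) =
            (Finset.univ.filter fun a => (φ.γ a, φ.d a) = (γ, r)).card :=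
          fun r => (φ.card_eq_hilb hW γ r).symm
        rw [← Finset.sum_fiberwise_of_maps_to
          (t := hfin.toFinset.filter fun ξ => invDegree G γ ξ.weight = ξ)
          (g := fun a => invDegree G γ (φ.d a))]
        · refine Finset.sum_congr rfl fun ξ hξ => ?_
          have hξ' := (Finset.mem_filter.mp hξ).2
          have h1 : ((Finset.univ.filter fun a => φ.γ a = γ).filter
              fun a => invDegree G γ (φ.d a) = ξ) =
              Finset.univ.filter fun a => (φ.γ a, φ.d a) = (γ, ξ.weight) := by
            ext a
            simp only [Finset.mem_filter, Finset.mem_univ, true_and, Prod.mk.injEq]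
            refine and_congr_right fun _ => ⟨fun h => by rw [← h]; rfl, fun h => by rw [h, hξ']⟩
          rw [h1, ← hξ', hcard]
          rw [Finset.sum_congr rfl (g := fun _ => expSeries (ξ.weight : ℂ)) fun a ha => by
            have := (Finset.mem_filter.mp ha).2
            rw [(Prod.mk.inj this).2]
            rw [hξ'], Finset.sum_const, nsmul_eq_mul, hξ']
          push_cast
          rfl
        · intro a ha
          have ha' := (Finset.mem_filter.mp ha).2
          rw [Finset.mem_filter, Set.Finite.mem_toFinset]
          refine ⟨?_, rfl⟩
          rw [Function.mem_support, hcard, Nat.cast_ne_zero, ← Nat.pos_iff_ne_zero,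
            Finset.card_pos]
          exact ⟨a, by simp [ha']⟩

theorem expSeries_sum {ι : Type*} (s : Finset ι) (a : ι → ℂ) :
    expSeries (∑ i ∈ s, a i) = ∏ i ∈ s, expSeries (a i) := by
  classical
  induction s using Finset.induction_on with
  | empty => simp [expSeries_zero]
  | insert i s hi ih => rw [Finset.sum_insert hi, Finset.prod_insert hi, expSeries_add, ih]

theorem one_sub_C_mul_expSeries_ne_zero {r : ℂ} (hr : r ≠ 0) (w : ℂˣ) :
    1 - PowerSeries.C (w : ℂ) * expSeries r ≠ 0 := by
  intro h
  have := congrArg (PowerSeries.coeff 1) h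
  rw [map_sub, PowerSeries.coeff_C_mul, coeff_expSeries, PowerSeries.coeff_one] at this
  simp [hr] at this

/-- The factors of the generating series of the Hodge gradings, with their second jets. -/
theorem exists_hasJet_factor (hW : IsNondegenerate W q) (i : Fin n) (γ g : ℂˣ)
    [Decidable (γ = 1 ∧ g = 1)] :
    ∃ F : PowerSeries ℂ,
      HasJet F (if γ = 1 ∧ g = 1 then 1 - 1 / (q i : ℂ) else 1) (firstJet γ g)
        ((1 - 2 * (q i : ℂ)) * secondJet γ g) ∧
      (γ = 1 → F * (1 - PowerSeries.C (g : ℂ) * expSeries (q i : ℂ)) =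
        expSeries (1 / 2) - PowerSeries.C (g : ℂ) * expSeries ((q i : ℂ) - 1 / 2)) ∧
      (γ ≠ 1 → F = expSeries ((phase γ : ℂ) - 1 / 2)) := by
  classical
  by_cases hγ : γ = 1
  · subst hγ
    have hq : (q i : ℂ) ≠ 0 := by exact_mod_cast (hW.weight_pos i).ne'
    obtain ⟨F, h1, h2⟩ := exists_hasJet_fixed hq g
    refine ⟨F, ?_, fun _ => h1, fun h => absurd rfl h⟩
    convert h2 using 1
    simp
  · refine ⟨expSeries ((phase γ : ℂ) - 1 / 2), ?_, fun h => absurd h hγ, fun _ => rfl⟩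
    have := hasJet_expSeries ((phase γ : ℂ) - 1 / 2)
    rw [if_neg (fun h => hγ h.1), firstJet, secondJet, if_neg hγ, if_neg hγ, sawtooth, if_neg hγ,
      mul_zero]
    exact this

/-- Since `ĉ / 2` is the sum of the `1 / 2 - q i`, subtracting it turns `θ i - q i` into `θ i - 1 /
2`. At a fixed coordinate `θ i = 0`, and the form `dx i` adds `q i`. -/
theorem muPlus_eq {ι : Type*} (φ : HomogeneousBasis q G ι) (a : ι) :
    (φ.muPlus a : ℂ) = (φ.d a : ℂ) +
      (∑ i : FixIdx (φ.γ a : Fin n → ℂˣ), ((q i : ℂ) - 1 / 2) +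
        ∑ i : {i // ¬ (φ.γ a : Fin n → ℂˣ) i = 1},
          ((phase ((φ.γ a : Fin n → ℂˣ) i) : ℂ) - 1 / 2)) := by
  classical
  set γ := (φ.γ a : Fin n → ℂˣ) with hγ
  rw [HomogeneousBasis.muPlus, HomogeneousBasis.wt, degreeShift, centralCharge]
  push_cast
  rw [← hγ, add_assoc, add_sub_assoc, Finset.sum_div, add_sub_assoc, ← Finset.sum_sub_distrib]
  congr 1
  have h1 : ∑ i : FixIdx γ, ((phase (γ i) : ℂ) - (q i : ℂ) - (1 - 2 * (q i : ℂ)) / 2) +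
      ∑ i : {i // ¬ γ i = 1}, ((phase (γ i) : ℂ) - (q i : ℂ) - (1 - 2 * (q i : ℂ)) / 2) =
      ∑ i, ((phase (γ i) : ℂ) - (q i : ℂ) - (1 - 2 * (q i : ℂ)) / 2) := by
    rw [← Fintype.sum_subtype_add_sum_subtype (fun i => γ i = 1)]
    congr 1
    exact Finset.sum_congr (by ext; simp) fun _ _ => rfl
  rw [← h1, ← add_assoc]
  congr 1
  · rw [← Finset.sum_add_distrib]
    refine Finset.sum_congr rfl fun i _ => ?_
    rw [i.2, phase_one]
    push_cast
    ring
  · refine Finset.sum_congr rfl fun i _ => ?_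
    ring

/-- The contribution of a pair of symmetries to the generating series. -/
theorem neg_one_pow_mul_twistedHilb (hW : IsNondegenerate W q) (γ g : G) (F : Fin n → PowerSeries ℂ)
    (hfix : ∀ i, (γ : Fin n → ℂˣ) i = 1 →
      F i * (1 - PowerSeries.C (coordChar G i g : ℂ) * expSeries (q i : ℂ)) =
        expSeries (1 / 2) - PowerSeries.C (coordChar G i g : ℂ) * expSeries ((q i : ℂ) - 1 / 2))
    (hnon : ∀ i, (γ : Fin n → ℂˣ) i ≠ 1 →
      F i = expSeries ((phase ((γ : Fin n → ℂˣ) i) : ℂ) - 1 / 2)) :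
    (-1) ^ fixDim (γ : Fin n → ℂˣ) *
      expSeries (∑ i : FixIdx (γ : Fin n → ℂˣ), ((q i : ℂ) - 1 / 2) +
        ∑ i : {i // ¬ (γ : Fin n → ℂˣ) i = 1}, ((phase ((γ : Fin n → ℂˣ) i) : ℂ) - 1 / 2)) *
      (PowerSeries.C (volumeChar G γ g : ℂ) * twistedHilb q G γ g) = ∏ i, F i := by
  classical
  have hprod := prod_mul_twistedHilb hW (γ : diagSym W).2 g
  set D := ∏ i : FixIdx (γ : Fin n → ℂˣ),
    (1 - PowerSeries.C (coordChar G i g : ℂ) * expSeries (q i : ℂ)) with hD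
  have hD0 : D ≠ 0 := by
    refine Finset.prod_ne_zero_iff.mpr fun i _ => one_sub_C_mul_expSeries_ne_zero ?_ _
    exact_mod_cast (hW.weight_pos i).ne'
  -- The denominators may have zero constant term, so they are not inverted but cancelled in the
  -- domain of power series.
  refine mul_left_cancel₀ hD0 ?_
  have hFsplit : ∏ i, F i = (∏ i : FixIdx (γ : Fin n → ℂˣ), F i) *
      ∏ i : {i // ¬ (γ : Fin n → ℂˣ) i = 1}, F i := by
    rw [← Fintype.prod_subtype_mul_prod_subtype (fun i => (γ : Fin n → ℂˣ) i = 1) F]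
    congr 1
    exact Finset.prod_congr (by ext; simp) fun _ _ => rfl
  have hvol : PowerSeries.C (volumeChar G γ g : ℂ) =
      ∏ i : FixIdx (γ : Fin n → ℂˣ), PowerSeries.C (coordChar G i g : ℂ) := by
    rw [volumeChar_apply, map_prod]
    rfl
  have hsign : (-1 : PowerSeries ℂ) ^ fixDim (γ : Fin n → ℂˣ) =
      ∏ _i : FixIdx (γ : Fin n → ℂˣ), (-1) := by
    rw [Finset.prod_const, fixDim, Finset.card_univ]
  rw [expSeries_add, expSeries_sum, expSeries_sum, hsign, hvol, hFsplit,
    Finset.prod_congr rfl (g := fun i : {i // ¬ (γ : Fin n → ℂˣ) i = 1} =>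
      expSeries ((phase ((γ : Fin n → ℂˣ) i) : ℂ) - 1 / 2)) fun i _ => hnon i i.2]
  set Q := ∏ i : {i // ¬ (γ : Fin n → ℂˣ) i = 1},
    expSeries ((phase ((γ : Fin n → ℂˣ) i) : ℂ) - 1 / 2)
  have hfactor : ∀ i : FixIdx (γ : Fin n → ℂˣ),
      F i * (1 - PowerSeries.C (coordChar G i g : ℂ) * expSeries (q i : ℂ)) =
      -1 * expSeries ((q i : ℂ) - 1 / 2) * PowerSeries.C (coordChar G i g : ℂ) *
        (1 - PowerSeries.C ((coordChar G i g)⁻¹ : ℂˣ).1 * expSeries (1 - (q i : ℂ))) := by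
    intro i
    have h1 : expSeries (1 / 2) = expSeries ((q i : ℂ) - 1 / 2) * expSeries (1 - (q i : ℂ)) := by
      rw [← expSeries_add]
      congr 1
      ring
    have h2 : PowerSeries.C (coordChar G i g : ℂ) *
        PowerSeries.C ((coordChar G i g)⁻¹ : ℂˣ).1 = 1 := by
      rw [← map_mul, ← Units.val_mul, mul_inv_cancel, Units.val_one, map_one]
    rw [hfix i i.2, h1]
    linear_combination (-expSeries ((q i : ℂ) - 1 / 2) * expSeries (1 - (q i : ℂ))) * h2
  have hall := Finset.prod_congr (rfl : (Finset.univ : Finset (FixIdx (γ : Fin n → ℂˣ))) = _)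
    fun i _ => hfactor i
  simp only [Finset.prod_mul_distrib] at hall
  rw [← hD, ← hprod] at hall
  linear_combination (-Q) * hall

end GeneratingSeries

/-! ### The supertrace identity. -/

section Supertrace

variable {n : ℕ} {W : MvPolynomial (Fin n) ℂ} {q : Fin n → ℚ} {G : Subgroup (diagSym W)}

/-- The signed exponential generating series of the Hodge gradings is a sum over pairs of
symmetries. -/
theorem card_mul_sum_sign_mul_expSeries (hW : IsNondegenerate W q) [Fintype G] {ι : Type*}
    [Fintype ι] (φ : HomogeneousBasis q G ι) (F : Fin n → G → G → PowerSeries ℂ)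
    (hfix : ∀ i γ g, coordChar G i γ = 1 →
      F i γ g * (1 - PowerSeries.C (coordChar G i g : ℂ) * expSeries (q i : ℂ)) =
        expSeries (1 / 2) - PowerSeries.C (coordChar G i g : ℂ) * expSeries ((q i : ℂ) - 1 / 2))
    (hnon : ∀ i γ g, coordChar G i γ ≠ 1 →
      F i γ g = expSeries ((phase (coordChar G i γ) : ℂ) - 1 / 2)) :
    (Fintype.card G : PowerSeries ℂ) *
      ∑ a, (φ.sign a : PowerSeries ℂ) * expSeries (φ.muPlus a : ℂ) =
        ∑ γ, ∑ g, ∏ i, F i γ g := by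
  classical
  rw [← Finset.sum_fiberwise_of_maps_to (t := Finset.univ) (g := φ.γ)
    (fun _ _ => Finset.mem_univ _), Finset.mul_sum]
  refine Finset.sum_congr rfl fun γ _ => ?_
  rw [← Finset.sum_congr rfl fun g _ => neg_one_pow_mul_twistedHilb hW γ g (fun i => F i γ g)
    (fun i hi => hfix i γ g hi) (fun i hi => hnon i γ g hi), ← Finset.mul_sum,
    sum_volumeChar_mul_twistedHilb hW φ γ, mul_left_comm]
  congr 1
  rw [Finset.mul_sum]
  refine Finset.sum_congr rfl fun a ha => ?_
  have ha' := (Finset.mem_filter.mp ha).2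
  subst ha'
  rw [muPlus_eq, expSeries_add, HomogeneousBasis.sign]
  push_cast
  ring

/-- Compare the coefficients of `s ^ 0` and `s ^ 2` in the generating series: the vanishing of the
corrected second jet makes the latter a fixed multiple of the former. -/
theorem HomogeneousBasis.sum_sign_mul_muPlus_sq (hW : IsNondegenerate W q) {ι : Type*}
    [Fintype ι] (φ : HomogeneousBasis q G ι) :
    ∑ a, (φ.sign a : ℂ) * (φ.muPlus a : ℂ) ^ 2 =
      (centralCharge q : ℂ) / 12 * ∑ a, (φ.sign a : ℂ) := by
  classical
  have := finite_diagSym hW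
  have := Fintype.ofFinite G
  have hcard : (Fintype.card G : ℂ) ≠ 0 := by exact_mod_cast Fintype.card_ne_zero
  choose F hjet hfix hnon using fun (i : Fin n) (γ g : G) =>
    exists_hasJet_factor hW i (coordChar G i γ) (coordChar G i g)
  have hgen := card_mul_sum_sign_mul_expSeries hW φ F hfix hnon
  have hj : ∀ γ g : G, HasJet (∏ i, F i γ g) _ _ _ := fun γ g =>
    HasJet.prod Finset.univ fun i => hjet i γ g
  have hcast : (Fintype.card G : PowerSeries ℂ) = PowerSeries.C (Fintype.card G : ℂ) := by simp
  have hcast' : ∀ a, (φ.sign a : PowerSeries ℂ) = PowerSeries.C (φ.sign a : ℂ) := fun a => by simp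
  have h0 := congrArg (PowerSeries.coeff 0) hgen
  have h2 := congrArg (PowerSeries.coeff 2) hgen
  simp only [hcast, hcast', PowerSeries.coeff_C_mul, map_sum, coeff_expSeries] at h0 h2
  rw [Finset.sum_congr rfl fun γ _ => Finset.sum_congr rfl fun g _ => (hj γ g).coeff_zero] at h0
  rw [Finset.sum_congr rfl fun γ _ => Finset.sum_congr rfl fun g _ => (hj γ g).coeff_two] at h2
  have hz := sum_prod_mul_jets (coordChar G) (fun i => 1 - 2 * (q i : ℂ)) (fun i => 1 / (q i : ℂ))
  have hc : (centralCharge q : ℂ) = ∑ i, (1 - 2 * (q i : ℂ)) := by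
    rw [centralCharge]
    push_cast
    rfl
  -- The terms `-1 / 12` in `hz`, weighted by `1 - 2 q i`, add up to `-ĉ / 12`; the factor `1 / 2`
  -- of the second coefficient turns this into `ĉ / 24`.
  have hz' : ∑ γ : G, ∑ g : G, (∏ i, if coordChar G i γ = 1 ∧ coordChar G i g = 1 then
      1 - 1 / (q i : ℂ) else 1) * ((∑ i, firstJet (coordChar G i γ) (coordChar G i g)) ^ 2 +
        ∑ i, (1 - 2 * (q i : ℂ)) * secondJet (coordChar G i γ) (coordChar G i g)) / 2 =
      (centralCharge q : ℂ) / 24 * ∑ γ : G, ∑ g : G, ∏ i,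
        if coordChar G i γ = 1 ∧ coordChar G i g = 1 then 1 - 1 / (q i : ℂ) else 1 := by
    rw [← sub_eq_zero, Finset.mul_sum, ← Finset.sum_sub_distrib]
    refine Eq.trans ?_ ((congrArg (· / 2) hz).trans (zero_div _))
    simp only [Finset.sum_div, Finset.mul_sum, ← Finset.sum_sub_distrib]
    refine Finset.sum_congr rfl fun γ _ => Finset.sum_congr rfl fun g _ => ?_
    simp only [mul_sub, Finset.sum_sub_distrib, ← Finset.sum_mul, ← hc]
    ring
  rw [hz', ← h0] at h2
  simp only [pow_zero, Nat.factorial, Nat.cast_one, div_one, mul_one] at h2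
  refine mul_left_cancel₀ hcard ?_
  have h3 : ∑ a, (φ.sign a : ℂ) * (φ.muPlus a : ℂ) ^ 2 =
      2 * ∑ a, (φ.sign a : ℂ) * ((φ.muPlus a : ℂ) ^ 2 / ((2 * 1 : ℕ) : ℂ)) := by
    rw [Finset.mul_sum]
    refine Finset.sum_congr rfl fun a _ => ?_
    push_cast
    ring
  simp only [Nat.succ_eq_add_one, zero_add, mul_one, Nat.reduceAdd] at h2 h3
  rw [h3]
  linear_combination 2 * h2

theorem HomogeneousBasis.supertrace_eq (hW : IsNondegenerate W q) {ι : Type*}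
    [Fintype ι] (φ : HomogeneousBasis q G ι) :
    φ.supertrace = ((centralCharge q : ℝ) - 3) / 12 * (φ.eulerChar : ℝ) := by
  have h := φ.sum_sign_mul_muPlus_sq hW
  have h' : ∑ a, (φ.sign a : ℝ) * φ.muPlus a ^ 2 =
      (centralCharge q : ℝ) / 12 * ∑ a, (φ.sign a : ℝ) := by
    exact_mod_cast h
  rw [HomogeneousBasis.supertrace, HomogeneousBasis.eulerChar]
  have h1 : ∀ a, (φ.sign a : ℝ) * ((φ.muPlus a - 1 / 2) * (φ.muPlus a + 1 / 2)) =
      (φ.sign a : ℝ) * φ.muPlus a ^ 2 - 1 / 4 * (φ.sign a : ℝ) := fun a => by ring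
  rw [Finset.sum_congr rfl fun a _ => h1 a, Finset.sum_sub_distrib, h', ← Finset.mul_sum]
  push_cast
  ring

end Supertrace

end LG

theorem mainTheorem5 {n : ℕ} (W : MvPolynomial (Fin n) ℂ) (q : Fin n → ℚ)
    (hW : LG.IsNondegenerate W q) (G : Subgroup (LG.diagSym W)) (hG : LG.IsAdmissible hW G) :
    Finite G ∧
    (∃ N : ℕ, Nonempty (LG.HomogeneousBasis q G (Fin N))) ∧
    ∀ (ι : Type) [Fintype ι] (φ : LG.HomogeneousBasis q G ι),
      φ.eulerChar = LG.superDim G ∧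
      φ.supertrace = ((LG.centralCharge q : ℝ) - 3) / 12 * (φ.eulerChar : ℝ) := by
  have := LG.finite_diagSym hW
  exact ⟨inferInstance, LG.exists_homogeneousBasis hW G,
    fun ι _ φ => ⟨φ.eulerChar_eq_superDim, φ.supertrace_eq hW⟩⟩
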